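/- Let $k\ge 4$ be an integer. On $\mathbb C^4$ let $\Omega=dx_1\wedge dx_2+dx_3\wedge dx_4$, and put \[ \hat\psi(z)=\begin{pmatrix} z^3\\ \tfrac16\bigl(-6+13k-9k^2+2k^3+\tfrac{12(2k-3)}{k-3}z^k+3k(2k-3)z^k-6z^{2k}\bigr)\\ \tfrac12(2k-3)\,z\,(k-2+2z^k)\\ z^2(k-1+z^k)\end{pmatrix},\qquad z\in\mathbb C . \] Then the following hold. (1) The lift $\hat\psi$ defines a unique rational curve $\psi\colon\mathbb{CP}^1=\mathbb C\cup\{\infty\}\to\mathbb{CP}^3$. It is nondegenerate (not contained in any hyperplane), has degree $2k$, and is a contact curve: $\Omega(u\wedge u')=0$ for every local holomorphic lift $u$ of $\psi$. (2) Its branch points are exactly the $k$-th roots of unity, each of branch order $1$, and $z=\infty$, of branch order $k-3$; hence its total branch order is $2k-3$. (The branch order at a point is the order of vanishing of $u\wedge u'$ there, $u$ being a local holomorphic lift without zeros.) (3) Let $W=\{\eta\in\Lambda^2\mathbb C^4:\Omega(\eta)=0\}$ with the inner product $\tfrac12\Omega\wedge\Omega$, and $\mathbb C^5$ with $\langle x,y\rangle=-x_0y_4-x_4y_0+x_1y_1+x_2y_2+x_3y_3$.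 The second associated curve $\psi^2=[\hat\psi\wedge\hat\psi']\colon\mathbb{CP}^1\to PW$ is an unbranched null curve of degree $2k+1$ (that is, every local holomorphic lift $u$ of it has $\langle u,u\rangle=0=\langle u',u'\rangle$). Let \[ D(z)=4z\bigl((k-3)(k-1)^2(2k-3)-6(k-1)(2k-3)z^k-3(k-3)z^{2k}\bigr) \] and let $F=(F_1,F_2,F_3)\colon\mathbb C\setminus\{D=0\}\to\mathbb C^3$ be given by \[ F_1=\frac{-12\,i\,(k-3)(2k-3)\,z^2\,(2-3k+k^2-2z^k)}{D(z)}, \] \[ F_2=\frac{(k-1)\bigl(-12(3-2k)^2(k-2)z^k-12(k-3)(2k-3)z^{2k}+(k-3)((6-7k+2k^2)^2-12z^4)\bigr)}{D(z)}, \] \[ F_3=\frac{i\,(k-1)\bigl(12(3-2k)^2(k-2)z^k+12(k-3)(2k-3)z^{2k}+(k-3)(-(6-7k+2k^2)^2-12z^4)\bigr)}{D(z)} . \] There is a linear isometry $T\colon W\to\mathbb C^5$ such that $T\circ\psi^2=[\tfrac12(F_1^2+F_2^2+F_3^2),F_1,F_2,F_3,1]$ wherever $D\ne0$. (4) $f=\operatorname{Re}F$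 is a genus $0$ minimal surface in $\mathbb R^3$ with $2k+1$ embedded planar ends, located at the zeros of $D$. That is, there is a smooth conformal immersion $\phi\colon\mathbb{CP}^1\to S^3\subset\mathbb R^4$ which takes the value $N=(0,0,0,1)$ at exactly $2k+1$ points, these being the zeros of $D$; whose stereographic projection from $N$ (given by $x\mapsto (x_1,x_2,x_3)/(1-x_4)$) equals $\operatorname{Re}F$ at every $z\in\mathbb C$ with $D(z)\neq0$; and whose stereographic projection is a conformal minimal immersion into $\mathbb R^3$ on all of $\mathbb{CP}^1\setminus\phi^{-1}(N)$. Moreover $\phi$ is a Willmore sphere, i.e. a critical point, among immersions $\mathbb{CP}^1\to S^3$ under smooth variations, of $\mathcal W(\phi)=\int(H^2-K+1)\,dA$ (with $H$ the mean curvature in $S^3$, $K$ the curvature and $dA$ the area form of the induced metric), and $\mathcal W(\phi)=8\pi k$. -/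

import Mathlib

open scoped ContDiff Topology RealInnerProductSpace

noncomputable section

namespace WillmoreSphere

/-! ### The Riemann sphere and holomorphic curves in projective spaces -/

/-- The Riemann sphere `ℂ ∪ {∞}`. -/
abbrev CP1 := OnePoint ℂ

/-- The standard holomorphic coordinate of `CP1` centred at `p`: `w ↦ z₀ + w` for a finite point
`p = z₀`, and `w ↦ 1 / w` (with `0 ↦ ∞`) for `p = ∞`. -/
def coord : CP1 → ℂ → CP1
  | none, w => if w = 0 then OnePoint.infty else ((w⁻¹ : ℂ) : CP1)
  | some z₀, w => ((z₀ + w : ℂ) : CP1)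

section Curves

variable {V : Type*} [NormedAddCommGroup V] [NormedSpace ℂ V]

/-- `u` is a local holomorphic lift of `c` near `p`, in the coordinate centred at `p`. -/
def IsLiftAt (c : CP1 → Projectivization ℂ V) (p : CP1) (u : ℂ → V) : Prop :=
  AnalyticAt ℂ u 0 ∧ u 0 ≠ 0 ∧ ∀ᶠ w in 𝓝 (0 : ℂ), u w ∈ (c (coord p w)).submodule

/-- A holomorphic curve `CP1 → P(V)`: it has a local holomorphic lift near every point. -/
def IsHolomorphicCurve (c : CP1 → Projectivization ℂ V) : Prop :=
  ∀ p, ∃ u, IsLiftAt c p u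

/-- `c` is the holomorphic curve on `CP1` defined by the lift `h : ℂ → V`. -/
def IsCurveOfLift (h : ℂ → V) (c : CP1 → Projectivization ℂ V) : Prop :=
  IsHolomorphicCurve c ∧ ∀ z : ℂ, h z ≠ 0 → h z ∈ (c (z : CP1)).submodule

/-- The curve is not contained in any hyperplane. -/
def IsNondegenerate (c : CP1 → Projectivization ℂ V) : Prop :=
  ∀ l : V →ₗ[ℂ] ℂ, l ≠ 0 → ∃ p, ¬ (c p).submodule ≤ LinearMap.ker l

/-- A null curve for the bilinear form `B`: every local lift `u` satisfies
`B(u, u) = 0 = B(u', u')`. -/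
def IsNullCurve (B : V → V → ℂ) (c : CP1 → Projectivization ℂ V) : Prop :=
  ∀ p u, IsLiftAt c p u →
    ∀ᶠ w in 𝓝 (0 : ℂ), B (u w) (u w) = 0 ∧ B (deriv u w) (deriv u w) = 0

end Curves

/-- The decomposable bivector `v ∧ w`, given by its Plücker coordinates `v i w j - v j w i`. -/
def wedge {n : ℕ} (v w : Fin n → ℂ) : Fin n → Fin n → ℂ :=
  fun i j => v i * w j - v j * w i

/-- The branch order of a holomorphic curve at `p`: the order of vanishing at `p` of `u ∧ u'`,
where `u` is a local holomorphic lift without zeros (the order does not depend on the lift). -/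
def branchOrder {n : ℕ} (c : CP1 → Projectivization ℂ (Fin n → ℂ)) (p : CP1) : ℕ∞ :=
  ⨅ u : {u : ℂ → (Fin n → ℂ) // IsLiftAt c p u},
    analyticOrderAt (fun w => wedge (u.1 w) (deriv u.1 w)) 0

/-- `c` is a rational curve of degree `d`: in homogeneous coordinates `[x : y]` on `CP1`, with
`z = x / y`, it is `[∑ⱼ (P i).coeff j * x ^ j * y ^ (d - j)]ᵢ`, and these homogeneous polynomials
of degree `d` have no common zero on `CP1`. -/
def HasDegree {n : ℕ} (c : CP1 → Projectivization ℂ (Fin n → ℂ)) (d : ℕ) : Prop :=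
  ∃ P : Fin n → Polynomial ℂ,
    (∀ i, (P i).natDegree ≤ d) ∧
    (∀ z : ℂ, (fun i => (P i).eval z) ≠ 0 ∧
      (fun i => (P i).eval z) ∈ (c (z : CP1)).submodule) ∧
    (fun i => (P i).coeff d) ≠ 0 ∧
    (fun i => (P i).coeff d) ∈ (c OnePoint.infty).submodule

/-! ### Contact curves and the Klein correspondence -/

/-- `Ω = dx₁ ∧ dx₂ + dx₃ ∧ dx₄`, evaluated on the bivector with Plücker coordinates `η`. -/
def Omega (η : Fin 4 → Fin 4 → ℂ) : ℂ := η 0 1 + η 2 3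

/-- `c` is a contact curve: `Ω(u ∧ u') = 0` for every local holomorphic lift `u`. -/
def IsContactCurve (c : CP1 → Projectivization ℂ (Fin 4 → ℂ)) : Prop :=
  ∀ p u, IsLiftAt c p u → ∀ᶠ w in 𝓝 (0 : ℂ), Omega (wedge (u w) (deriv u w)) = 0

/-- `W = {η ∈ Λ²ℂ⁴ | Ω(η) = 0}`, a bivector `∑_{i<j} η i j eᵢ ∧ eⱼ` being represented by its
alternating array of coordinates. -/
def W : Submodule ℂ (Fin 4 → Fin 4 → ℂ) where
  carrier := {η | (∀ i j, η i j = - η j i) ∧ Omega η = 0}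
  zero_mem' := by simp [Omega]
  add_mem' := by
    rintro a b ⟨ha, ha0⟩ ⟨hb, hb0⟩
    refine ⟨fun i j => ?_, ?_⟩
    · simp only [Pi.add_apply]
      rw [ha i j, hb i j]
      ring
    · simp only [Omega, Pi.add_apply] at *
      linear_combination ha0 + hb0
  smul_mem' := by
    rintro r a ⟨ha, ha0⟩
    refine ⟨fun i j => ?_, ?_⟩
    · simp only [Pi.smul_apply, smul_eq_mul]
      rw [ha i j]
      ring
    · simp only [Omega, Pi.smul_apply, smul_eq_mul] at *
      linear_combination r * ha0

/-- The symmetric inner product `½ Ω ∧ Ω` on `W`, i.e. `(η, ξ) ↦ (dx₁∧dx₂∧dx₃∧dx₄)(η ∧ ξ)`. -/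
def kleinForm (η ξ : W) : ℂ :=
  η.1 0 1 * ξ.1 2 3 + η.1 2 3 * ξ.1 0 1 - η.1 0 2 * ξ.1 1 3 - η.1 1 3 * ξ.1 0 2
    + η.1 0 3 * ξ.1 1 2 + η.1 1 2 * ξ.1 0 3

/-- `c₂` is the second associated curve of `c`: the holomorphic curve in `P(W)` with
`c₂ = [u ∧ u']` (away from the isolated zeros of `u ∧ u'`) for every local lift `u` of `c`. -/
def IsSecondAssociatedCurve (c : CP1 → Projectivization ℂ (Fin 4 → ℂ))
    (c₂ : CP1 → Projectivization ℂ W) : Prop :=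
  IsHolomorphicCurve c₂ ∧
  ∀ p u, IsLiftAt c p u → ∀ᶠ w in 𝓝 (0 : ℂ),
    wedge (u w) (deriv u w) ∈ Submodule.map W.subtype (c₂ (coord p w)).submodule

/-- The inner product `-e₀⊗e₄ - e₄⊗e₀ + e₁⊗e₁ + e₂⊗e₂ + e₃⊗e₃` on `ℂ⁵`. -/
def form5 (x y : Fin 5 → ℂ) : ℂ :=
  - x 0 * y 4 - x 4 * y 0 + x 1 * y 1 + x 2 * y 2 + x 3 * y 3

/-- The representative `(½(z₁² + z₂² + z₃²), z₁, z₂, z₃, 1)` of the conformal embedding of `ℂ³`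
in the 3-quadric. -/
def Psi (x : Fin 3 → ℂ) : Fin 5 → ℂ :=
  ![(x 0 ^ 2 + x 1 ^ 2 + x 2 ^ 2) / 2, x 0, x 1, x 2, 1]

/-! ### Immersed spheres in the round 3-sphere and the Willmore functional -/

abbrev E3 := EuclideanSpace ℝ (Fin 3)

abbrev E4 := EuclideanSpace ℝ (Fin 4)

section Surfaces

variable {E : Type*} [NormedAddCommGroup E] [InnerProductSpace ℝ E]

/-- Partial derivative in the direction `v` (`v = 1` or `v = I` below). -/
def pd {F : Type*} [NormedAddCommGroup F] [NormedSpace ℝ F] (v : ℂ) (X : ℂ → F) : ℂ → F :=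
  fun z => fderiv ℝ X z v

/-- Coefficients `g₁₁, g₁₂, g₂₂` of the induced metric of `X`. -/
def g11 (X : ℂ → E) (z : ℂ) : ℝ := ⟪pd 1 X z, pd 1 X z⟫

def g12 (X : ℂ → E) (z : ℂ) : ℝ := ⟪pd 1 X z, pd Complex.I X z⟫

def g22 (X : ℂ → E) (z : ℂ) : ℝ := ⟪pd Complex.I X z, pd Complex.I X z⟫

def detg (X : ℂ → E) (z : ℂ) : ℝ := g11 X z * g22 X z - g12 X z ^ 2

/-- The Gauss curvature of the metric `E du² + 2 F du dv + G dv²`, by the formula of Brioschi. -/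
def metricCurvature (E F G : ℂ → ℝ) (z : ℂ) : ℝ :=
  (Matrix.det
      !![- pd Complex.I (pd Complex.I E) z / 2 + pd Complex.I (pd 1 F) z - pd 1 (pd 1 G) z / 2,
            pd 1 E z / 2, pd 1 F z - pd Complex.I E z / 2;
         pd Complex.I F z - pd 1 G z / 2, E z, F z;
         pd Complex.I G z / 2, F z, G z]
    - Matrix.det
      !![0, pd Complex.I E z / 2, pd 1 G z / 2;
         pd Complex.I E z / 2, E z, F z;
         pd 1 G z / 2, F z, G z]) / (E z * G z - F z ^ 2) ^ 2

/-- The curvature `K` of the induced metric of `X`. -/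
def gaussCurvature (X : ℂ → E) : ℂ → ℝ := metricCurvature (g11 X) (g12 X) (g22 X)

/-- The mean curvature vector (half the trace of the second fundamental form) at `z` of an immersed
surface `X` in a submanifold of `E` whose normal space at the point `X z` is spanned by `N`. The
second fundamental form is the component of the second derivatives of `X` orthogonal both to `N`
and to the surface. -/
def meanCurvatureVector [FiniteDimensional ℝ E] (N : Set E) (X : ℂ → E) (z : ℂ) : E :=
  ((Submodule.span ℝ (N ∪ {pd 1 X z, pd Complex.I X z}))ᗮ).starProjection
    ((2 * detg X z)⁻¹ • (g22 X z • pd 1 (pd 1 X) z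
      - (2 * g12 X z) • pd Complex.I (pd 1 X) z
      + g11 X z • pd Complex.I (pd Complex.I X) z))

end Surfaces

/-- A smooth immersion `φ : CP1 → S³ ⊂ ℝ⁴`. -/
def IsSphericalImmersion (φ : CP1 → E4) : Prop :=
  ∀ p, ‖φ p‖ = 1 ∧ ContDiffAt ℝ ∞ (fun w => φ (coord p w)) 0 ∧
    Function.Injective (fderiv ℝ (fun w => φ (coord p w)) 0)

/-- The Willmore functional `∫ (H² - K + 1) dA` of an immersion `φ : CP1 → S³`, the integral being
computed in the affine coordinate `z` (the point `∞` is a null set). -/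
def willmoreEnergy (φ : CP1 → E4) : ℝ :=
  let X : ℂ → E4 := fun z => φ (z : CP1)
  ∫ z : ℂ, (‖meanCurvatureVector {X z} X z‖ ^ 2 - gaussCurvature X z + 1) * √(detg X z)

/-- `Φ` is a smooth variation of `φ` through immersions into `S³`. -/
def IsVariation (φ : CP1 → E4) (Φ : ℝ → CP1 → E4) : Prop :=
  Φ 0 = φ ∧ (∀ t, IsSphericalImmersion (Φ t)) ∧
    ∀ t p, ContDiffAt ℝ ∞ (fun q : ℝ × ℂ => Φ q.1 (coord p q.2)) (t, 0)

/-- A Willmore sphere: an immersed sphere in `S³` that is a critical point of the Willmore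
functional. -/
def IsWillmoreSphere (φ : CP1 → E4) : Prop :=
  IsSphericalImmersion φ ∧
    ∀ Φ, IsVariation φ Φ → HasDerivAt (fun t => willmoreEnergy (Φ t)) 0 0

/-- The point `(0, 0, 0, 1)` of `S³`. -/
def northPole : E4 := !₂[0, 0, 0, 1]

/-- Stereographic projection from the north pole, `S³ ∖ {northPole} → ℝ³`. -/
def stereo (x : E4) : E3 := (1 - x 3)⁻¹ • !₂[x 0, x 1, x 2]

/-- The smooth conformal immersion `φ : CP1 → S³` compactifies a (conformally parametrised,
immersed) genus 0 minimal surface in `ℝ³` with exactly `n` embedded planar ends: `n` points are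
mapped to the north pole, and off them the stereographic projection of `φ` is a conformal immersion
into `ℝ³` with vanishing mean curvature. -/
def IsMinimalSurfaceWithPlanarEnds (φ : CP1 → E4) (n : ℕ) : Prop :=
  IsSphericalImmersion φ ∧
  (∀ p, ConformalAt (fun w => φ (coord p w)) 0) ∧
  {p | φ p = northPole}.encard = n ∧
  ∀ p, φ p ≠ northPole →
    ConformalAt (fun w => stereo (φ (coord p w))) 0 ∧
    meanCurvatureVector ∅ (fun w => stereo (φ (coord p w))) 0 = 0

/-! ### The explicit curve and the explicit surface -/

/-- The lift of the contact curve. -/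
def psiLift (k : ℕ) (z : ℂ) : Fin 4 → ℂ :=
  ![z ^ 3,
    (1 / 6) * (-6 + 13 * k - 9 * k ^ 2 + 2 * k ^ 3 + (12 * (-3 + 2 * k)) / (-3 + k) * z ^ k
      + 3 * k * (-3 + 2 * k) * z ^ k - 6 * z ^ (2 * k)),
    (1 / 2) * (-3 + 2 * k) * z * (-2 + k + 2 * z ^ k),
    z ^ 2 * (-1 + k + z ^ k)]

/-- The common denominator of the components of `surfF`. -/
def surfDenom (k : ℕ) (z : ℂ) : ℂ :=
  4 * z * ((-3 + k) * (-1 + k) ^ 2 * (-3 + 2 * k) - 6 * (-1 + k) * (-3 + 2 * k) * z ^ k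
    - 3 * (-3 + k) * z ^ (2 * k))

/-- The meromorphic null curve in `ℂ³` whose real part is the minimal surface. -/
def surfF (k : ℕ) (z : ℂ) : Fin 3 → ℂ :=
  ![-12 * Complex.I * (-3 + k) * (-3 + 2 * k) * z ^ 2 * (2 - 3 * k + k ^ 2 - 2 * z ^ k)
      / surfDenom k z,
    (-1 + k) * (-12 * (3 - 2 * k) ^ 2 * (-2 + k) * z ^ k
      - 12 * (-3 + k) * (-3 + 2 * k) * z ^ (2 * k)
      + (-3 + k) * ((6 - 7 * k + 2 * k ^ 2) ^ 2 - 12 * z ^ 4)) / surfDenom k z,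
    Complex.I * (-1 + k) * (12 * (3 - 2 * k) ^ 2 * (-2 + k) * z ^ k
      + 12 * (-3 + k) * (-3 + 2 * k) * z ^ (2 * k)
      + (-3 + k) * (-(6 - 7 * k + 2 * k ^ 2) ^ 2 - 12 * z ^ 4)) / surfDenom k z]

end WillmoreSphere

end

open WillmoreSphere

noncomputable section

namespace WillmoreSphere

/-! ### Linear algebra in `ℝ⁴` -/

/-! The whole theorem rests on polynomial identities in `z` and `y = z ^ k`, combined with two
integral arguments on the sphere.

Algebra. The lift satisfies `ψ̂ ∧ ψ̂' = (z ^ k - 1) • η`, where `η` is the bivector of a polynomial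
curve `p` in `ℂ⁵` (`wedge_psiVec`). The curve `p` lies in the quadric `p₁² + p₂² + p₃² = 2 p₀ p₄`
(`nullVec_quadric`), and `pⱼ' p₄ - pⱼ p₄'`, for `j = 1, 2, 3`, is a nonzero constant times the
isotropic vector of the spinor `(P, Q)` formed by the second and fourth coordinates of `ψ̂`
(`nullVec_wronskian`). Since `P` and `Q` have no common zero, neither `p` nor `p ∧ p'` vanishes,
also at infinity. Hence the scalar factor alone carries the branch points of `ψ`, the second
associated curve is unbranched, and the zeros of `p₄` are simple. Two local lifts of a curve differ
by an analytic unit (`exists_analyticAt_smul`), so contact, nullity and branch order are read off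
from one lift at each point.

Surface. With `F = (p₁, p₂, p₃) / p₄`, the Wronskian identity says that `F'` is a multiple of an
isotropic vector. This is the Weierstrass representation: `Re F` is conformal and harmonic, with
Gauss map given by `[P : Q]`. Multiplying inverse stereographic projection through by `|p₄|²` and
using the quadric removes the poles; at a simple zero of `p₄` the result is still a conformal
immersion (`isConformalImmersionAt_nullSphere_of_eq`). The zeros of `p₄`, as many as its degree `2 k
+ 1`, are the ends.

Criticality. The Willmore integrand is half the energy density of the conformal Gauss map `Y = (ν +
H X, H)` into the unit quadric of Minkowski space (`willmore_density`). For a minimal surface in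
`ℝ³` this map consists of the Gauss map and the support function, and it is conformal and harmonic
(`harmonic_confGauss`). The first variation of the integrand is then a divergence (`dt_gaussEnergy`)
of a field decaying like `|z|⁻²`, so its integral vanishes (`integral_divergence_eq_zero`). The
identity is needed only off the ends: both sides are continuous.

Energy. For these surfaces the integrand is the area density of the Gauss map, equal to the
Laplacian of `log (|P|² + |Q|²)` (`laplacian_logNorm`). Comparing with `n log (1 + |z|²)`, where `n
= 2 k` is the degree of the spinor, the difference extends smoothly over infinity, so the total is
`n` times the area `4 π` of the unit sphere (`integral_spinDensity`). -/

/-- The generalized cross product of three vectors of `ℝ⁴`. -/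
def cross4 (x a b : E4) : E4 :=
  !₂[x 1 * (a 2 * b 3 - a 3 * b 2) - x 2 * (a 1 * b 3 - a 3 * b 1) + x 3 * (a 1 * b 2 - a 2 * b 1),
    -(x 0 * (a 2 * b 3 - a 3 * b 2) - x 2 * (a 0 * b 3 - a 3 * b 0) + x 3 * (a 0 * b 2 - a 2 * b 0)),
    x 0 * (a 1 * b 3 - a 3 * b 1) - x 1 * (a 0 * b 3 - a 3 * b 0) + x 3 * (a 0 * b 1 - a 1 * b 0),
    -(x 0 * (a 1 * b 2 - a 2 * b 1) - x 1 * (a 0 * b 2 - a 2 * b 0) + x 2 * (a 0 * b 1 - a 1 * b 0))]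

theorem inner_E4 (p q : E4) : ⟪p, q⟫ = p 0 * q 0 + p 1 * q 1 + p 2 * q 2 + p 3 * q 3 := by
  rw [real_inner_comm]
  simp [PiLp.inner_apply, Fin.sum_univ_four]

theorem inner_E3 (p q : E3) : ⟪p, q⟫ = p 0 * q 0 + p 1 * q 1 + p 2 * q 2 := by
  rw [real_inner_comm]
  simp [PiLp.inner_apply, Fin.sum_univ_three]

/-- The matrix with the given rows. -/
def rows4 (p x a b : E4) : Matrix (Fin 4) (Fin 4) ℝ :=
  Matrix.of ![p.ofLp, x.ofLp, a.ofLp, b.ofLp]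

theorem inner_cross4 (p x a b : E4) : ⟪p, cross4 x a b⟫ = (rows4 p x a b).det := by
  rw [inner_E4]
  simp [rows4, cross4, Matrix.det_succ_row_zero, Fin.sum_univ_succ, Fin.succAbove,
    Matrix.submatrix]
  ring

theorem rows4_mul_transpose (p x a b q y c d : E4) :
    rows4 p x a b * (rows4 q y c d).transpose =
      !![⟪p, q⟫, ⟪p, y⟫, ⟪p, c⟫, ⟪p, d⟫; ⟪x, q⟫, ⟪x, y⟫, ⟪x, c⟫, ⟪x, d⟫;
        ⟪a, q⟫, ⟪a, y⟫, ⟪a, c⟫, ⟪a, d⟫; ⟪b, q⟫, ⟪b, y⟫, ⟪b, c⟫, ⟪b, d⟫] := by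
  ext i j
  fin_cases i <;> fin_cases j <;>
    simp [rows4, Matrix.mul_apply, inner_E4, Fin.sum_univ_four]

/-- Both factors are determinants; multiplying one matrix by the transpose of the other turns their
product into a Gram determinant. -/
theorem inner_cross4_mul (p q x a b : E4) :
    ⟪p, cross4 x a b⟫ * ⟪q, cross4 x a b⟫ = Matrix.det
      !![⟪p, q⟫, ⟪p, x⟫, ⟪p, a⟫, ⟪p, b⟫; ⟪x, q⟫, ⟪x, x⟫, ⟪x, a⟫, ⟪x, b⟫;
        ⟪a, q⟫, ⟪a, x⟫, ⟪a, a⟫, ⟪a, b⟫; ⟪b, q⟫, ⟪b, x⟫, ⟪b, a⟫, ⟪b, b⟫] := by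
  rw [inner_cross4, inner_cross4, ← rows4_mul_transpose, Matrix.det_mul, Matrix.det_transpose]

theorem inner_left_cross4 (x a b : E4) : ⟪x, cross4 x a b⟫ = 0 := by
  rw [inner_E4]
  simp [cross4]
  ring

theorem inner_middle_cross4 (x a b : E4) : ⟪a, cross4 x a b⟫ = 0 := by
  rw [inner_E4]
  simp [cross4]
  ring

theorem inner_right_cross4 (x a b : E4) : ⟪b, cross4 x a b⟫ = 0 := by
  rw [inner_E4]
  simp [cross4]
  ring

/-- Expansion of the Gram determinant when `x` is a unit vector normal to `a` and `b`. It becomes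
the completeness relation `frame` of the moving frame of a surface. -/
theorem inner_cross4_mul_of_orthogonal {x a b : E4} (hx : ⟪x, x⟫ = (1 : ℝ))
    (ha : ⟪x, a⟫ = (0 : ℝ)) (hb : ⟪x, b⟫ = (0 : ℝ)) (p q : E4) :
    ⟪p, cross4 x a b⟫ * ⟪q, cross4 x a b⟫ =
      (⟪a, a⟫ * ⟪b, b⟫ - ⟪a, b⟫ ^ 2) * (⟪p, q⟫ - ⟪p, x⟫ * ⟪q, x⟫)
        - (⟪b, b⟫ * ⟪p, a⟫ * ⟪q, a⟫ - ⟪a, b⟫ * (⟪p, a⟫ * ⟪q, b⟫ + ⟪p, b⟫ * ⟪q, a⟫)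
          + ⟪a, a⟫ * ⟪p, b⟫ * ⟪q, b⟫ : ℝ) := by
  rw [inner_cross4_mul, real_inner_comm x a, real_inner_comm x b, real_inner_comm q x,
    real_inner_comm q a, real_inner_comm q b, real_inner_comm a b, hx, ha, hb]
  simp [Matrix.det_succ_row_zero, Fin.sum_univ_succ, Fin.succAbove, Matrix.submatrix]
  ring

/-- For `c = cross4 x a b`, the preceding identity with `p = q = c` reads `|c|⁴ = Gram * |c|²`. If
`c = 0` but the Gram determinant is nonzero, the same identity kills every vector orthogonal to `x`,
`a`, `b`, although three functionals on `ℝ⁴` have a common nonzero kernel vector. -/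
theorem norm_sq_cross4 {x a b : E4} (hx : ⟪x, x⟫ = (1 : ℝ))
    (ha : ⟪x, a⟫ = (0 : ℝ)) (hb : ⟪x, b⟫ = (0 : ℝ)) :
    ⟪cross4 x a b, cross4 x a b⟫ = (⟪a, a⟫ * ⟪b, b⟫ - ⟪a, b⟫ ^ 2 : ℝ) := by
  rw [inner_E4]
  have h := inner_cross4 (cross4 x a b) x a b
  set c := cross4 x a b with hc
  have h2 := inner_cross4_mul_of_orthogonal hx ha hb c c
  rw [← hc, real_inner_comm x c, real_inner_comm a c, real_inner_comm b c, hc,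
    inner_left_cross4, inner_middle_cross4, inner_right_cross4, ← hc] at h2
  rw [inner_E4 c c] at h2
  by_cases h0 : c 0 * c 0 + c 1 * c 1 + c 2 * c 2 + c 3 * c 3 = 0
  · have hc0 : c = 0 := by
      rw [← inner_E4] at h0
      exact inner_self_eq_zero.1 h0
    have h3 := fun p => inner_cross4_mul_of_orthogonal hx ha hb p p
    rw [h0]
    by_contra hne
    have e : ∀ p : E4, ⟪x, p⟫ = (0:ℝ) → ⟪a, p⟫ = (0:ℝ) → ⟪b, p⟫ = (0:ℝ) → p = 0 := by
      intro p h1 h2 h4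
      have h5 := h3 p
      rw [← hc, hc0, real_inner_comm x p, real_inner_comm a p, real_inner_comm b p, h1, h2, h4]
        at h5
      simp only [inner_zero_right, mul_zero, sub_zero, add_zero] at h5
      have : (⟪p, p⟫ : ℝ) = 0 := by
        rcases mul_eq_zero.1 h5.symm with h6 | h6
        · exact absurd h6.symm hne
        · exact h6
      exact inner_self_eq_zero.1 this
    obtain ⟨v, hv, hv0⟩ : ∃ v : E4, v ∈ LinearMap.ker (LinearMap.pi
        ![(innerₛₗ ℝ x : E4 →ₗ[ℝ] ℝ), innerₛₗ ℝ a, innerₛₗ ℝ b]) ∧ v ≠ 0 := by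
      apply Submodule.exists_mem_ne_zero_of_ne_bot
      apply LinearMap.ker_ne_bot_of_finrank_lt
      simp
    rw [LinearMap.mem_ker] at hv
    have w0 := congrFun hv 0
    have w1 := congrFun hv 1
    have w2 := congrFun hv 2
    simp at w0 w1 w2
    exact hv0 (e v w0 w1 w2)
  · apply mul_left_cancel₀ h0
    rw [h2]
    ring

/-! ### Partial derivatives -/

section PartialDerivatives

variable {E F G : Type*} [NormedAddCommGroup E] [NormedSpace ℝ E] [NormedAddCommGroup F]
  [NormedSpace ℝ F] [NormedAddCommGroup G] [InnerProductSpace ℝ G]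

theorem contDiff_pd {X : ℂ → F} (hX : ContDiff ℝ ∞ X) (v : ℂ) : ContDiff ℝ ∞ (pd v X) := by
  unfold pd
  have : ContDiff ℝ ∞ (fderiv ℝ X) := hX.fderiv_right (by simp)
  exact this.clm_apply contDiff_const

theorem pd_pd_comm {X : ℂ → F} (hX : ContDiff ℝ ∞ X) (u v z : ℂ) :
    pd u (pd v X) z = pd v (pd u X) z := by
  have h1 : DifferentiableAt ℝ (fderiv ℝ X) z :=
    ((hX.fderiv_right (m := ∞) (by simp)).differentiable (by simp)) z
  have h2 : IsSymmSndFDerivAt ℝ X z := hX.contDiffAt.isSymmSndFDerivAt (by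
    simp only [minSmoothness_of_isRCLikeNormedField]
    exact WithTop.coe_le_coe.2 (le_top : (2 : ℕ∞) ≤ ⊤))
  have key : ∀ u v : ℂ, pd u (pd v X) z = fderiv ℝ (fderiv ℝ X) z u v := by
    intro u v
    have : pd v X = fun w => (fderiv ℝ X w) v := rfl
    rw [this, pd, fderiv_clm_apply h1 (differentiableAt_const v)]
    simp
  rw [key, key]
  exact h2 u v

theorem pd_inner {f g : ℂ → G} {z : ℂ} (hf : DifferentiableAt ℝ f z)
    (hg : DifferentiableAt ℝ g z) (v : ℂ) :
    pd v (fun w => (⟪f w, g w⟫ : ℝ)) z = ⟪pd v f z, g z⟫ + ⟪f z, pd v g z⟫ := by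
  unfold pd
  rw [fderiv_inner_apply ℝ hf hg]
  ring

theorem pd_congr {f g : ℂ → F} {z : ℂ} (h : f =ᶠ[𝓝 z] g) (v : ℂ) : pd v f z = pd v g z := by
  rw [pd, pd, h.fderiv_eq]

theorem pd_const (v z : ℂ) (c : F) : pd v (fun _ => c) z = 0 := by simp [pd]

theorem _root_.ContDiff.diffAt {f : E → F} (hf : ContDiff ℝ ∞ f) (z : E) :
    DifferentiableAt ℝ f z := hf.differentiable (by simp) z

end PartialDerivatives

/-! ### Surfaces in the round 3-sphere -/

/-- `X` is a smooth immersion of the plane in `S³`. -/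
structure IsPlaneImmersion (X : ℂ → E4) : Prop where
  contDiff : ContDiff ℝ ∞ X
  norm_eq : ∀ z, ‖X z‖ = 1
  detg_pos : ∀ z, 0 < detg X z

/-- The unit normal of a surface in `S³`. -/
def nu (X : ℂ → E4) (z : ℂ) : E4 :=
  (√(detg X z))⁻¹ • cross4 (X z) (pd 1 X z) (pd Complex.I X z)

/-- Coefficients of the second fundamental form. -/
def sff (u v : ℂ) (X : ℂ → E4) (z : ℂ) : ℝ := - ⟪pd u X z, pd v (nu X) z⟫

/-- The mean curvature with respect to `nu`. -/
def meanCurv (X : ℂ → E4) (z : ℂ) : ℝ :=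
  (2 * detg X z)⁻¹ * (g22 X z * sff 1 1 X z
    - g12 X z * (sff 1 Complex.I X z + sff Complex.I 1 X z)
    + g11 X z * sff Complex.I Complex.I X z)

/-- The conformal Gauss map, with values in the Minkowski space `ℝ⁴ × ℝ`. -/
def confGauss (X : ℂ → E4) (z : ℂ) : E4 × ℝ := (nu X z + meanCurv X z • X z, meanCurv X z)

/-- The Lorentz product of `ℝ⁴ × ℝ`. -/
def lor (p q : E4 × ℝ) : ℝ := ⟪p.1, q.1⟫ - p.2 * q.2

theorem contDiff_lor {E : Type*} [NormedAddCommGroup E] [NormedSpace ℝ E] {f g : E → E4 × ℝ}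
    {n : ℕ∞} (hf : ContDiff ℝ n f) (hg : ContDiff ℝ n g) :
    ContDiff ℝ n fun z => lor (f z) (g z) := by
  unfold lor
  exact ((hf.fst).inner ℝ hg.fst).sub (hf.snd.mul hg.snd)

theorem contDiff_cross4 {E : Type*} [NormedAddCommGroup E] [NormedSpace ℝ E] {x a b : E → E4}
    {n : ℕ∞} (hx : ContDiff ℝ n x) (ha : ContDiff ℝ n a) (hb : ContDiff ℝ n b) :
    ContDiff ℝ n fun z => cross4 (x z) (a z) (b z) := by
  rw [contDiff_euclidean] at *
  have h0 := hx 0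
  have h1 := hx 1
  have h2 := hx 2
  have h3 := hx 3
  have a0 := ha 0
  have a1 := ha 1
  have a2 := ha 2
  have a3 := ha 3
  have b0 := hb 0
  have b1 := hb 1
  have b2 := hb 2
  have b3 := hb 3
  intro i
  fin_cases i <;> simp [cross4] <;> fun_prop

/-! ### The unit normal, the second fundamental form and the mean curvature vector -/

namespace IsPlaneImmersion

variable {X : ℂ → E4} (hX : IsPlaneImmersion X)
include hX

theorem contDiff_detg : ContDiff ℝ ∞ (detg X) := by
  have h1 := contDiff_pd hX.contDiff 1
  have h2 := contDiff_pd hX.contDiff Complex.I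
  unfold detg g11 g12 g22
  exact ((h1.inner ℝ h1).mul (h2.inner ℝ h2)).sub ((h1.inner ℝ h2).pow 2)

theorem contDiff_nu : ContDiff ℝ ∞ (nu X) := by
  unfold nu
  exact ((hX.contDiff_detg.sqrt fun z => (hX.detg_pos z).ne').inv fun z =>
    (Real.sqrt_pos.2 (hX.detg_pos z)).ne').smul (contDiff_cross4 hX.contDiff
      (contDiff_pd hX.contDiff 1) (contDiff_pd hX.contDiff Complex.I))

theorem contDiff_sff (u v : ℂ) : ContDiff ℝ ∞ (sff u v X) :=
  ((contDiff_pd hX.contDiff u).inner ℝ (contDiff_pd hX.contDiff_nu v)).neg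

theorem contDiff_meanCurv : ContDiff ℝ ∞ (meanCurv X) := by
  have h1 := contDiff_pd hX.contDiff 1
  have h2 := contDiff_pd hX.contDiff Complex.I
  unfold meanCurv
  refine ((contDiff_const.mul hX.contDiff_detg).inv fun z => by
    have := hX.detg_pos z; positivity).mul (((h2.inner ℝ h2).mul (hX.contDiff_sff _ _)).sub
      ((h1.inner ℝ h2).mul ((hX.contDiff_sff _ _).add (hX.contDiff_sff _ _))) |>.add
      ((h1.inner ℝ h1).mul (hX.contDiff_sff _ _)))

theorem contDiff_confGauss : ContDiff ℝ ∞ (confGauss X) :=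
  (hX.contDiff_nu.add (hX.contDiff_meanCurv.smul hX.contDiff)).prodMk hX.contDiff_meanCurv

theorem inner_self (z : ℂ) : ⟪X z, X z⟫ = (1 : ℝ) := by
  rw [real_inner_self_eq_norm_sq, hX.norm_eq]; norm_num

theorem inner_pd (u z : ℂ) : ⟪X z, pd u X z⟫ = (0 : ℝ) := by
  have h := pd_inner (hX.contDiff.diffAt z) (hX.contDiff.diffAt z) u
  have h1 : (fun w => (⟪X w, X w⟫ : ℝ)) = fun _ => 1 := funext hX.inner_self
  rw [h1, pd_const, real_inner_comm] at h
  linarith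

theorem sq_sqrt_detg (z : ℂ) : √(detg X z) ^ 2 = detg X z := Real.sq_sqrt (hX.detg_pos z).le

omit hX in
theorem inner_nu (z : ℂ) : ⟪X z, nu X z⟫ = (0 : ℝ) := by
  rw [nu, inner_smul_right, inner_left_cross4, mul_zero]

omit hX in
theorem inner_pd_nu (u z : ℂ) : ⟪pd u X z, nu X z⟫ = (0 : ℝ) := by
  have h1 : ⟪pd 1 X z, nu X z⟫ = (0 : ℝ) := by
    rw [nu, inner_smul_right, inner_middle_cross4, mul_zero]
  have h2 : ⟪pd Complex.I X z, nu X z⟫ = (0 : ℝ) := by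
    rw [nu, inner_smul_right, inner_right_cross4, mul_zero]
  have h3 : pd u X z = u.re • pd 1 X z + u.im • pd Complex.I X z := by
    unfold pd
    rw [← map_smul, ← map_smul, ← map_add]
    congr 1
    simp [Complex.re_add_im]
  rw [h3, inner_add_left, inner_smul_left, inner_smul_left, h1, h2]
  simp

theorem nu_inner_nu (z : ℂ) : ⟪nu X z, nu X z⟫ = (1 : ℝ) := by
  have hd := hX.detg_pos z
  rw [nu, inner_smul_left, inner_smul_right, norm_sq_cross4 (hX.inner_self z) (hX.inner_pd 1 z)
    (hX.inner_pd Complex.I z)]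
  change (√(detg X z))⁻¹ * ((√(detg X z))⁻¹ * detg X z) = 1
  have h := hX.sq_sqrt_detg z
  have h0 : √(detg X z) ≠ 0 := (Real.sqrt_pos.2 hd).ne'
  field_simp
  exact h.symm

/-- Completeness of the frame `X`, `X_u`, `X_v`, `ν`. -/
theorem frame (z : ℂ) (p q : E4) :
    detg X z * (⟪p, nu X z⟫ * ⟪q, nu X z⟫) = detg X z * (⟪p, q⟫ - ⟪p, X z⟫ * ⟪q, X z⟫)
      - (g22 X z * (⟪p, pd 1 X z⟫ * ⟪q, pd 1 X z⟫)
        - g12 X z * (⟪p, pd 1 X z⟫ * ⟪q, pd Complex.I X z⟫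
          + ⟪p, pd Complex.I X z⟫ * ⟪q, pd 1 X z⟫)
        + g11 X z * (⟪p, pd Complex.I X z⟫ * ⟪q, pd Complex.I X z⟫)) := by
  have hd := hX.detg_pos z
  have h := inner_cross4_mul_of_orthogonal (hX.inner_self z) (hX.inner_pd 1 z)
    (hX.inner_pd Complex.I z) p q
  have h0 : √(detg X z) ≠ 0 := (Real.sqrt_pos.2 hd).ne'
  rw [nu, inner_smul_right, inner_smul_right]
  have e : detg X z * ((√(detg X z))⁻¹ * ⟪p, cross4 (X z) (pd 1 X z) (pd Complex.I X z)⟫ *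
      ((√(detg X z))⁻¹ * ⟪q, cross4 (X z) (pd 1 X z) (pd Complex.I X z)⟫)) =
      ⟪p, cross4 (X z) (pd 1 X z) (pd Complex.I X z)⟫ *
        ⟪q, cross4 (X z) (pd 1 X z) (pd Complex.I X z)⟫ := by
    nth_rewrite 1 [← hX.sq_sqrt_detg z]
    field_simp
  rw [e, h, detg, g11, g12, g22]
  ring

theorem inner_pd_pd (u v z : ℂ) :
    ⟪pd v (pd u X) z, X z⟫ = -⟪pd u X z, pd v X z⟫ := by
  have h := pd_inner ((contDiff_pd hX.contDiff u).diffAt z) (hX.contDiff.diffAt z) v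
  have h1 : (fun w => (⟪pd u X w, X w⟫ : ℝ)) = fun _ => 0 := by
    funext w
    rw [real_inner_comm, hX.inner_pd]
  rw [h1, pd_const] at h
  linarith

/-- Differentiation of `⟪X_u, ν⟫ = 0`; it passes from derivatives of `ν` to second derivatives of
`X` and gives the symmetry of `sff`. -/
theorem inner_pd_pd_nu (u v z : ℂ) : ⟪pd v (pd u X) z, nu X z⟫ = sff u v X z := by
  have h := pd_inner ((contDiff_pd hX.contDiff u).diffAt z) (hX.contDiff_nu.diffAt z) v
  have h1 : (fun w => (⟪pd u X w, nu X w⟫ : ℝ)) = fun _ => 0 :=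
    funext fun w => inner_pd_nu u w
  rw [h1, pd_const] at h
  rw [sff]
  linarith

theorem sff_comm (u v z : ℂ) : sff u v X z = sff v u X z := by
  rw [← hX.inner_pd_pd_nu, ← hX.inner_pd_pd_nu, pd_pd_comm hX.contDiff]

theorem nu_inner_pd_nu (u z : ℂ) : ⟪pd u (nu X) z, nu X z⟫ = (0 : ℝ) := by
  have h := pd_inner (hX.contDiff_nu.diffAt z) (hX.contDiff_nu.diffAt z) u
  have h1 : (fun w => (⟪nu X w, nu X w⟫ : ℝ)) = fun _ => 1 := funext hX.nu_inner_nu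
  rw [h1, pd_const, real_inner_comm (pd u (nu X) z)] at h
  linarith

theorem pd_nu_inner (u z : ℂ) : ⟪pd u (nu X) z, X z⟫ = (0 : ℝ) := by
  have h := pd_inner (hX.contDiff_nu.diffAt z) (hX.contDiff.diffAt z) u
  have h1 : (fun w => (⟪nu X w, X w⟫ : ℝ)) = fun _ => 0 := by
    funext w
    rw [real_inner_comm, inner_nu]
  rw [h1, pd_const, real_inner_comm (pd u X z), inner_pd_nu] at h
  linarith

/-- The orthogonal complement of `X`, `X_u`, `X_v` is the line of `ν`: for `w` in it, `frame`
collapses to `⟪m, ν⟫ * ⟪w, ν⟫ = ⟪m, w⟫`, so subtracting `⟪m, ν⟫ • ν` from `m` leaves something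
orthogonal to `w`. -/
theorem meanCurvatureVector_eq (z : ℂ) :
    meanCurvatureVector {X z} X z = meanCurv X z • nu X z := by
  have hd := hX.detg_pos z
  rw [meanCurvatureVector]
  set m : E4 := (2 * detg X z)⁻¹ • (g22 X z • pd 1 (pd 1 X) z
      - (2 * g12 X z) • pd Complex.I (pd 1 X) z
      + g11 X z • pd Complex.I (pd Complex.I X) z) with hm
  have hmc : ⟪m, nu X z⟫ = meanCurv X z := by
    rw [hm, inner_smul_left, inner_add_left, inner_sub_left, inner_smul_left, inner_smul_left,
      inner_smul_left, hX.inner_pd_pd_nu, hX.inner_pd_pd_nu, hX.inner_pd_pd_nu, meanCurv,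
      hX.sff_comm Complex.I 1]
    simp only [conj_trivial]
    ring
  clear_value m
  have hmem : ∀ w, w ∈ (Submodule.span ℝ ({X z} ∪ {pd 1 X z, pd Complex.I X z}))ᗮ ↔
      ⟪X z, w⟫ = (0 : ℝ) ∧ ⟪pd 1 X z, w⟫ = (0 : ℝ) ∧ ⟪pd Complex.I X z, w⟫ = (0 : ℝ) := by
    intro w
    rw [Submodule.mem_orthogonal]
    constructor
    · intro h
      exact ⟨h _ (Submodule.subset_span (by simp)), h _ (Submodule.subset_span (by simp)),
        h _ (Submodule.subset_span (by simp))⟩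
    · rintro ⟨h1, h2, h3⟩ u hu
      induction hu using Submodule.span_induction with
      | mem x hx =>
        simp only [Set.mem_union, Set.mem_singleton_iff, Set.mem_insert_iff] at hx
        rcases hx with rfl | rfl | rfl <;> assumption
      | zero => simp
      | add x y _ _ hx hy => rw [inner_add_left, hx, hy, add_zero]
      | smul a x _ hx => rw [inner_smul_left, hx, mul_zero]
  apply Submodule.eq_starProjection_of_mem_of_inner_eq_zero
  · rw [hmem]
    simp [inner_smul_right, inner_nu, inner_pd_nu]
  · intro w hw
    obtain ⟨h1, h2, h3⟩ := (hmem w).1 hw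
    have hf := hX.frame z m w
    rw [real_inner_comm (X z) w, real_inner_comm (pd 1 X z) w,
      real_inner_comm (pd Complex.I X z) w, h1, h2, h3, hmc] at hf
    rw [inner_sub_left, inner_smul_left, real_inner_comm w (nu X z)]
    simp only [conj_trivial]
    simp only [mul_zero, sub_zero, add_zero] at hf
    linarith [mul_left_cancel₀ hd.ne' hf]

end IsPlaneImmersion

/-- Half the energy density of the conformal Gauss map. -/
def gaussEnergy (X : ℂ → E4) (z : ℂ) : ℝ :=
  (2 * √(detg X z))⁻¹ * (g22 X z * lor (pd 1 (confGauss X) z) (pd 1 (confGauss X) z)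
    - 2 * g12 X z * lor (pd 1 (confGauss X) z) (pd Complex.I (confGauss X) z)
    + g11 X z * lor (pd Complex.I (confGauss X) z) (pd Complex.I (confGauss X) z))

/-! ### The Gauss equation and the Willmore integrand -/

namespace IsPlaneImmersion

variable {X : ℂ → E4} (hX : IsPlaneImmersion X)
include hX

theorem contDiff_g11 : ContDiff ℝ ∞ (g11 X) :=
  (contDiff_pd hX.contDiff 1).inner ℝ (contDiff_pd hX.contDiff 1)

theorem contDiff_g12 : ContDiff ℝ ∞ (g12 X) :=
  (contDiff_pd hX.contDiff 1).inner ℝ (contDiff_pd hX.contDiff Complex.I)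

theorem contDiff_g22 : ContDiff ℝ ∞ (g22 X) :=
  (contDiff_pd hX.contDiff Complex.I).inner ℝ (contDiff_pd hX.contDiff Complex.I)

omit hX in
theorem pd_inner_pd {X : ℂ → E4} (hX : ContDiff ℝ ∞ X) (u v w z : ℂ) :
    pd w (fun z => (⟪pd u X z, pd v X z⟫ : ℝ)) z =
      ⟪pd w (pd u X) z, pd v X z⟫ + ⟪pd u X z, pd w (pd v X) z⟫ :=
  pd_inner ((contDiff_pd hX u).diffAt z) ((contDiff_pd hX v).diffAt z) w

omit hX in
theorem pd_pd_inner_pd {X : ℂ → E4} (hX : ContDiff ℝ ∞ X) (u v w s z : ℂ) :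
    pd s (pd w (fun z => (⟪pd u X z, pd v X z⟫ : ℝ))) z =
      ⟪pd s (pd w (pd u X)) z, pd v X z⟫ + ⟪pd w (pd u X) z, pd s (pd v X) z⟫
        + (⟪pd s (pd u X) z, pd w (pd v X) z⟫ + ⟪pd u X z, pd s (pd w (pd v X)) z⟫) := by
  have e : pd w (fun z => (⟪pd u X z, pd v X z⟫ : ℝ)) = fun z =>
      ⟪pd w (pd u X) z, pd v X z⟫ + ⟪pd u X z, pd w (pd v X) z⟫ :=
    funext fun z => pd_inner_pd hX u v w z
  have hu := contDiff_pd hX u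
  have hv := contDiff_pd hX v
  rw [e, pd, fderiv_fun_add (((contDiff_pd hu w).inner ℝ hv).diffAt z)
    ((hu.inner ℝ (contDiff_pd hv w)).diffAt z), add_apply]
  change pd s _ z + pd s _ z = _
  rw [pd_inner ((contDiff_pd hu w).diffAt z) (hv.diffAt z),
    pd_inner (hu.diffAt z) ((contDiff_pd hv w).diffAt z)]

/-- The theorema egregium for surfaces in `S³`. -/
theorem gaussCurvature_eq (z : ℂ) :
    gaussCurvature X z = 1 + (sff 1 1 X z * sff Complex.I Complex.I X z
      - sff 1 Complex.I X z ^ 2) / detg X z := by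
  have hd := hX.detg_pos z
  have hs := hX.contDiff
  have c1 : pd Complex.I (pd 1 X) = pd 1 (pd Complex.I X) :=
    funext fun w => pd_pd_comm hs Complex.I 1 w
  have c2 : pd Complex.I (pd 1 (pd 1 X)) z = pd 1 (pd 1 (pd Complex.I X)) z := by
    rw [pd_pd_comm (contDiff_pd hs 1), c1]
  have c3 : pd 1 (pd Complex.I (pd Complex.I X)) z = pd Complex.I (pd 1 (pd Complex.I X)) z :=
    pd_pd_comm (contDiff_pd hs Complex.I) _ _ _
  -- The Gauss equation: `frame` for the pairs `(X_uu, X_vv)` and `(X_uv, X_uv)` expresses the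
  -- products of coefficients of `sff`. The tangential terms reproduce the Brioschi determinants,
  -- and the `X`-components contribute the curvature `1` of the ambient sphere.
  have f1 := hX.frame z (pd 1 (pd 1 X) z) (pd Complex.I (pd Complex.I X) z)
  have f2 := hX.frame z (pd 1 (pd Complex.I X) z) (pd 1 (pd Complex.I X) z)
  rw [hX.inner_pd_pd_nu, hX.inner_pd_pd_nu, hX.inner_pd_pd, hX.inner_pd_pd] at f1
  rw [hX.inner_pd_pd_nu, hX.inner_pd_pd] at f2
  have hdet : g11 X z * g22 X z - g12 X z ^ 2 = detg X z := rfl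
  have sw : ∀ p q : E4, (⟪p, q⟫ : ℝ) = ⟪q, p⟫ := fun p q => real_inner_comm q p
  -- In this combination of second derivatives of the metric the third derivatives of `X` cancel.
  have k : -pd Complex.I (pd Complex.I (g11 X)) z / 2 + pd Complex.I (pd 1 (g12 X)) z
      - pd 1 (pd 1 (g22 X)) z / 2 = ⟪pd 1 (pd 1 X) z, pd Complex.I (pd Complex.I X) z⟫
        - ⟪pd 1 (pd Complex.I X) z, pd 1 (pd Complex.I X) z⟫ := by
    have k1 : pd Complex.I (pd 1 (g12 X)) z = _ := pd_pd_inner_pd hs _ _ _ _ _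
    have k2 : pd Complex.I (pd Complex.I (g11 X)) z = _ := pd_pd_inner_pd hs _ _ _ _ _
    have k3 : pd 1 (pd 1 (g22 X)) z = _ := pd_pd_inner_pd hs _ _ _ _ _
    rw [k1, k2, k3, c2, c1, sw (pd 1 X z) (pd Complex.I (pd 1 (pd Complex.I X)) z),
      sw (pd Complex.I X z) (pd 1 (pd 1 (pd Complex.I X)) z)]
    ring
  have k4 : pd 1 (g11 X) z = 2 * ⟪pd 1 (pd 1 X) z, pd 1 X z⟫ := by
    have : pd 1 (g11 X) z = _ := pd_inner_pd hs _ _ _ _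
    rw [this, sw (pd 1 X z)]
    ring
  have k5 : pd Complex.I (g11 X) z = 2 * ⟪pd 1 (pd Complex.I X) z, pd 1 X z⟫ := by
    have : pd Complex.I (g11 X) z = _ := pd_inner_pd hs _ _ _ _
    rw [this, c1, sw (pd 1 X z)]
    ring
  have k6 : pd 1 (g12 X) z = ⟪pd 1 (pd 1 X) z, pd Complex.I X z⟫
      + ⟪pd 1 (pd Complex.I X) z, pd 1 X z⟫ := by
    have : pd 1 (g12 X) z = _ := pd_inner_pd hs _ _ _ _
    rw [this, sw (pd 1 X z)]
  have k7 : pd Complex.I (g12 X) z = ⟪pd 1 (pd Complex.I X) z, pd Complex.I X z⟫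
      + ⟪pd Complex.I (pd Complex.I X) z, pd 1 X z⟫ := by
    have : pd Complex.I (g12 X) z = _ := pd_inner_pd hs _ _ _ _
    rw [this, c1, sw (pd 1 X z)]
  have k8 : pd 1 (g22 X) z = 2 * ⟪pd 1 (pd Complex.I X) z, pd Complex.I X z⟫ := by
    have : pd 1 (g22 X) z = _ := pd_inner_pd hs _ _ _ _
    rw [this, sw (pd Complex.I X z)]
    ring
  have k9 : pd Complex.I (g22 X) z = 2 * ⟪pd Complex.I (pd Complex.I X) z, pd Complex.I X z⟫ := by
    have : pd Complex.I (g22 X) z = _ := pd_inner_pd hs _ _ _ _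
    rw [this, sw (pd Complex.I X z)]
    ring
  rw [sff_comm hX 1 Complex.I, gaussCurvature, metricCurvature, k, k4, k5, k6, k7, k8, k9,
    Matrix.det_fin_three, Matrix.det_fin_three]
  simp only [Matrix.of_apply, Matrix.cons_val', Matrix.cons_val_zero, Matrix.cons_val_one,
    Matrix.cons_val]
  change _ / detg X z ^ 2 = _
  rw [div_eq_iff (by positivity)]
  have r : (1 + (sff 1 1 X z * sff Complex.I Complex.I X z - sff Complex.I 1 X z ^ 2) / detg X z)
      * detg X z ^ 2 = detg X z ^ 2 + (detg X z * (sff 1 1 X z * sff Complex.I Complex.I X z)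
        - detg X z * (sff Complex.I 1 X z * sff Complex.I 1 X z)) := by
    field_simp
  rw [sw (pd Complex.I X z) (pd 1 X z)] at f2
  change detg X z * _ = detg X z * (_ - -g11 X z * -g22 X z) - _ at f1
  change detg X z * _ = detg X z * (_ - -g12 X z * -g12 X z) - _ at f2
  rw [r]
  linear_combination -f1 + f2 + (⟪pd 1 (pd 1 X) z, pd Complex.I (pd Complex.I X) z⟫
    - ⟪pd 1 (pd Complex.I X) z, pd 1 (pd Complex.I X) z⟫ + detg X z) * hdet

/-- The derivative of `Y` contains `H_u • (X, 1)`. The vector `(X, 1)` is null and orthogonal to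
`ν_u + H X_u`, so the derivatives of `H` drop out. -/
theorem lor_pd_confGauss (u v z : ℂ) :
    lor (pd u (confGauss X) z) (pd v (confGauss X) z) =
      ⟪pd u (nu X) z + meanCurv X z • pd u X z, pd v (nu X) z + meanCurv X z • pd v X z⟫ := by
  have key : ∀ u, pd u (confGauss X) z =
      (pd u (nu X) z + meanCurv X z • pd u X z + pd u (meanCurv X) z • X z,
        pd u (meanCurv X) z) := by
    intro u
    have h1 := hX.contDiff_meanCurv.diffAt z
    have h2 := hX.contDiff.diffAt z
    have h3 := hX.contDiff_nu.diffAt z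
    have : HasFDerivAt (confGauss X) _ z :=
      ((h3.hasFDerivAt.add (h1.hasFDerivAt.smul h2.hasFDerivAt)).prodMk h1.hasFDerivAt)
    rw [pd, this.fderiv]
    simp [pd, add_assoc]
  rw [key, key, lor]
  simp only [inner_add_left, inner_add_right, inner_smul_left, inner_smul_right, conj_trivial,
    hX.inner_self, hX.inner_pd, hX.pd_nu_inner, real_inner_comm (X z) (pd u X z),
    real_inner_comm (pd v (nu X) z) (X z)]
  ring

/-- The Willmore integrand is half the energy density of the conformal Gauss map. -/
theorem willmore_density (z : ℂ) :
    (‖meanCurvatureVector {X z} X z‖ ^ 2 - gaussCurvature X z + 1) * √(detg X z)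
      = gaussEnergy X z := by
  have hd := hX.detg_pos z
  have hr := Real.sqrt_pos.2 hd
  have hq := hX.sq_sqrt_detg z
  rw [hX.gaussCurvature_eq, hX.meanCurvatureVector_eq, ← real_inner_self_eq_norm_sq,
    inner_smul_left, inner_smul_right, hX.nu_inner_nu, gaussEnergy,
    hX.lor_pd_confGauss, hX.lor_pd_confGauss, hX.lor_pd_confGauss]
  -- Derivatives of `ν` are tangent to the surface, so `frame` writes the third fundamental form in
  -- terms of the first and second.
  have hf : ∀ u v, _ := fun u v => hX.frame z (pd u (nu X) z) (pd v (nu X) z)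
  simp only [hX.nu_inner_pd_nu, hX.pd_nu_inner] at hf
  have hs : ∀ u v, (⟪pd u (nu X) z, pd v X z⟫ : ℝ) = - sff v u X z := by
    intro u v
    rw [sff, real_inner_comm, neg_neg]
  simp only [hs] at hf
  have hg : ∀ u v, (⟪pd u (nu X) z + meanCurv X z • pd u X z,
      pd v (nu X) z + meanCurv X z • pd v X z⟫ : ℝ) = ⟪pd u (nu X) z, pd v (nu X) z⟫
        - 2 * meanCurv X z * sff u v X z + meanCurv X z ^ 2 * ⟪pd u X z, pd v X z⟫ := by
    intro u v
    simp only [inner_add_left, inner_add_right, inner_smul_left, inner_smul_right, conj_trivial,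
      hs, real_inner_comm (pd v (nu X) z) (pd u X z), hX.sff_comm v u]
    ring
  simp only [hg]
  have hc := hX.sff_comm Complex.I 1 z
  have hdet : detg X z = g11 X z * g22 X z - g12 X z ^ 2 := rfl
  have e11 := hf 1 1
  have e12 := hf 1 Complex.I
  have e22 := hf Complex.I Complex.I
  simp only [hc] at e11 e12
  have hm : meanCurv X z * (2 * detg X z) = g22 X z * sff 1 1 X z
    - 2 * g12 X z * sff 1 Complex.I X z + g11 X z * sff Complex.I Complex.I X z := by
    rw [meanCurv, hc]
    field_simp
    ring
  change (_ : ℝ) = (2 * √(detg X z))⁻¹ * (g22 X z * (_ + _ * g11 X z)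
    - 2 * g12 X z * (_ + _ * g12 X z) + g11 X z * (_ + _ * g22 X z))
  generalize (⟪pd 1 (nu X) z, pd 1 (nu X) z⟫ : ℝ) = n11 at *
  generalize (⟪pd 1 (nu X) z, pd Complex.I (nu X) z⟫ : ℝ) = n12 at *
  generalize (⟪pd Complex.I (nu X) z, pd Complex.I (nu X) z⟫ : ℝ) = n22 at *
  generalize sff 1 1 X z = h11 at *
  generalize sff 1 Complex.I X z = h12 at *
  generalize sff Complex.I Complex.I X z = h22 at *
  generalize meanCurv X z = H at *
  generalize g11 X z = E at *
  generalize g12 X z = F at *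
  generalize g22 X z = G at *
  generalize √(detg X z) = r at *
  generalize detg X z = d at *
  -- This is `|A|² = (tr A)² - 2 det A` for the shape operator `A`, cleared of denominators.
  have hS : d * (G * n11 - 2 * F * n12 + E * n22) =
      d * (4 * d * H ^ 2 - 2 * (h11 * h22 - h12 ^ 2)) := by
    have h4 : 4 * d ^ 2 * H ^ 2 = (G * h11 - 2 * F * h12 + E * h22) ^ 2 := by
      rw [← hm]
      ring
    linear_combination -G * e11 + 2 * F * e12 - E * e22 - h4
      + 2 * (h11 * h22 - h12 ^ 2) * hdet
  have hS' := mul_left_cancel₀ hd.ne' hS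
  simp only [conj_trivial]
  have hrhs : G * (n11 - 2 * H * h11 + H ^ 2 * E) - 2 * F * (n12 - 2 * H * h12 + H ^ 2 * F)
      + E * (n22 - 2 * H * h22 + H ^ 2 * G) = 2 * d * H ^ 2 - 2 * (h11 * h22 - h12 ^ 2) := by
    linear_combination hS' + 2 * H * hm - 2 * H ^ 2 * hdet
  rw [hrhs]
  have h0 := hr.ne'
  subst hq
  field_simp
  ring

end IsPlaneImmersion

/-! ### The Lorentz product -/

theorem lor_comm (p q : E4 × ℝ) : lor p q = lor q p := by
  rw [lor, lor, real_inner_comm, mul_comm]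

theorem lor_add_left (p q r : E4 × ℝ) : lor (p + q) r = lor p r + lor q r := by
  simp only [lor, Prod.fst_add, Prod.snd_add, inner_add_left]
  ring

theorem lor_smul_left (c : ℝ) (p r : E4 × ℝ) : lor (c • p) r = c * lor p r := by
  simp only [lor, Prod.smul_fst, Prod.smul_snd, inner_smul_left, smul_eq_mul, conj_trivial]
  ring

theorem lor_add_right (p q r : E4 × ℝ) : lor r (p + q) = lor r p + lor r q := by
  rw [lor_comm, lor_add_left, lor_comm p, lor_comm q]

theorem lor_smul_right (c : ℝ) (p r : E4 × ℝ) : lor r (c • p) = c * lor r p := by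
  rw [lor_comm, lor_smul_left, lor_comm]

theorem hasFDerivAt_lor {E : Type*} [NormedAddCommGroup E] [NormedSpace ℝ E] {f g : E → E4 × ℝ}
    {z : E} (hf : DifferentiableAt ℝ f z) (hg : DifferentiableAt ℝ g z) (v : E) :
    fderiv ℝ (fun w => lor (f w) (g w)) z v =
      lor (fderiv ℝ f z v) (g z) + lor (f z) (fderiv ℝ g z v) := by
  unfold lor
  have h1 := hf.hasFDerivAt.fst.inner ℝ hg.hasFDerivAt.fst
  have h2 := hf.hasFDerivAt.snd.mul hg.hasFDerivAt.snd
  have h3 : HasFDerivAt (fun w => (⟪(f w).1, (g w).1⟫ : ℝ) - (f w).2 * (g w).2) _ z := h1.sub h2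
  rw [h3.fderiv]
  simp
  ring

/-- The norm on the product is the maximum of the two norms, so each of the two terms is at most
`‖p‖ * ‖q‖`. -/
theorem abs_lor_le (p q : E4 × ℝ) : |lor p q| ≤ 2 * (‖p‖ * ‖q‖) := by
  rw [lor]
  have h1 := abs_real_inner_le_norm p.1 q.1
  have h2 : |p.2 * q.2| = ‖p.2‖ * ‖q.2‖ := by rw [abs_mul]; rfl
  have h3 : ‖p.1‖ * ‖q.1‖ ≤ ‖p‖ * ‖q‖ :=
    mul_le_mul (norm_fst_le p) (norm_fst_le q) (norm_nonneg _) (norm_nonneg _)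
  have h4 : ‖p.2‖ * ‖q.2‖ ≤ ‖p‖ * ‖q‖ :=
    mul_le_mul (norm_snd_le p) (norm_snd_le q) (norm_nonneg _) (norm_nonneg _)
  have h5 := abs_sub (⟪p.1, q.1⟫ : ℝ) (p.2 * q.2)
  linarith

/-- `|ν + H X|² = 1 + H²`, so `Y` takes values in the unit quadric of Minkowski space; its
variations are therefore orthogonal to it. -/
theorem IsPlaneImmersion.lor_confGauss {X : ℂ → E4} (hX : IsPlaneImmersion X) (z : ℂ) :
    lor (confGauss X z) (confGauss X z) = 1 := by
  rw [lor, confGauss]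
  simp only [inner_add_left, inner_add_right, inner_smul_left, inner_smul_right, conj_trivial,
    hX.inner_self, hX.nu_inner_nu, inner_nu, real_inner_comm (X z) (nu X z)]
  ring

/-! ### Behaviour under the inversion `z ↦ 1 / z` -/

section Inversion

variable {F : Type*} [NormedAddCommGroup F] [NormedSpace ℝ F]

/-- Here `f₀` and `f₁` play the role of one map on the sphere written in the coordinates `z` and `1
/ z`. -/
theorem fderiv_of_inv {f₀ f₁ : ℂ → F} (h : ∀ z, z ≠ 0 → f₀ z = f₁ z⁻¹) {z : ℂ} (hz : z ≠ 0)
    (hf : DifferentiableAt ℝ f₁ z⁻¹) (v : ℂ) :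
    fderiv ℝ f₀ z v = fderiv ℝ f₁ z⁻¹ (-(z ^ 2)⁻¹ * v) := by
  have h1 : f₀ =ᶠ[𝓝 z] f₁ ∘ fun w => w⁻¹ := by
    filter_upwards [isOpen_ne.mem_nhds hz] with w hw using h w hw
  have h2 : HasFDerivAt (fun w : ℂ => w⁻¹) _ z := (hasDerivAt_inv hz).hasFDerivAt.restrictScalars ℝ
  rw [h1.fderiv_eq, (hf.hasFDerivAt.comp z h2).fderiv]
  simp [mul_comm]

theorem apply_eq_re_im (L : ℂ →L[ℝ] F) (v : ℂ) : L v = v.re • L 1 + v.im • L Complex.I := by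
  rw [← map_smul, ← map_smul, ← map_add]
  congr 1
  simp [Complex.re_add_im]

theorem pd_one_of_inv {f₀ f₁ : ℂ → F} (h : ∀ z, z ≠ 0 → f₀ z = f₁ z⁻¹) {z : ℂ} (hz : z ≠ 0)
    (hf : DifferentiableAt ℝ f₁ z⁻¹) :
    pd 1 f₀ z = (-(z ^ 2)⁻¹).re • pd 1 f₁ z⁻¹ + (-(z ^ 2)⁻¹).im • pd Complex.I f₁ z⁻¹ := by
  rw [pd, fderiv_of_inv h hz hf, apply_eq_re_im, mul_one]
  rfl

theorem pd_I_of_inv {f₀ f₁ : ℂ → F} (h : ∀ z, z ≠ 0 → f₀ z = f₁ z⁻¹) {z : ℂ} (hz : z ≠ 0)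
    (hf : DifferentiableAt ℝ f₁ z⁻¹) :
    pd Complex.I f₀ z =
      (-(-(z ^ 2)⁻¹).im) • pd 1 f₁ z⁻¹ + (-(z ^ 2)⁻¹).re • pd Complex.I f₁ z⁻¹ := by
  rw [pd, fderiv_of_inv h hz hf, apply_eq_re_im, Complex.mul_I_re, Complex.mul_I_im]
  rfl

/-- Derivative bound for functions that are smooth on the sphere. -/
theorem exists_norm_fderiv_le_of_inv {f₀ f₁ : ℂ → F} (h : ∀ z, z ≠ 0 → f₀ z = f₁ z⁻¹)
    (h₀ : ContDiff ℝ ∞ f₀) (h₁ : ContDiff ℝ ∞ f₁) :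
    ∃ C, ∀ z, ‖fderiv ℝ f₀ z‖ ≤ C * (1 + ‖z‖ ^ 2)⁻¹ := by
  have hK : IsCompact (Metric.closedBall (0 : ℂ) 1) := isCompact_closedBall 0 1
  have c₀ : Continuous (fderiv ℝ f₀) := h₀.continuous_fderiv (by simp)
  have c₁ : Continuous (fderiv ℝ f₁) := h₁.continuous_fderiv (by simp)
  obtain ⟨C₀, hC₀⟩ := hK.exists_bound_of_continuousOn c₀.continuousOn
  obtain ⟨C₁, hC₁⟩ := hK.exists_bound_of_continuousOn c₁.continuousOn
  have p₀ : 0 ≤ C₀ := (norm_nonneg _).trans (hC₀ 0 (by simp))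
  have p₁ : 0 ≤ C₁ := (norm_nonneg _).trans (hC₁ 0 (by simp))
  refine ⟨2 * max C₀ C₁, fun z => ?_⟩
  rw [← div_eq_mul_inv, le_div_iff₀ (by positivity)]
  -- Inside the unit disc compactness bounds the derivative; outside, the change of chart supplies
  -- `|z|⁻²`. The factor `2` comes from `1 + |z|² ≤ 2` and `1 + |z|² ≤ 2 |z|²` respectively.
  by_cases hz : ‖z‖ ≤ 1
  · have h2 := hC₀ z (by simpa using hz)
    have h3 : 1 + ‖z‖ ^ 2 ≤ 2 := by nlinarith [norm_nonneg z]
    calc ‖fderiv ℝ f₀ z‖ * (1 + ‖z‖ ^ 2) ≤ C₀ * 2 :=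
          mul_le_mul h2 h3 (by positivity) p₀
      _ ≤ 2 * max C₀ C₁ := by linarith [le_max_left C₀ C₁]
  · push Not at hz
    have hz0 : z ≠ 0 := fun h0 => by simp [h0] at hz; linarith
    have h2 := hC₁ z⁻¹ (by simpa using inv_le_one_of_one_le₀ hz.le)
    have h3 : ‖fderiv ℝ f₀ z‖ ≤ C₁ * (‖z‖ ^ 2)⁻¹ := by
      refine ContinuousLinearMap.opNorm_le_bound _ (by positivity) fun v => ?_
      rw [fderiv_of_inv h hz0 (h₁.diffAt _)]
      refine (ContinuousLinearMap.le_opNorm _ _).trans ?_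
      rw [norm_mul, norm_neg, norm_inv, norm_pow, ← mul_assoc]
      gcongr
    have hz2 : 1 ≤ ‖z‖ ^ 2 := one_le_pow₀ hz.le
    calc ‖fderiv ℝ f₀ z‖ * (1 + ‖z‖ ^ 2) ≤ C₁ * (‖z‖ ^ 2)⁻¹ * (2 * ‖z‖ ^ 2) :=
          mul_le_mul h3 (by linarith) (by positivity) (by positivity)
      _ = 2 * C₁ := by field_simp
      _ ≤ 2 * max C₀ C₁ := by linarith [le_max_right C₀ C₁]

end Inversion

/-- A holomorphic change of coordinate acts on `(X_u, X_v)` by a similarity; an alternating bilinear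
expression is multiplied by its determinant. -/
theorem cross4_rotate (x a b : E4) (r s : ℝ) :
    cross4 x (r • a + s • b) ((-s) • a + r • b) = (r ^ 2 + s ^ 2) • cross4 x a b := by
  ext i
  fin_cases i <;> simp [cross4] <;> ring

section InversionOfSurfaces

variable {X₀ X₁ : ℂ → E4} (h₁ : IsPlaneImmersion X₁)
  (h : ∀ z, z ≠ 0 → X₀ z = X₁ z⁻¹)
include h₁ h

theorem metric_of_inv {z : ℂ} (hz : z ≠ 0) :
    g11 X₀ z = (-(z ^ 2)⁻¹).re ^ 2 * g11 X₁ z⁻¹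
      + 2 * (-(z ^ 2)⁻¹).re * (-(z ^ 2)⁻¹).im * g12 X₁ z⁻¹ + (-(z ^ 2)⁻¹).im ^ 2 * g22 X₁ z⁻¹ ∧
    g12 X₀ z = ((-(z ^ 2)⁻¹).re ^ 2 - (-(z ^ 2)⁻¹).im ^ 2) * g12 X₁ z⁻¹
      + (-(z ^ 2)⁻¹).re * (-(z ^ 2)⁻¹).im * (g22 X₁ z⁻¹ - g11 X₁ z⁻¹) ∧
    g22 X₀ z = (-(z ^ 2)⁻¹).im ^ 2 * g11 X₁ z⁻¹
      - 2 * (-(z ^ 2)⁻¹).re * (-(z ^ 2)⁻¹).im * g12 X₁ z⁻¹ + (-(z ^ 2)⁻¹).re ^ 2 * g22 X₁ z⁻¹ := by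
  have d := h₁.contDiff.diffAt z⁻¹
  have e1 := pd_one_of_inv h hz d
  have e2 := pd_I_of_inv h hz d
  generalize -(z ^ 2)⁻¹ = c at *
  have sw := real_inner_comm (pd 1 X₁ z⁻¹) (pd Complex.I X₁ z⁻¹)
  simp only [g11, g12, g22, e1, e2, inner_add_left, inner_add_right, inner_smul_left,
    inner_smul_right, conj_trivial, sw]
  refine ⟨?_, ?_, ?_⟩ <;> ring

theorem detg_of_inv {z : ℂ} (hz : z ≠ 0) :
    detg X₀ z = Complex.normSq (-(z ^ 2)⁻¹) ^ 2 * detg X₁ z⁻¹ := by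
  obtain ⟨e1, e2, e3⟩ := metric_of_inv h₁ h hz
  rw [detg, detg, e1, e2, e3, Complex.normSq_apply]
  ring

/-- No sign appears because `z ↦ 1 / z` preserves orientation, and the factor from `cross4_rotate`
is the one by which `√(detg)` changes. -/
theorem nu_of_inv {z : ℂ} (hz : z ≠ 0) : nu X₀ z = nu X₁ z⁻¹ := by
  have d := h₁.contDiff.diffAt z⁻¹
  have hc : Complex.normSq (-(z ^ 2)⁻¹) ≠ 0 := by simpa using hz
  rw [nu, nu, detg_of_inv h₁ h hz, pd_one_of_inv h hz d, pd_I_of_inv h hz d, cross4_rotate,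
    h z hz, smul_smul, Real.sqrt_mul (by positivity), Real.sqrt_sq (Complex.normSq_nonneg _)]
  congr 1
  rw [Complex.normSq_apply] at *
  have hq := (Real.sqrt_pos.2 (h₁.detg_pos z⁻¹)).ne'
  generalize (-(z ^ 2)⁻¹).re = r at *
  generalize (-(z ^ 2)⁻¹).im = s at *
  generalize z⁻¹ = w at *
  have hc : r ^ 2 + s ^ 2 ≠ 0 := by simpa [sq] using hc
  rw [← sq, ← sq]
  field_simp

/-- The mean curvature is half the trace of the second fundamental form with respect to the first,
hence independent of the coordinate once the normals agree. -/
theorem meanCurv_of_inv {z : ℂ} (hz : z ≠ 0) : meanCurv X₀ z = meanCurv X₁ z⁻¹ := by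
  have d := h₁.contDiff.diffAt z⁻¹
  have d' := h₁.contDiff_nu.diffAt z⁻¹
  have hν : ∀ z, z ≠ 0 → nu X₀ z = nu X₁ z⁻¹ := fun z hz => nu_of_inv h₁ h hz
  have hc : Complex.normSq (-(z ^ 2)⁻¹) ≠ 0 := by simpa using hz
  obtain ⟨e1, e2, e3⟩ := metric_of_inv h₁ h hz
  have hd := (h₁.detg_pos z⁻¹).ne'
  simp only [meanCurv, sff]
  rw [detg_of_inv h₁ h hz, pd_one_of_inv h hz d, pd_I_of_inv h hz d, pd_one_of_inv hν hz d',
    pd_I_of_inv hν hz d', e1, e2, e3]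
  simp only [inner_add_left, inner_add_right, inner_smul_left, inner_smul_right, conj_trivial]
  rw [Complex.normSq_apply] at *
  generalize (-(z ^ 2)⁻¹).re = r at *
  generalize (-(z ^ 2)⁻¹).im = s at *
  generalize z⁻¹ = w at *
  have hc : r ^ 2 + s ^ 2 ≠ 0 := by simpa [sq] using hc
  rw [← sq, ← sq]
  field_simp
  ring

theorem confGauss_of_inv {z : ℂ} (hz : z ≠ 0) : confGauss X₀ z = confGauss X₁ z⁻¹ := by
  rw [confGauss, confGauss, nu_of_inv h₁ h hz, meanCurv_of_inv h₁ h hz, h z hz]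

/-- The energy density is the coefficient of a 2-form on the sphere, so it picks up the Jacobian
`|z|⁻⁴` of the inversion. -/
theorem gaussEnergy_of_inv {z : ℂ} (hz : z ≠ 0) :
    gaussEnergy X₀ z = (‖z‖ ^ 4)⁻¹ * gaussEnergy X₁ z⁻¹ := by
  have hY : ∀ z, z ≠ 0 → confGauss X₀ z = confGauss X₁ z⁻¹ :=
    fun z hz => confGauss_of_inv h₁ h hz
  have d := h₁.contDiff_confGauss.diffAt z⁻¹
  have hc : Complex.normSq (-(z ^ 2)⁻¹) ≠ 0 := by simpa using hz
  have hn : (‖z‖ ^ 4)⁻¹ = Complex.normSq (-(z ^ 2)⁻¹) := by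
    rw [Complex.normSq_eq_norm_sq, norm_neg, norm_inv, norm_pow]
    ring
  obtain ⟨e1, e2, e3⟩ := metric_of_inv h₁ h hz
  have hd := (Real.sqrt_pos.2 (h₁.detg_pos z⁻¹)).ne'
  rw [hn, gaussEnergy, gaussEnergy, detg_of_inv h₁ h hz, Real.sqrt_mul (by positivity),
    Real.sqrt_sq (Complex.normSq_nonneg _), e1, e2, e3, pd_one_of_inv hY hz d, pd_I_of_inv hY hz d]
  simp only [lor_add_left, lor_add_right, lor_smul_left, lor_smul_right,
    lor_comm (pd Complex.I (confGauss X₁) z⁻¹) (pd 1 (confGauss X₁) z⁻¹)]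
  rw [Complex.normSq_apply] at *
  generalize (-(z ^ 2)⁻¹).re = r at *
  generalize (-(z ^ 2)⁻¹).im = s at *
  generalize z⁻¹ = w at *
  have hc : r ^ 2 + s ^ 2 ≠ 0 := by simpa [sq] using hc
  rw [← sq, ← sq]
  field_simp
  ring

end InversionOfSurfaces

/-! ### The divergence theorem on the plane for decaying vector fields -/

-- Integrate by parts against cut-offs `η n` that dilate one fixed bump. Their gradients are `O(1 /
-- (1 + |z|))` uniformly in `n` and tend to `0` pointwise; against a field of size `|z|⁻²` this is
-- dominated by `(1 + |z|)⁻³`, which is integrable on the plane, so the boundary term disappears in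
-- the limit.
open MeasureTheory Filter in
theorem integral_divergence_eq_zero {V₁ V₂ : ℂ → ℝ} (h₁ : ContDiff ℝ ∞ V₁) (h₂ : ContDiff ℝ ∞ V₂)
    {C : ℝ} (b₁ : ∀ z, |V₁ z| ≤ C * (1 + ‖z‖ ^ 2)⁻¹) (b₂ : ∀ z, |V₂ z| ≤ C * (1 + ‖z‖ ^ 2)⁻¹)
    (hint : Integrable fun z => pd 1 V₁ z + pd Complex.I V₂ z) :
    ∫ z, (pd 1 V₁ z + pd Complex.I V₂ z) = 0 := by
  have hC : 0 ≤ C := by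
    have := (abs_nonneg _).trans (b₁ 0)
    simpa using this
  let χ : ContDiffBump (0 : ℂ) := ⟨1, 2, one_pos, one_lt_two⟩
  have hχ : ContDiff ℝ ∞ (χ : ℂ → ℝ) := χ.contDiff
  have hχc : HasCompactSupport (χ : ℂ → ℝ) := χ.hasCompactSupport
  obtain ⟨K, hK⟩ := (hχ.continuous_fderiv (by simp)).bounded_above_of_compact_support
    (hχc.fderiv (𝕜 := ℝ))
  have hK0 : 0 ≤ K := (norm_nonneg _).trans (hK 0)
  let η : ℕ → ℂ → ℝ := fun n z => χ (((n : ℝ) + 1)⁻¹ • z)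
  have hη : ∀ n, ContDiff ℝ ∞ (η n) := fun n => hχ.comp (contDiff_const_smul _)
  have hn0 : ∀ n : ℕ, ((n : ℝ) + 1)⁻¹ ≠ 0 := fun n => by positivity
  have hηc : ∀ n, HasCompactSupport (η n) := fun n =>
    hχc.comp_homeomorph (Homeomorph.smulOfNeZero _ (hn0 n))
  have hder : ∀ n z v, fderiv ℝ (η n) z v
      = ((n : ℝ) + 1)⁻¹ * fderiv ℝ χ (((n : ℝ) + 1)⁻¹ • z) v := by
    intro n z v
    have e : HasFDerivAt (η n) _ z := (hχ.diffAt (((n : ℝ) + 1)⁻¹ • z)).hasFDerivAt.comp z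
      ((hasFDerivAt_id z).const_smul (((n : ℝ) + 1)⁻¹))
    rw [e.fderiv]
    simp
  have hbd : ∀ n z v, |fderiv ℝ (η n) z v| ≤ ((n : ℝ) + 1)⁻¹ * (K * ‖v‖) := by
    intro n z v
    rw [hder, abs_mul, abs_of_nonneg (by positivity)]
    gcongr
    exact ContinuousLinearMap.le_of_opNorm_le _ (hK _) _
  have hbd' : ∀ n z v, |fderiv ℝ (η n) z v| ≤ 3 * (K * ‖v‖) * (1 + ‖z‖)⁻¹ := by
    intro n z v
    -- On the support of the cut-off `|z| ≤ 2 (n + 1)`, hence `1 + |z| ≤ 3 (n + 1)`; elsewhere the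
    -- gradient is zero. This makes the bound independent of `n`.
    by_cases hz : ‖z‖ ≤ 2 * ((n : ℝ) + 1)
    · refine (hbd n z v).trans ?_
      have hn : (0 : ℝ) ≤ n := n.cast_nonneg
      have : ((n : ℝ) + 1)⁻¹ ≤ 3 * (1 + ‖z‖)⁻¹ := by
        rw [← div_eq_mul_inv, inv_eq_one_div, div_le_div_iff₀ (by positivity) (by positivity)]
        linarith
      calc ((n : ℝ) + 1)⁻¹ * (K * ‖v‖) ≤ 3 * (1 + ‖z‖)⁻¹ * (K * ‖v‖) := by gcongr
        _ = _ := by ring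
    · have : fderiv ℝ χ (((n : ℝ) + 1)⁻¹ • z) = 0 := by
        have hns : ((n : ℝ) + 1)⁻¹ • z ∉ tsupport (fderiv ℝ χ) := by
          intro hmem
          have := tsupport_fderiv_subset ℝ hmem
          rw [χ.tsupport_eq, mem_closedBall_zero_iff, norm_smul, norm_inv, Real.norm_of_nonneg
            (by positivity), inv_mul_le_iff₀ (by positivity)] at this
          exact hz (by linarith)
        exact image_eq_zero_of_notMem_tsupport hns
      rw [hder, this]
      simp only [zero_apply, mul_zero, abs_zero]
      positivity
  have ibp : ∀ n (V : ℂ → ℝ) (v : ℂ), ContDiff ℝ ∞ V →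
      Integrable (fun z => η n z * fderiv ℝ V z v) ∧ Integrable (fun z => fderiv ℝ (η n) z v * V z) ∧
      ∫ z, η n z * fderiv ℝ V z v = - ∫ z, fderiv ℝ (η n) z v * V z := by
    intro n V v hV
    have i1 : Integrable (fun z => fderiv ℝ (η n) z v * V z) := by
      refine Continuous.integrable_of_hasCompactSupport ?_ ?_
      · exact (contDiff_pd (hη n) v).continuous.mul hV.continuous
      · exact ((hηc n).fderiv_apply (𝕜 := ℝ) v).mul_right
    have i2 : Integrable (fun z => η n z * fderiv ℝ V z v) := by
      refine Continuous.integrable_of_hasCompactSupport ?_ ?_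
      · exact (hη n).continuous.mul (contDiff_pd hV v).continuous
      · exact (hηc n).mul_right
    have i3 : Integrable (fun z => η n z * V z) := by
      refine Continuous.integrable_of_hasCompactSupport ?_ ?_
      · exact (hη n).continuous.mul hV.continuous
      · exact (hηc n).mul_right
    exact ⟨i2, i1, integral_mul_fderiv_eq_neg_fderiv_mul_of_integrable i1 i2 i3
      (fun x _ => (hη n).diffAt x) (fun x _ => hV.diffAt x)⟩
  have lim0 : ∀ (V : ℂ → ℝ) (v : ℂ), ContDiff ℝ ∞ V → (∀ z, |V z| ≤ C * (1 + ‖z‖ ^ 2)⁻¹) →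
      Tendsto (fun n => ∫ z, fderiv ℝ (η n) z v * V z) atTop (𝓝 0) := by
    intro V v hV hb
    have : (0 : ℝ) = ∫ _ : ℂ, (0 : ℝ) := by simp
    rw [this]
    refine tendsto_integral_of_dominated_convergence
      (fun z => 6 * (K * ‖v‖) * C * (1 + ‖z‖) ^ (-3 : ℝ)) (fun n => (ibp n V v hV).2.1.1) ?_ ?_ ?_
    · refine (integrable_one_add_norm ?_).const_mul _
      rw [Complex.finrank_real_complex]
      norm_num
    · intro n
      refine Eventually.of_forall fun z => ?_
      rw [norm_mul, Real.norm_eq_abs, Real.norm_eq_abs]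
      have e1 := hbd' n z v
      have e2 := hb z
      have e3 : (1 + ‖z‖ ^ 2)⁻¹ ≤ 2 * ((1 + ‖z‖) ^ 2)⁻¹ := by
        rw [← div_eq_mul_inv, inv_eq_one_div, div_le_div_iff₀ (by positivity) (by positivity)]
        nlinarith [sq_nonneg (1 - ‖z‖)]
      calc |fderiv ℝ (η n) z v| * |V z|
          ≤ (3 * (K * ‖v‖) * (1 + ‖z‖)⁻¹) * (C * (2 * ((1 + ‖z‖) ^ 2)⁻¹)) :=
            mul_le_mul e1 (e2.trans (by gcongr)) (abs_nonneg _) (by positivity)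
        _ = 6 * (K * ‖v‖) * C * (1 + ‖z‖) ^ (-3 : ℝ) := by
          rw [Real.rpow_neg (by positivity), show (3 : ℝ) = ((3 : ℕ) : ℝ) by norm_num,
            Real.rpow_natCast]
          field_simp
          push_cast
          ring
    · refine Eventually.of_forall fun z => ?_
      have t1 : Tendsto (fun n : ℕ => ((n : ℝ) + 1)⁻¹ * (K * ‖v‖) * |V z|) atTop (𝓝 0) := by
        have := (tendsto_one_div_add_atTop_nhds_zero_nat (𝕜 := ℝ)).mul_const (K * ‖v‖ * |V z|)
        simpa [mul_assoc] using this
      refine squeeze_zero_norm (fun n => ?_) t1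
      rw [norm_mul, Real.norm_eq_abs, Real.norm_eq_abs]
      exact mul_le_mul_of_nonneg_right (hbd n z v) (abs_nonneg _)
  have lim1 : Tendsto (fun n => ∫ z, η n z * (pd 1 V₁ z + pd Complex.I V₂ z)) atTop
      (𝓝 (∫ z, (pd 1 V₁ z + pd Complex.I V₂ z))) := by
    refine tendsto_integral_of_dominated_convergence
      (fun z => ‖pd 1 V₁ z + pd Complex.I V₂ z‖) (fun n => ?_) hint.norm ?_ ?_
    · exact ((hη n).continuous.aestronglyMeasurable).mul hint.1
    · intro n
      refine Eventually.of_forall fun z => ?_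
      rw [norm_mul]
      refine mul_le_of_le_one_left (norm_nonneg _) ?_
      rw [Real.norm_of_nonneg χ.nonneg]
      exact χ.le_one
    · refine Eventually.of_forall fun z => ?_
      -- The inner radius of the bump is `1`, so `η n z = 1` as soon as `n ≥ |z|`.
      have : ∀ᶠ n : ℕ in atTop, η n z = 1 := by
        filter_upwards [eventually_ge_atTop ⌈‖z‖⌉₊] with n hn
        apply χ.one_of_mem_closedBall
        rw [mem_closedBall_zero_iff, norm_smul, norm_inv, Real.norm_of_nonneg
            (by positivity), inv_mul_le_iff₀ (by positivity)]
        change ‖z‖ ≤ _ * 1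
        have := Nat.ceil_le.1 hn
        linarith
      refine tendsto_const_nhds.congr' ?_
      filter_upwards [this] with n hn
      rw [hn, one_mul]
  have lim2 := ((lim0 V₁ 1 h₁ b₁).neg.add (lim0 V₂ Complex.I h₂ b₂).neg)
  rw [neg_zero, add_zero] at lim2
  refine tendsto_nhds_unique lim1 (lim2.congr fun n => ?_)
  obtain ⟨i1, _, e1⟩ := ibp n V₁ 1 h₁
  obtain ⟨i2, _, e2⟩ := ibp n V₂ Complex.I h₂
  rw [← e1, ← e2, ← integral_add i1 i2]
  congr 1
  funext z
  rw [pd, pd]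
  ring

open MeasureTheory in
theorem integrable_inv_one_add_norm_sq_sq :
    Integrable fun z : ℂ => ((1 + ‖z‖ ^ 2) ^ 2)⁻¹ := by
  have := integrable_rpow_neg_one_add_norm_sq (E := ℂ) (μ := volume) (r := 4) (by
    rw [Complex.finrank_real_complex]; norm_num)
  refine this.congr (Filter.Eventually.of_forall fun z => ?_)
  simp only
  rw [show (-4 / 2 : ℝ) = -((2 : ℕ) : ℝ) by norm_num, Real.rpow_neg (by positivity),
    Real.rpow_natCast]

/-! ### Smooth families of surfaces -/

section Families

variable {F : Type*} [NormedAddCommGroup F] [NormedSpace ℝ F]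

/-- Joint smoothness of a family of maps on the plane. -/
abbrev IsSmoothFamily (G : ℝ → ℂ → F) : Prop := ContDiff ℝ ∞ fun q : ℝ × ℂ => G q.1 q.2

/-- The time derivative of a family. -/
def dt (G : ℝ → ℂ → F) (t : ℝ) (z : ℂ) : F := fderiv ℝ (fun q : ℝ × ℂ => G q.1 q.2) (t, z) (1, 0)

theorem IsSmoothFamily.slice {G : ℝ → ℂ → F} (hG : IsSmoothFamily G) (t : ℝ) :
    ContDiff ℝ ∞ (G t) :=
  hG.comp (contDiff_const.prodMk contDiff_id : ContDiff ℝ ∞ fun z : ℂ => (t, z))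

theorem IsSmoothFamily.pd_eq {G : ℝ → ℂ → F} (hG : IsSmoothFamily G) (v : ℂ) (t : ℝ) (z : ℂ) :
    pd v (G t) z = fderiv ℝ (fun q : ℝ × ℂ => G q.1 q.2) (t, z) (0, v) := by
  have h1 : HasFDerivAt (fun z : ℂ => ((t, z) : ℝ × ℂ)) _ z :=
    hasFDerivAt_prodMk_right (𝕜 := ℝ) t z
  have h2 : HasFDerivAt (G t) _ z := (hG.diffAt (t, z)).hasFDerivAt.comp z h1
  rw [pd, h2.fderiv]
  simp

theorem IsSmoothFamily.pd {G : ℝ → ℂ → F} (hG : IsSmoothFamily G) (v : ℂ) :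
    IsSmoothFamily fun t => WillmoreSphere.pd v (G t) := by
  have h : (fun q : ℝ × ℂ => WillmoreSphere.pd v (G q.1) q.2) = fun q : ℝ × ℂ =>
      fderiv ℝ (fun q : ℝ × ℂ => G q.1 q.2) q (0, v) :=
    funext fun q => hG.pd_eq v q.1 q.2
  rw [IsSmoothFamily, h]
  exact (ContDiff.fderiv_right hG (m := ∞) (by simp)).clm_apply contDiff_const

theorem IsSmoothFamily.dt {G : ℝ → ℂ → F} (hG : IsSmoothFamily G) : IsSmoothFamily (dt G) :=
  (ContDiff.fderiv_right hG (m := ∞) (by simp)).clm_apply contDiff_const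

theorem IsSmoothFamily.hasDerivAt {G : ℝ → ℂ → F} (hG : IsSmoothFamily G) (t : ℝ) (z : ℂ) :
    HasDerivAt (fun s => G s z) (WillmoreSphere.dt G t z) t := by
  have h1 : HasFDerivAt (fun s : ℝ => ((s, z) : ℝ × ℂ)) _ t :=
    hasFDerivAt_prodMk_left (𝕜 := ℝ) t z
  have h2 : HasFDerivAt (fun s => G s z) _ t := HasFDerivAt.comp (f := fun s : ℝ => (s, z))
    (g := fun q : ℝ × ℂ => G q.1 q.2) t (hG.diffAt (t, z)).hasFDerivAt h1
  have h3 := h2.hasDerivAt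
  simpa [WillmoreSphere.dt] using h3

/-- Symmetry of the second derivative on `ℝ × ℂ`, applied to the directions `(1, 0)` and `(0, v)`.
-/
theorem IsSmoothFamily.dt_pd {G : ℝ → ℂ → F} (hG : IsSmoothFamily G) (v : ℂ) (t : ℝ) (z : ℂ) :
    WillmoreSphere.dt (fun t => WillmoreSphere.pd v (G t)) t z
      = WillmoreSphere.pd v (WillmoreSphere.dt G t) z := by
  have h : (fun q : ℝ × ℂ => WillmoreSphere.pd v (G q.1) q.2) = fun q : ℝ × ℂ =>
      fderiv ℝ (fun q : ℝ × ℂ => G q.1 q.2) q (0, v) :=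
    funext fun q => hG.pd_eq v q.1 q.2
  have hd : DifferentiableAt ℝ (fderiv ℝ (fun q : ℝ × ℂ => G q.1 q.2)) (t, z) :=
    (ContDiff.fderiv_right hG (m := ∞) (by simp)).diffAt _
  have hs : IsSymmSndFDerivAt ℝ (fun q : ℝ × ℂ => G q.1 q.2) (t, z) :=
    hG.contDiffAt.isSymmSndFDerivAt (by
      simp only [minSmoothness_of_isRCLikeNormedField]
      exact WithTop.coe_le_coe.2 (le_top : (2 : ℕ∞) ≤ ⊤))
  rw [hG.dt.pd_eq, WillmoreSphere.dt, h]
  change _ = fderiv ℝ (fun q : ℝ × ℂ => fderiv ℝ (fun q : ℝ × ℂ => G q.1 q.2) (q.1, q.2) (1, 0))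
    (t, z) (0, v)
  simp only [Prod.mk.eta]
  rw [fderiv_clm_apply hd (differentiableAt_const _), fderiv_clm_apply hd (differentiableAt_const _)]
  simpa using hs (1, 0) (0, v)

end Families

/-- A smooth family of immersions of the plane in `S³`. -/
structure IsImmersedFamily (X : ℝ → ℂ → E4) : Prop where
  smooth : IsSmoothFamily X
  immersion : ∀ t, IsPlaneImmersion (X t)

/-! ### First variation of the Willmore integrand in a family -/

namespace IsImmersedFamily

variable {X : ℝ → ℂ → E4} (hX : IsImmersedFamily X)
include hX

theorem smooth_inner (u v : ℂ) : IsSmoothFamily fun t z => (⟪pd u (X t) z, pd v (X t) z⟫ : ℝ) :=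
  ContDiff.inner ℝ (hX.smooth.pd u) (hX.smooth.pd v)

theorem smooth_g11 : IsSmoothFamily fun t => g11 (X t) := hX.smooth_inner 1 1

theorem smooth_g12 : IsSmoothFamily fun t => g12 (X t) := hX.smooth_inner 1 Complex.I

theorem smooth_g22 : IsSmoothFamily fun t => g22 (X t) := hX.smooth_inner Complex.I Complex.I

theorem smooth_detg : IsSmoothFamily fun t => detg (X t) :=
  (ContDiff.mul hX.smooth_g11 hX.smooth_g22).sub (ContDiff.pow hX.smooth_g12 2)

theorem smooth_sqrt_detg : IsSmoothFamily fun t z => √(detg (X t) z) :=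
  ContDiff.sqrt hX.smooth_detg fun q => ((hX.immersion q.1).detg_pos q.2).ne'

theorem smooth_nu : IsSmoothFamily fun t => nu (X t) :=
  ContDiff.smul (ContDiff.inv hX.smooth_sqrt_detg fun q =>
    (Real.sqrt_pos.2 ((hX.immersion q.1).detg_pos q.2)).ne')
    (contDiff_cross4 hX.smooth (hX.smooth.pd 1) (hX.smooth.pd Complex.I))

theorem smooth_sff (u v : ℂ) : IsSmoothFamily fun t => sff u v (X t) :=
  (ContDiff.inner ℝ (hX.smooth.pd u) (hX.smooth_nu.pd v)).neg

theorem smooth_meanCurv : IsSmoothFamily fun t => meanCurv (X t) :=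
  ContDiff.mul (ContDiff.inv (ContDiff.mul contDiff_const hX.smooth_detg) fun q => by
    have := (hX.immersion q.1).detg_pos q.2; positivity)
    (((ContDiff.mul hX.smooth_g22 (hX.smooth_sff _ _)).sub
      (ContDiff.mul hX.smooth_g12 (ContDiff.add (hX.smooth_sff _ _) (hX.smooth_sff _ _)))).add
      (ContDiff.mul hX.smooth_g11 (hX.smooth_sff _ _)))

theorem smooth_confGauss : IsSmoothFamily fun t => confGauss (X t) :=
  (ContDiff.add hX.smooth_nu (ContDiff.smul hX.smooth_meanCurv hX.smooth)).prodMk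
    hX.smooth_meanCurv

theorem smooth_lor (u v : ℂ) : IsSmoothFamily fun t z =>
    lor (pd u (confGauss (X t)) z) (pd v (confGauss (X t)) z) :=
  contDiff_lor (hX.smooth_confGauss.pd u) (hX.smooth_confGauss.pd v)

theorem smooth_gaussEnergy : IsSmoothFamily fun t => gaussEnergy (X t) :=
  ContDiff.mul (ContDiff.inv (ContDiff.mul contDiff_const hX.smooth_sqrt_detg) fun q => by
    have := Real.sqrt_pos.2 ((hX.immersion q.1).detg_pos q.2); positivity)
    (((ContDiff.mul hX.smooth_g22 (hX.smooth_lor _ _)).sub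
      (ContDiff.mul (ContDiff.mul contDiff_const hX.smooth_g12) (hX.smooth_lor _ _))).add
      (ContDiff.mul hX.smooth_g11 (hX.smooth_lor _ _)))

theorem lor_confGauss_dt (t : ℝ) (z : ℂ) :
    lor (confGauss (X t) z) (dt (fun t => confGauss (X t)) t z) = 0 := by
  have hd := (hX.smooth_confGauss.diffAt (t, z))
  have h := hasFDerivAt_lor hd hd (1, 0)
  have e : (fun q : ℝ × ℂ => lor (confGauss (X q.1) q.2) (confGauss (X q.1) q.2)) = fun _ => 1 :=
    funext fun q => (hX.immersion q.1).lor_confGauss q.2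
  rw [e] at h
  simp only [fderiv_fun_const, Pi.zero_apply, zero_apply] at h
  rw [lor_comm (fderiv ℝ _ _ _)] at h
  rw [dt]
  linarith

theorem hasDerivAt_lor (u v : ℂ) (t : ℝ) (z : ℂ) :
    HasDerivAt (fun t => lor (pd u (confGauss (X t)) z) (pd v (confGauss (X t)) z))
      (lor (pd u (dt (fun t => confGauss (X t)) t) z) (pd v (confGauss (X t)) z)
        + lor (pd u (confGauss (X t)) z) (pd v (dt (fun t => confGauss (X t)) t) z)) t := by
  have h := (hX.smooth_lor u v).hasDerivAt t z
  have hu := (hX.smooth_confGauss.pd u)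
  have hv := (hX.smooth_confGauss.pd v)
  have e : dt (fun t z => lor (pd u (confGauss (X t)) z) (pd v (confGauss (X t)) z)) t z = _ :=
    hasFDerivAt_lor (hu.diffAt (t, z)) (hv.diffAt (t, z)) (1, 0)
  rw [e] at h
  rw [← hX.smooth_confGauss.dt_pd u t z, ← hX.smooth_confGauss.dt_pd v t z]
  exact h

/-- The first variation of the Willmore integrand is a divergence where the conformal Gauss map is
a conformal harmonic map. -/
theorem dt_gaussEnergy {t : ℝ} {z : ℂ} (h12 : g12 (X t) z = 0) (h22 : g22 (X t) z = g11 (X t) z)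
    (q12 : lor (pd 1 (confGauss (X t)) z) (pd Complex.I (confGauss (X t)) z) = 0)
    (q22 : lor (pd Complex.I (confGauss (X t)) z) (pd Complex.I (confGauss (X t)) z) =
      lor (pd 1 (confGauss (X t)) z) (pd 1 (confGauss (X t)) z))
    {c : ℝ} (harm : pd 1 (pd 1 (confGauss (X t))) z + pd Complex.I (pd Complex.I (confGauss (X t))) z
      = c • confGauss (X t) z) :
    dt (fun t => gaussEnergy (X t)) t z =
      pd 1 (fun w => lor (pd 1 (confGauss (X t)) w) (dt (fun t => confGauss (X t)) t w)) z
      + pd Complex.I (fun w =>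
        lor (pd Complex.I (confGauss (X t)) w) (dt (fun t => confGauss (X t)) t w)) z := by
  have hYt := (hX.immersion t).contDiff_confGauss
  have hdiv : pd 1 (fun w => lor (pd 1 (confGauss (X t)) w) (dt (fun t => confGauss (X t)) t w)) z
      + pd Complex.I (fun w =>
        lor (pd Complex.I (confGauss (X t)) w) (dt (fun t => confGauss (X t)) t w)) z
      = lor (pd 1 (confGauss (X t)) z) (pd 1 (dt (fun t => confGauss (X t)) t) z)
        + lor (pd Complex.I (confGauss (X t)) z)
          (pd Complex.I (dt (fun t => confGauss (X t)) t) z) := by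
    have e : ∀ v, pd v (fun w => lor (pd v (confGauss (X t)) w)
        (dt (fun t => confGauss (X t)) t w)) z = lor (pd v (pd v (confGauss (X t))) z)
          (dt (fun t => confGauss (X t)) t z) + lor (pd v (confGauss (X t)) z)
            (pd v (dt (fun t => confGauss (X t)) t) z) := fun v =>
      hasFDerivAt_lor ((contDiff_pd hYt v).diffAt z) ((hX.smooth_confGauss.dt.slice t).diffAt z) v
    -- Harmonicity: the Laplacian of `Y` is a multiple of `Y`, which is orthogonal to its time
    -- derivative.
    have e0 : lor (pd 1 (pd 1 (confGauss (X t))) z) (dt (fun t => confGauss (X t)) t z)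
        + lor (pd Complex.I (pd Complex.I (confGauss (X t))) z)
          (dt (fun t => confGauss (X t)) t z) = 0 := by
      rw [← lor_add_left, harm, lor_smul_left, hX.lor_confGauss_dt, mul_zero]
    rw [e, e]
    linarith
  rw [hdiv]
  have hd := (hX.immersion t).detg_pos z
  have hdet : detg (X t) z = g11 (X t) z ^ 2 := by rw [detg, h12, h22]; ring
  have hE : 0 < g11 (X t) z := by
    have h0 : 0 ≤ g11 (X t) z := real_inner_self_nonneg
    refine lt_of_le_of_ne h0 fun h => ?_
    rw [hdet, ← h] at hd
    norm_num at hd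
  have hsq : √(detg (X t) z) = g11 (X t) z := by rw [hdet, Real.sqrt_sq hE.le]
  have d11 := hX.smooth_g11.hasDerivAt t z
  have d12 := hX.smooth_g12.hasDerivAt t z
  have d22 := hX.smooth_g22.hasDerivAt t z
  have l11 := hX.hasDerivAt_lor 1 1 t z
  have l12 := hX.hasDerivAt_lor 1 Complex.I t z
  have l22 := hX.hasDerivAt_lor Complex.I Complex.I t z
  have dd : HasDerivAt (fun t => detg (X t) z) _ t := (d11.mul d22).sub (d12.pow 2)
  have dS := ((d22.mul l11).sub ((d12.const_mul 2).mul l12)).add (d11.mul l22)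
  have dA : HasDerivAt (fun y => (2 * √(detg (X y) z))⁻¹) _ t := ((dd.sqrt hd.ne').const_mul 2).inv (by rw [hsq]; positivity)
  have tot : HasDerivAt (fun t => gaussEnergy (X t) z) _ t := dA.mul dS
  rw [((hX.smooth_gaussEnergy.hasDerivAt t z).unique tot)]
  -- With `X` and `Y` both conformal at this point, the contributions of the time derivatives of the
  -- metric coefficients cancel; only the time derivative of `Y` survives.
  simp only [h12, h22, q12, q22, hsq]
  simp only [lor_comm (pd 1 (dt (fun t => confGauss (X t)) t) z) (pd 1 (confGauss (X t)) z),
    lor_comm (pd Complex.I (dt (fun t => confGauss (X t)) t) z) (pd Complex.I (confGauss (X t)) z)]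
  field_simp
  ring

end IsImmersedFamily

/-- Two families of immersions of the plane in `S³` that fit together to a family of immersions of
the sphere. -/
structure IsSphereFamily (X₀ X₁ : ℝ → ℂ → E4) : Prop where
  left : IsImmersedFamily X₀
  right : IsImmersedFamily X₁
  inv : ∀ t z, z ≠ 0 → X₀ t z = X₁ t z⁻¹

/-! ### First variation of the Willmore integral over the sphere -/

namespace IsSphereFamily

variable {X₀ X₁ : ℝ → ℂ → E4} (hX : IsSphereFamily X₀ X₁)
include hX

theorem gaussEnergy_inv (t : ℝ) {z : ℂ} (hz : z ≠ 0) :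
    gaussEnergy (X₀ t) z = (‖z‖ ^ 4)⁻¹ * gaussEnergy (X₁ t) z⁻¹ :=
  gaussEnergy_of_inv (hX.right.immersion t) (hX.inv t) hz

theorem dt_gaussEnergy_inv (t : ℝ) {z : ℂ} (hz : z ≠ 0) :
    dt (fun t => gaussEnergy (X₀ t)) t z
      = (‖z‖ ^ 4)⁻¹ * dt (fun t => gaussEnergy (X₁ t)) t z⁻¹ := by
  have h1 := hX.left.smooth_gaussEnergy.hasDerivAt t z
  have h2 := (hX.right.smooth_gaussEnergy.hasDerivAt t z⁻¹).const_mul (‖z‖ ^ 4)⁻¹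
  refine h1.unique (h2.congr_of_eventuallyEq (Filter.Eventually.of_forall fun s => ?_))
  exact hX.gaussEnergy_inv s hz

omit hX in
/-- Densities that are continuous on the sphere are bounded by a multiple of `(1 + ‖z‖²)⁻²`. -/
theorem exists_bound_of_density {f₀ f₁ : ℝ → ℂ → ℝ}
    (h₀ : Continuous fun q : ℝ × ℂ => f₀ q.1 q.2) (h₁ : Continuous fun q : ℝ × ℂ => f₁ q.1 q.2)
    (h : ∀ t z, z ≠ 0 → f₀ t z = (‖z‖ ^ 4)⁻¹ * f₁ t z⁻¹) :
    ∃ C, ∀ t ∈ Metric.ball (0 : ℝ) 1, ∀ z, ‖f₀ t z‖ ≤ C * ((1 + ‖z‖ ^ 2) ^ 2)⁻¹ := by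
  have hK : IsCompact (Metric.closedBall (0 : ℝ) 1 ×ˢ Metric.closedBall (0 : ℂ) 1) :=
    (isCompact_closedBall 0 1).prod (isCompact_closedBall 0 1)
  obtain ⟨C₀, hC₀⟩ := hK.exists_bound_of_continuousOn h₀.continuousOn
  obtain ⟨C₁, hC₁⟩ := hK.exists_bound_of_continuousOn h₁.continuousOn
  have p₀ : 0 ≤ C₀ := (norm_nonneg _).trans (hC₀ (0, 0) (by simp))
  have p₁ : 0 ≤ C₁ := (norm_nonneg _).trans (hC₁ (0, 0) (by simp))
  refine ⟨4 * max C₀ C₁, fun t ht z => ?_⟩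
  have ht' : t ∈ Metric.closedBall (0 : ℝ) 1 := Metric.ball_subset_closedBall ht
  rw [← div_eq_mul_inv, le_div_iff₀ (by positivity)]
  -- Compactness of `|t| ≤ 1`, `|z| ≤ 1` in both charts gives a bound uniform in `t`. The factor `4`
  -- bounds `(1 + |z|²)²` inside the disc and `(1 + |z|²)² / |z|⁴` outside.
  by_cases hz : ‖z‖ ≤ 1
  · have h2 := hC₀ (t, z) ⟨ht', by simpa using hz⟩
    have h3 : (1 + ‖z‖ ^ 2) ^ 2 ≤ 4 := by
      have : ‖z‖ ^ 2 ≤ 1 := pow_le_one₀ (norm_nonneg z) hz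
      nlinarith [sq_nonneg ‖z‖]
    calc ‖f₀ t z‖ * (1 + ‖z‖ ^ 2) ^ 2 ≤ C₀ * 4 :=
          mul_le_mul h2 h3 (by positivity) p₀
      _ ≤ 4 * max C₀ C₁ := by linarith [le_max_left C₀ C₁]
  · push Not at hz
    have hz0 : z ≠ 0 := fun h0 => by simp [h0] at hz; linarith
    have h2 := hC₁ (t, z⁻¹) ⟨ht', by simpa using inv_le_one_of_one_le₀ hz.le⟩
    have hz2 : 1 ≤ ‖z‖ ^ 2 := one_le_pow₀ hz.le
    have h3 : (1 + ‖z‖ ^ 2) ^ 2 ≤ 4 * ‖z‖ ^ 4 := by nlinarith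
    rw [h t z hz0, norm_mul, norm_inv, Real.norm_of_nonneg (by positivity : 0 ≤ ‖z‖ ^ 4)]
    calc (‖z‖ ^ 4)⁻¹ * ‖f₁ t z⁻¹‖ * (1 + ‖z‖ ^ 2) ^ 2 ≤ (‖z‖ ^ 4)⁻¹ * C₁ * (4 * ‖z‖ ^ 4) := by
          gcongr
      _ = 4 * C₁ := by field_simp
      _ ≤ 4 * max C₀ C₁ := by linarith [le_max_right C₀ C₁]

open MeasureTheory in
theorem integrable_gaussEnergy : Integrable (gaussEnergy (X₀ 0)) := by
  obtain ⟨C, hC⟩ := exists_bound_of_density hX.left.smooth_gaussEnergy.continuous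
    hX.right.smooth_gaussEnergy.continuous fun t z hz => hX.gaussEnergy_inv t hz
  exact (integrable_inv_one_add_norm_sq_sq.const_mul C).mono'
    (hX.left.smooth_gaussEnergy.slice 0).continuous.aestronglyMeasurable
    (Filter.Eventually.of_forall fun z => hC 0 (by simp) z)

-- Differentiation under the integral. The time derivative of the density obeys the same inversion
-- law as the density itself, so for `|t| < 1` it has one integrable majorant `C (1 + |z|²)⁻²`.
open MeasureTheory in
theorem hasDerivAt_integral_gaussEnergy :
    Integrable (dt (fun t => gaussEnergy (X₀ t)) 0) ∧
    HasDerivAt (fun t => ∫ z, gaussEnergy (X₀ t) z)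
      (∫ z, dt (fun t => gaussEnergy (X₀ t)) 0 z) 0 := by
  obtain ⟨C, hC⟩ := exists_bound_of_density hX.left.smooth_gaussEnergy.dt.continuous
    hX.right.smooth_gaussEnergy.dt.continuous fun t z hz => hX.dt_gaussEnergy_inv t hz
  refine hasDerivAt_integral_of_dominated_loc_of_deriv_le (Metric.ball_mem_nhds (0 : ℝ) one_pos)
    (bound := fun z => C * ((1 + ‖z‖ ^ 2) ^ 2)⁻¹)
    (Filter.Eventually.of_forall fun t =>
      (hX.left.smooth_gaussEnergy.slice t).continuous.aestronglyMeasurable)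
    hX.integrable_gaussEnergy
    (hX.left.smooth_gaussEnergy.dt.slice 0).continuous.aestronglyMeasurable
    (Filter.Eventually.of_forall fun z t ht => hC t ht z)
    (integrable_inv_one_add_norm_sq_sq.const_mul C)
    (Filter.Eventually.of_forall fun z t _ => hX.left.smooth_gaussEnergy.hasDerivAt t z)

open MeasureTheory in
/-- A sphere whose conformal Gauss map is conformal and harmonic on a dense set is a critical point
of the Willmore functional. -/
theorem hasDerivAt_integral_gaussEnergy_zero {S : Set ℂ} (hS : Dense S)
    (hharm : ∀ z ∈ S, g12 (X₀ 0) z = 0 ∧ g22 (X₀ 0) z = g11 (X₀ 0) z ∧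
      lor (pd 1 (confGauss (X₀ 0)) z) (pd Complex.I (confGauss (X₀ 0)) z) = 0 ∧
      lor (pd Complex.I (confGauss (X₀ 0)) z) (pd Complex.I (confGauss (X₀ 0)) z) =
        lor (pd 1 (confGauss (X₀ 0)) z) (pd 1 (confGauss (X₀ 0)) z) ∧
      ∃ c : ℝ, pd 1 (pd 1 (confGauss (X₀ 0))) z
        + pd Complex.I (pd Complex.I (confGauss (X₀ 0))) z = c • confGauss (X₀ 0) z) :
    HasDerivAt (fun t => ∫ z, gaussEnergy (X₀ t) z) 0 0 := by
  obtain ⟨hint, hder⟩ := hX.hasDerivAt_integral_gaussEnergy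
  have hY : ContDiff ℝ ∞ (confGauss (X₀ 0)) := (hX.left.immersion 0).contDiff_confGauss
  -- The field whose divergence is the first variation. Its factor `∂Y` decays like `|z|⁻²` and its
  -- factor `∂Y/∂t` is bounded, because both `Y` and `∂Y/∂t` are restrictions of maps on the sphere.
  let V : ℂ → ℂ → ℝ := fun v w =>
    lor (pd v (confGauss (X₀ 0)) w) (dt (fun t => confGauss (X₀ t)) 0 w)
  have hdt : ContDiff ℝ ∞ (dt (fun t => confGauss (X₀ t)) 0) :=
    hX.left.smooth_confGauss.dt.slice 0
  have hdt₁ : ContDiff ℝ ∞ (dt (fun t => confGauss (X₁ t)) 0) :=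
    hX.right.smooth_confGauss.dt.slice 0
  have hV : ∀ v, ContDiff ℝ ∞ (V v) := fun v => contDiff_lor (contDiff_pd hY v) hdt
  have hYinv : ∀ t z, z ≠ 0 → confGauss (X₀ t) z = confGauss (X₁ t) z⁻¹ := fun t z hz =>
    confGauss_of_inv (hX.right.immersion t) (hX.inv t) hz
  obtain ⟨C₁, hC₁⟩ := exists_norm_fderiv_le_of_inv (hYinv 0) hY
    (hX.right.immersion 0).contDiff_confGauss
  have hdtinv : ∀ z, z ≠ 0 → dt (fun t => confGauss (X₀ t)) 0 z
      = dt (fun t => confGauss (X₁ t)) 0 z⁻¹ := by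
    intro z hz
    have h1 := hX.left.smooth_confGauss.hasDerivAt 0 z
    have h2 := hX.right.smooth_confGauss.hasDerivAt 0 z⁻¹
    exact h1.unique (h2.congr_of_eventuallyEq (Filter.Eventually.of_forall fun s => hYinv s z hz))
  obtain ⟨C₂, hC₂⟩ : ∃ C, ∀ z, ‖dt (fun t => confGauss (X₀ t)) 0 z‖ ≤ C := by
    have hK : IsCompact (Metric.closedBall (0 : ℂ) 1) := isCompact_closedBall 0 1
    obtain ⟨A, hA⟩ := hK.exists_bound_of_continuousOn hdt.continuous.continuousOn
    obtain ⟨B, hB⟩ := hK.exists_bound_of_continuousOn hdt₁.continuous.continuousOn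
    refine ⟨max A B, fun z => ?_⟩
    by_cases hz : ‖z‖ ≤ 1
    · exact (hA z (by simpa using hz)).trans (le_max_left _ _)
    · push Not at hz
      have hz0 : z ≠ 0 := fun h0 => by simp [h0] at hz; linarith
      rw [hdtinv z hz0]
      exact (hB z⁻¹ (by simpa using inv_le_one_of_one_le₀ hz.le)).trans (le_max_right _ _)
  have hbound : ∀ v : ℂ, ‖v‖ = 1 → ∀ z, |V v z| ≤ (2 * C₁ * C₂) * (1 + ‖z‖ ^ 2)⁻¹ := by
    intro v hv z
    have hC₂0 : 0 ≤ C₂ := (norm_nonneg _).trans (hC₂ 0)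
    refine (abs_lor_le _ _).trans ?_
    have h1 : ‖pd v (confGauss (X₀ 0)) z‖ ≤ C₁ * (1 + ‖z‖ ^ 2)⁻¹ := by
      have := ContinuousLinearMap.le_of_opNorm_le _ (hC₁ z) v
      rwa [hv, mul_one] at this
    calc 2 * (‖pd v (confGauss (X₀ 0)) z‖ * ‖dt (fun t => confGauss (X₀ t)) 0 z‖)
        ≤ 2 * (C₁ * (1 + ‖z‖ ^ 2)⁻¹ * C₂) := by
          gcongr
          · exact (norm_nonneg _).trans h1
          · exact hC₂ z
      _ = _ := by ring
  -- The divergence formula holds on the dense set, and both sides are continuous, so it holds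
  -- everywhere.
  have heq : dt (fun t => gaussEnergy (X₀ t)) 0 = fun z =>
      pd 1 (V 1) z + pd Complex.I (V Complex.I) z := by
    refine Continuous.ext_on hS (hX.left.smooth_gaussEnergy.dt.slice 0).continuous
      ((contDiff_pd (hV 1) 1).continuous.add (contDiff_pd (hV _) Complex.I).continuous)
      fun z hz => ?_
    obtain ⟨h1, h2, h3, h4, c, h5⟩ := hharm z hz
    exact hX.left.dt_gaussEnergy h1 h2 h3 h4 h5
  rw [heq] at hint hder
  rwa [integral_divergence_eq_zero (hV 1) (hV Complex.I) (hbound 1 (by simp))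
    (hbound Complex.I (by simp)) hint] at hder

end IsSphereFamily

/-! ### Spheres in `S³` in the two standard charts -/

section Charts

variable {F : Type*}

/-- A map on the sphere in the affine coordinate. -/
def chart₀ (φ : CP1 → F) (z : ℂ) : F := φ (z : CP1)

/-- A map on the sphere in the coordinate at infinity. -/
def chart₁ (φ : CP1 → F) (w : ℂ) : F := φ (coord OnePoint.infty w)

theorem coord_coe (z w : ℂ) : coord (z : CP1) w = ((z + w : ℂ) : CP1) := rfl

theorem coord_infty_zero : coord OnePoint.infty 0 = OnePoint.infty := if_pos rfl

theorem coord_infty {w : ℂ} (hw : w ≠ 0) : coord OnePoint.infty w = ((w⁻¹ : ℂ) : CP1) := if_neg hw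

theorem chart₀_eq (φ : CP1 → F) {z : ℂ} (hz : z ≠ 0) : chart₀ φ z = chart₁ φ z⁻¹ := by
  rw [chart₀, chart₁, coord_infty (inv_ne_zero hz), inv_inv]

theorem chart₁_eq (φ : CP1 → F) {w : ℂ} (hw : w ≠ 0) : chart₁ φ w = chart₀ φ w⁻¹ := by
  rw [chart₀_eq φ (inv_ne_zero hw), inv_inv]

end Charts

theorem isPlaneImmersion_of_injective {X : ℂ → E4} (hs : ContDiff ℝ ∞ X) (hn : ∀ z, ‖X z‖ = 1)
    (hi : ∀ z, Function.Injective (fderiv ℝ X z)) : IsPlaneImmersion X := by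
  refine ⟨hs, hn, fun z => ?_⟩
  have h0 : ∀ v, v ≠ 0 → fderiv ℝ X z v ≠ 0 := fun v hv h =>
    hv (hi z (h.trans (map_zero _).symm))
  have h22 : 0 < g22 X z := by
    have := h0 Complex.I Complex.I_ne_zero
    exact real_inner_self_pos.2 this
  -- With `E, F, G` the metric coefficients, the image of `G - F i` has squared length `G (E G -
  -- F²)`, so injectivity makes the determinant positive.
  have h1 := h0 ((g22 X z : ℂ) - (g12 X z : ℂ) * Complex.I) (fun h => by
    have := congrArg Complex.re h
    simp at this
    exact h22.ne' this)
  have h2 := real_inner_self_pos.2 h1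
  rw [apply_eq_re_im (fderiv ℝ X z)] at h2
  simp only [Complex.sub_re, Complex.ofReal_re, Complex.mul_re, Complex.I_re, mul_zero,
    Complex.ofReal_im, Complex.I_im, mul_one, sub_self, sub_zero, Complex.sub_im, Complex.mul_im,
    add_zero, zero_sub, inner_add_left, inner_add_right, inner_smul_left, inner_smul_right,
    conj_trivial] at h2
  rw [real_inner_comm (fderiv ℝ X z 1) (fderiv ℝ X z Complex.I)] at h2
  change 0 < g22 X z * (g22 X z * g11 X z + _ * g12 X z) + _ * (_ * g12 X z
    + _ * g22 X z) at h2
  have h3 : 0 < g22 X z * detg X z := by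
    rw [detg]
    linarith
  exact (mul_pos_iff_of_pos_left h22).1 h3

theorem contDiffAt_of_inv {F : Type*} [NormedAddCommGroup F] [NormedSpace ℝ F] {f g : ℂ → F}
    (h : ∀ z, z ≠ 0 → f z = g z⁻¹) {z : ℂ} (hz : z ≠ 0) (hg : ContDiffAt ℝ ∞ g z⁻¹) :
    ContDiffAt ℝ ∞ f z := by
  have h1 : f =ᶠ[𝓝 z] g ∘ fun w => w⁻¹ := by
    filter_upwards [isOpen_ne.mem_nhds hz] with w hw using h w hw
  refine ContDiffAt.congr_of_eventuallyEq ?_ h1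
  exact hg.comp z (contDiffAt_inv ℝ hz)

namespace IsSphericalImmersion

variable {φ : CP1 → E4} (hφ : IsSphericalImmersion φ)
include hφ

/-- The hypotheses speak only of the origin of each centred coordinate; translations carry them to
all points of the plane. -/
theorem chart₀ : IsPlaneImmersion (chart₀ φ) := by
  have key : ∀ z w : ℂ, WillmoreSphere.chart₀ φ w = (fun w => φ (coord (z : CP1) w)) (w - z) := by
    intro z w
    simp only [coord_coe, add_sub_cancel]
    rfl
  have hs : ContDiff ℝ ∞ (WillmoreSphere.chart₀ φ) := by
    rw [contDiff_iff_contDiffAt]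
    intro z
    rw [funext (key z)]
    refine ContDiffAt.comp z (g := fun w => φ (coord (z : CP1) w)) ?_
      (contDiffAt_id.sub contDiffAt_const)
    simpa using (hφ z).2.1
  refine isPlaneImmersion_of_injective hs (fun z => (hφ z).1) fun z => ?_
  rw [funext (key z)]
  have : fderiv ℝ (fun w => (fun w => φ (coord (z : CP1) w)) (w - z)) z
      = fderiv ℝ (fun w => φ (coord (z : CP1) w)) 0 := by
    have h := fderiv_comp_sub (𝕜 := ℝ) (f := fun w => φ (coord (z : CP1) w)) (x := z) z
    rwa [sub_self] at h
  rw [this]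
  exact (hφ z).2.2

theorem chart₁ : IsPlaneImmersion (chart₁ φ) := by
  have h0 := hφ.chart₀
  have hs : ContDiff ℝ ∞ (WillmoreSphere.chart₁ φ) := by
    rw [contDiff_iff_contDiffAt]
    intro w
    by_cases hw : w = 0
    · rw [hw]
      exact (hφ OnePoint.infty).2.1
    · exact contDiffAt_of_inv (fun w hw => chart₁_eq φ hw) hw h0.contDiff.contDiffAt
  refine isPlaneImmersion_of_injective hs (fun w => (hφ _).1) fun w => ?_
  by_cases hw : w = 0
  · rw [hw]
    exact (hφ OnePoint.infty).2.2
  · have hi : Function.Injective (fderiv ℝ (WillmoreSphere.chart₀ φ) w⁻¹) := by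
      intro a b hab
      have hd := h0.detg_pos w⁻¹
      by_contra hne
      have h1 : fderiv ℝ (WillmoreSphere.chart₀ φ) w⁻¹ (a - b) = 0 := by
        rw [map_sub, hab, sub_self]
      rw [apply_eq_re_im] at h1
      set c := a - b with hc
      have hc0 : c ≠ 0 := sub_ne_zero.2 hne
      have i1 := congrArg (fun v : E4 => (⟪v, pd 1 (WillmoreSphere.chart₀ φ) w⁻¹⟫ : ℝ)) h1
      have i2 := congrArg (fun v : E4 => (⟪v, pd Complex.I (WillmoreSphere.chart₀ φ) w⁻¹⟫ : ℝ)) h1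
      simp only [inner_add_left, inner_smul_left, conj_trivial, inner_zero_left] at i1 i2
      rw [real_inner_comm] at i1
      have j1 : c.re * g11 (WillmoreSphere.chart₀ φ) w⁻¹
          + c.im * g12 (WillmoreSphere.chart₀ φ) w⁻¹ = 0 := by
        rw [← i1, real_inner_comm (pd 1 (WillmoreSphere.chart₀ φ) w⁻¹)
          (fderiv ℝ (WillmoreSphere.chart₀ φ) w⁻¹ Complex.I)]
        rfl
      have j2 : c.re * g12 (WillmoreSphere.chart₀ φ) w⁻¹
          + c.im * g22 (WillmoreSphere.chart₀ φ) w⁻¹ = 0 := i2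
      have k1 : c.re * detg (WillmoreSphere.chart₀ φ) w⁻¹ = 0 := by
        rw [detg]
        linear_combination g22 (WillmoreSphere.chart₀ φ) w⁻¹ * j1
          - g12 (WillmoreSphere.chart₀ φ) w⁻¹ * j2
      have k2 : c.im * detg (WillmoreSphere.chart₀ φ) w⁻¹ = 0 := by
        rw [detg]
        linear_combination g11 (WillmoreSphere.chart₀ φ) w⁻¹ * j2
          - g12 (WillmoreSphere.chart₀ φ) w⁻¹ * j1
      exact hc0 (Complex.ext ((mul_eq_zero_iff_right hd.ne').1 k1)
        ((mul_eq_zero_iff_right hd.ne').1 k2))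
    have e : ∀ v, fderiv ℝ (WillmoreSphere.chart₁ φ) w v
        = fderiv ℝ (WillmoreSphere.chart₀ φ) w⁻¹ (-(w ^ 2)⁻¹ * v) := fun v =>
      fderiv_of_inv (fun w hw => chart₁_eq φ hw) hw (h0.contDiff.diffAt _) v
    intro a b hab
    rw [e, e] at hab
    exact mul_left_cancel₀ (by simpa using hw) (hi hab)

open MeasureTheory in
theorem willmoreEnergy_eq : willmoreEnergy φ = ∫ z, gaussEnergy (WillmoreSphere.chart₀ φ) z := by
  rw [willmoreEnergy]
  exact integral_congr_ae (Filter.Eventually.of_forall fun z => hφ.chart₀.willmore_density z)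

end IsSphericalImmersion

theorem IsVariation.isSphereFamily {φ : CP1 → E4} {Φ : ℝ → CP1 → E4} (hΦ : IsVariation φ Φ) :
    IsSphereFamily (fun t => chart₀ (Φ t)) (fun t => chart₁ (Φ t)) := by
  obtain ⟨-, him, hs⟩ := hΦ
  have s₀ : IsSmoothFamily fun t => chart₀ (Φ t) := by
    rw [IsSmoothFamily, contDiff_iff_contDiffAt]
    rintro ⟨t, z⟩
    have key : (fun q : ℝ × ℂ => chart₀ (Φ q.1) q.2) =
        (fun q : ℝ × ℂ => Φ q.1 (coord (z : CP1) q.2)) ∘ fun q : ℝ × ℂ => (q.1, q.2 - z) := by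
      funext q
      simp only [Function.comp, coord_coe, add_sub_cancel]
      rfl
    rw [key]
    refine ContDiffAt.comp (t, z) ?_ (contDiffAt_fst.prodMk (contDiffAt_snd.sub contDiffAt_const))
    simpa using hs t z
  refine ⟨⟨s₀, fun t => (him t).chart₀⟩, ⟨?_, fun t => (him t).chart₁⟩,
    fun t z hz => chart₀_eq _ hz⟩
  rw [IsSmoothFamily, contDiff_iff_contDiffAt]
  rintro ⟨t, w⟩
  by_cases hw : w = 0
  · rw [hw]
    exact hs t OnePoint.infty
  · have h1 : (fun q : ℝ × ℂ => chart₁ (Φ q.1) q.2) =ᶠ[𝓝 (t, w)]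
        (fun q : ℝ × ℂ => chart₀ (Φ q.1) q.2) ∘ fun q : ℝ × ℂ => (q.1, q.2⁻¹) := by
      have : {q : ℝ × ℂ | q.2 ≠ 0} ∈ 𝓝 (t, w) :=
        (isOpen_ne.preimage continuous_snd).mem_nhds hw
      filter_upwards [this] with q hq using chart₁_eq _ hq
    refine ContDiffAt.congr_of_eventuallyEq ?_ h1
    exact ContDiffAt.comp (t, w) s₀.contDiffAt (contDiffAt_fst.prodMk
      ((contDiffAt_inv ℝ hw).comp (t, w) contDiffAt_snd))

theorem isWillmoreSphere_of_harmonic {φ : CP1 → E4} (hφ : IsSphericalImmersion φ) {S : Set ℂ}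
    (hS : Dense S)
    (hharm : ∀ z ∈ S, g12 (chart₀ φ) z = 0 ∧ g22 (chart₀ φ) z = g11 (chart₀ φ) z ∧
      lor (pd 1 (confGauss (chart₀ φ)) z) (pd Complex.I (confGauss (chart₀ φ)) z) = 0 ∧
      lor (pd Complex.I (confGauss (chart₀ φ)) z) (pd Complex.I (confGauss (chart₀ φ)) z) =
        lor (pd 1 (confGauss (chart₀ φ)) z) (pd 1 (confGauss (chart₀ φ)) z) ∧
      ∃ c : ℝ, pd 1 (pd 1 (confGauss (chart₀ φ))) z
        + pd Complex.I (pd Complex.I (confGauss (chart₀ φ))) z = c • confGauss (chart₀ φ) z) :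
    IsWillmoreSphere φ := by
  refine ⟨hφ, fun Φ hΦ => ?_⟩
  have h := hΦ.isSphereFamily.hasDerivAt_integral_gaussEnergy_zero hS
  rw [hΦ.1] at h
  refine (h hharm).congr_of_eventuallyEq (Filter.Eventually.of_forall fun t => ?_)
  exact (hΦ.2.1 t).willmoreEnergy_eq

/-! ### Surfaces in `S³` coming from surfaces in `ℝ³` -/

/-- The isometry `ℝ³ × ℝ → ℝ⁴`. -/
def glue : E3 × ℝ →L[ℝ] E4 :=
  LinearMap.toContinuousLinearMap
    { toFun := fun p => !₂[p.1 0, p.1 1, p.1 2, p.2]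
      map_add' := fun p q => by ext i; fin_cases i <;> simp
      map_smul' := fun c p => by ext i; fin_cases i <;> simp }

theorem glue_apply (p : E3 × ℝ) : glue p = !₂[p.1 0, p.1 1, p.1 2, p.2] := rfl

theorem inner_glue (p q : E3 × ℝ) : ⟪glue p, glue q⟫ = ⟪p.1, q.1⟫ + p.2 * q.2 := by
  rw [inner_E4, inner_E3, glue_apply, glue_apply]
  simp

/-- Inverse stereographic projection. -/
def invStereo (y : E3) : E4 := glue ((2 * (1 + ⟪y, y⟫)⁻¹) • y, 1 - 2 * (1 + ⟪y, y⟫)⁻¹)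

theorem one_add_inner_self_pos (y : E3) : (0 : ℝ) < 1 + ⟪y, y⟫ := by
  have : (0 : ℝ) ≤ ⟪y, y⟫ := real_inner_self_nonneg
  linarith

section InvStereo

variable {f n : ℂ → E3} {z : ℂ}

theorem pd_invStereo (hf : DifferentiableAt ℝ f z) (v : ℂ) :
    pd v (fun w => invStereo (f w)) z =
      glue ((-(4 * ((1 + ⟪f z, f z⟫)⁻¹) ^ 2 * ⟪f z, pd v f z⟫)) • f z
        + (2 * (1 + ⟪f z, f z⟫)⁻¹) • pd v f z,
        4 * ((1 + ⟪f z, f z⟫)⁻¹) ^ 2 * ⟪f z, pd v f z⟫) := by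
  have h0 := (one_add_inner_self_pos (f z)).ne'
  have h1 := hf.hasFDerivAt
  have h2 : HasFDerivAt (fun w => (2 * (1 + ⟪f w, f w⟫)⁻¹ : ℝ)) _ z :=
    ((hasDerivAt_inv h0).comp_hasFDerivAt z ((h1.inner ℝ h1).const_add 1)).const_mul 2
  have h3 : HasFDerivAt (fun w => invStereo (f w)) _ z :=
    glue.hasFDerivAt.comp z ((h2.smul h1).prodMk (h2.const_sub 1))
  rw [pd, h3.fderiv]
  have h4 : fderiv ℝ f z v = pd v f z := rfl
  simp only [ContinuousLinearMap.comp_apply]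
  congr 1
  ext1
  · simp [h4, smul_smul, real_inner_comm (f z) (pd v f z)]
    module
  · simp [h4, real_inner_comm (f z) (pd v f z)]
    ring

theorem inner_pd_invStereo (hf : DifferentiableAt ℝ f z) (u v : ℂ) :
    ⟪pd u (fun w => invStereo (f w)) z, pd v (fun w => invStereo (f w)) z⟫ =
      (4 * ((1 + ⟪f z, f z⟫)⁻¹) ^ 2 * ⟪pd u f z, pd v f z⟫ : ℝ) := by
  have h0 := (one_add_inner_self_pos (f z)).ne'
  rw [pd_invStereo hf, pd_invStereo hf, inner_glue]
  simp only [inner_add_left, inner_add_right, inner_smul_left, inner_smul_right, conj_trivial,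
    real_inner_comm (f z) (pd u f z)]
  field_simp
  ring

theorem norm_invStereo (y : E3) : ‖invStereo y‖ = 1 := by
  have h0 := (one_add_inner_self_pos y).ne'
  have : (⟪invStereo y, invStereo y⟫ : ℝ) = 1 := by
    rw [invStereo, inner_glue]
    simp only [inner_smul_left, inner_smul_right, conj_trivial]
    field_simp
    ring
  rw [real_inner_self_eq_norm_sq] at this
  exact (pow_eq_one_iff_of_nonneg (norm_nonneg _) two_ne_zero).1 this

end InvStereo

/-- The conformal Gauss map is characterized up to sign by orthogonality relations. -/
theorem IsPlaneImmersion.confGauss_eventuallyEq {X : ℂ → E4} (hX : IsPlaneImmersion X)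
    {y : ℂ → E4} {η : ℂ → ℝ} {z₀ : ℂ}
    (h : ∀ᶠ z in 𝓝 z₀, DifferentiableAt ℝ y z ∧ DifferentiableAt ℝ η z ∧
      g12 X z = 0 ∧ g22 X z = g11 X z ∧
      ⟪y z - η z • X z, y z - η z • X z⟫ = (1 : ℝ) ∧ ⟪y z - η z • X z, X z⟫ = (0 : ℝ) ∧
      (∀ v, ⟪y z - η z • X z, pd v X z⟫ = (0 : ℝ)) ∧
      (⟪pd 1 X z, pd 1 y z⟫ + ⟪pd Complex.I X z, pd Complex.I y z⟫ : ℝ) = 0) :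
    ∃ s : ℝ, s ^ 2 = 1 ∧ confGauss X =ᶠ[𝓝 z₀] fun z => s • (y z, η z) := by
  set m : ℂ → E4 := fun z => y z - η z • X z with hm
  set c : ℂ → ℝ := fun z => ⟪m z, nu X z⟫ with hc
  have hmd : ∀ z, DifferentiableAt ℝ y z → DifferentiableAt ℝ η z → DifferentiableAt ℝ m z :=
    fun z h1 h2 => h1.sub (h2.smul (hX.contDiff.diffAt z))
  -- The vector `m = y - η X` is a unit vector orthogonal to `X` and to the surface, so by `frame`
  -- it is `ν` up to the sign `c`.
  have hcm : ∀ᶠ z in 𝓝 z₀, c z ^ 2 = 1 ∧ nu X z = c z • m z := by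
    filter_upwards [h] with z hz
    obtain ⟨-, -, -, -, h1, h2, h3, -⟩ := hz
    have hf := hX.frame z (m z) (m z)
    have h1' : (⟪m z, m z⟫ : ℝ) = 1 := h1
    have h2' : (⟪m z, X z⟫ : ℝ) = 0 := h2
    have h3' : ∀ v, (⟪m z, pd v X z⟫ : ℝ) = 0 := h3
    rw [h1', h2', h3' 1, h3' Complex.I] at hf
    have hsq : c z ^ 2 = 1 := by
      apply mul_left_cancel₀ (hX.detg_pos z).ne'
      change detg X z * (c z * c z) = _ at hf
      linear_combination hf
    refine ⟨hsq, ?_⟩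
    have : (⟪nu X z - c z • m z, nu X z - c z • m z⟫ : ℝ) = 0 := by
      simp only [inner_sub_left, inner_sub_right, inner_smul_left, inner_smul_right, conj_trivial,
        h1', hX.nu_inner_nu, real_inner_comm (m z) (nu X z)]
      change 1 - c z * c z - c z * (c z - c z * 1) = 0
      linear_combination -hsq
    exact sub_eq_zero.1 (inner_self_eq_zero.1 this)
  have hcc : ContinuousAt c z₀ := by
    obtain ⟨h1, h2, -⟩ := h.self_of_nhds
    exact ContinuousAt.inner (𝕜 := ℝ) (hmd z₀ h1 h2).continuousAt hX.contDiff_nu.continuous.continuousAt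
  -- A continuous function with values `±1` is locally constant; this allows the relation between
  -- `ν` and `m` to be differentiated.
  have hconst : ∀ᶠ z in 𝓝 z₀, c z = c z₀ := by
    have h0 := hcm.self_of_nhds.1
    have hcl : ∀ᶠ z in 𝓝 z₀, |c z - c z₀| < 1 := by
      have := hcc.eventually (Metric.ball_mem_nhds (c z₀) one_pos)
      filter_upwards [this] with z hz
      exact hz
    filter_upwards [hcl, hcm] with z h1 h2
    have h3 := h2.1
    rcases sq_eq_sq_iff_eq_or_eq_neg.1 (h3.trans h0.symm) with h | h
    · exact h
    · rw [h] at h1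
      have := (sq_lt_one_iff_abs_lt_one _).2 h1
      nlinarith
  refine ⟨c z₀, hcm.self_of_nhds.1, ?_⟩
  have hnu : ∀ᶠ z in 𝓝 z₀, nu X z = c z₀ • m z := by
    filter_upwards [hconst, hcm] with z h1 h2
    rw [h2.2, h1]
  filter_upwards [h, hnu, hnu.eventually_nhds] with z hz hz1 hz2
  obtain ⟨hy, hη, h12, h22, -, -, -, hsum⟩ := hz
  have hpd : ∀ v, (⟪pd v X z, pd v (nu X) z⟫ : ℝ) =
      c z₀ * (⟪pd v X z, pd v y z⟫ - η z * ⟪pd v X z, pd v X z⟫) := by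
    intro v
    have e1 : HasFDerivAt (fun w => c z₀ • m w) _ z :=
      (hy.hasFDerivAt.sub (hη.hasFDerivAt.smul (hX.contDiff.diffAt z).hasFDerivAt)).const_smul (c z₀)
    have e2 : pd v (nu X) z = c z₀ • (pd v y z - (η z • pd v X z + pd v η z • X z)) := by
      rw [pd_congr hz2 v, pd, e1.fderiv]
      rfl
    rw [e2]
    simp only [inner_sub_right, inner_add_right, inner_smul_right,
      real_inner_comm (X z) (pd v X z), hX.inner_pd]
    ring
  have hd := hX.detg_pos z
  have hdet : detg X z = g11 X z ^ 2 := by rw [detg, h12, h22]; ring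
  have hE : g11 X z ≠ 0 := fun h => by rw [hdet, h] at hd; norm_num at hd
  -- In a conformal coordinate `-2 g₁₁ H` is the sum of the products `⟪X_v, ν_v⟫`. Substituting `ν =
  -- c (y - η X)`, the products with `y` cancel by hypothesis and `H = c η` remains.
  have hmc : meanCurv X z = c z₀ * η z := by
    simp only [meanCurv, sff]
    rw [hdet, h12, h22, hpd, hpd]
    change (2 * g11 X z ^ 2)⁻¹ * (g11 X z * -(c z₀ * (_ - η z * g11 X z)) - _
      + g11 X z * -(c z₀ * (_ - η z * g22 X z))) = _
    rw [h22]
    field_simp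
    linear_combination (- c z₀ * g11 X z) * hsum
  rw [confGauss, hmc, hz1, hm]
  ext1
  · simp only [Prod.smul_mk, smul_sub, smul_smul, sub_add_cancel]
  · simp

/-- The isometric embedding of `ℝ³` with a null direction. -/
def nullGlue : E3 × ℝ →L[ℝ] E4 × ℝ := glue.prod (ContinuousLinearMap.snd ℝ E3 ℝ)

/-- The last factor is embedded along a null direction orthogonal to the image of `ℝ³`, so it does
not contribute to the Lorentz product. -/
theorem lor_nullGlue (p q : E3 × ℝ) : lor (nullGlue p) (nullGlue q) = ⟪p.1, q.1⟫ := by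
  rw [lor]
  change ⟪glue p, glue q⟫ - p.2 * q.2 = _
  rw [inner_glue]
  ring

theorem pd_nullGlue {g : ℂ → E3 × ℝ} {z : ℂ} (hg : DifferentiableAt ℝ g z) (s : ℝ) (v : ℂ) :
    pd v (fun w => s • nullGlue (g w)) z = s • nullGlue (pd v g z) := by
  have h : HasFDerivAt (fun w => s • nullGlue (g w)) _ z :=
    (nullGlue.hasFDerivAt.comp z hg.hasFDerivAt).const_smul s
  rw [pd, h.fderiv]
  rfl

theorem pd_prodMk {E F : Type*} [NormedAddCommGroup E] [NormedSpace ℝ E] [NormedAddCommGroup F]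
    [NormedSpace ℝ F] {f : ℂ → E} {g : ℂ → F} {z : ℂ} (hf : DifferentiableAt ℝ f z)
    (hg : DifferentiableAt ℝ g z) (v : ℂ) : pd v (fun w => (f w, g w)) z = (pd v f z, pd v g z) := by
  rw [pd, (hf.hasFDerivAt.prodMk hg.hasFDerivAt).fderiv]
  rfl

/-- If a sphere is locally the inverse stereographic projection of a conformally parametrized
minimal surface `f` with Gauss map `n`, then its conformal Gauss map is conformal and harmonic. -/
theorem IsPlaneImmersion.harmonic_confGauss {X : ℂ → E4} (hX : IsPlaneImmersion X) {f n : ℂ → E3}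
    {z₀ : ℂ} (hXf : X =ᶠ[𝓝 z₀] fun w => invStereo (f w))
    (hf : ∀ᶠ z in 𝓝 z₀, DifferentiableAt ℝ f z) (hn : ContDiff ℝ ∞ n)
    (h : ∀ᶠ z in 𝓝 z₀, ⟪n z, n z⟫ = (1 : ℝ) ∧ (∀ v, ⟪n z, pd v f z⟫ = (0 : ℝ)) ∧
      ⟪pd 1 f z, pd Complex.I f z⟫ = (0 : ℝ) ∧
      (⟪pd Complex.I f z, pd Complex.I f z⟫ : ℝ) = ⟪pd 1 f z, pd 1 f z⟫ ∧
      (⟪pd 1 f z, pd 1 n z⟫ + ⟪pd Complex.I f z, pd Complex.I n z⟫ : ℝ) = 0)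
    (h12 : ⟪pd 1 n z₀, pd Complex.I n z₀⟫ = (0 : ℝ))
    (h22 : (⟪pd Complex.I n z₀, pd Complex.I n z₀⟫ : ℝ) = ⟪pd 1 n z₀, pd 1 n z₀⟫)
    {c : ℝ} (hc : pd 1 (pd 1 n) z₀ + pd Complex.I (pd Complex.I n) z₀ = c • n z₀) :
    g12 X z₀ = 0 ∧ g22 X z₀ = g11 X z₀ ∧
      lor (pd 1 (confGauss X) z₀) (pd Complex.I (confGauss X) z₀) = 0 ∧
      lor (pd Complex.I (confGauss X) z₀) (pd Complex.I (confGauss X) z₀) =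
        lor (pd 1 (confGauss X) z₀) (pd 1 (confGauss X) z₀) ∧
      (pd 1 (pd 1 (confGauss X)) z₀ + pd Complex.I (pd Complex.I (confGauss X)) z₀
        = c • confGauss X z₀) ∧
      lor (pd 1 (confGauss X) z₀) (pd 1 (confGauss X) z₀) = ⟪pd 1 n z₀, pd 1 n z₀⟫ := by
  -- The support function of the surface. Up to a constant sign the conformal Gauss map is `nullGlue
  -- (n, ρ)`; in particular `ρ` is, up to that sign, the mean curvature in `S³`.
  set ρ : ℂ → ℝ := fun z => ⟪f z, n z⟫ with hρ
  have hmet : ∀ᶠ z in 𝓝 z₀, ∀ u v, (⟪pd u X z, pd v X z⟫ : ℝ) =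
      4 * ((1 + ⟪f z, f z⟫)⁻¹) ^ 2 * ⟪pd u f z, pd v f z⟫ := by
    filter_upwards [hXf.eventually_nhds, hf] with z h1 h2 u v
    rw [pd_congr h1, pd_congr h1, inner_pd_invStereo h2]
  have hconf : ∀ᶠ z in 𝓝 z₀, g12 X z = 0 ∧ g22 X z = g11 X z := by
    filter_upwards [hmet, h] with z h1 h2
    rw [g12, g22, g11, h1, h1, h1, h2.2.2.1, h2.2.2.2.1, mul_zero]
    exact ⟨rfl, rfl⟩
  have hρd : ∀ z, DifferentiableAt ℝ f z → DifferentiableAt ℝ ρ z := fun z hz =>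
    hz.inner ℝ (hn.diffAt z)
  -- The term `⟪f_v, n⟫` vanishes because `n` is normal to the surface.
  have hρv : ∀ᶠ z in 𝓝 z₀, ∀ v, pd v ρ z = ⟪f z, pd v n z⟫ := by
    filter_upwards [hf, h] with z h1 h2 v
    rw [hρ, pd_inner h1 (hn.diffAt z), real_inner_comm, h2.2.1, zero_add]
  obtain ⟨s, hs, hY⟩ := hX.confGauss_eventuallyEq (y := fun z => glue (n z, ρ z)) (η := ρ)
    (z₀ := z₀) (by
      filter_upwards [hXf, hXf.eventually_nhds, hf, h, hρv, hconf] with z e1 e2 e3 e4 e5 e6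
      obtain ⟨i1, i2, -, -, i3⟩ := e4
      have hd : DifferentiableAt ℝ (fun z => (n z, ρ z)) z := (hn.diffAt z).prodMk (hρd z e3)
      have h0 := (one_add_inner_self_pos (f z)).ne'
      have hm : glue (n z, ρ z) - ρ z • X z = glue (n z - (ρ z * (2 * (1 + ⟪f z, f z⟫)⁻¹)) • f z,
          ρ z * (2 * (1 + ⟪f z, f z⟫)⁻¹)) := by
        rw [e1, invStereo, ← map_smul, ← map_sub]
        congr 1
        ext1
        · simp [smul_smul]
        · simp only [Prod.snd_sub, Prod.smul_snd, smul_eq_mul]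
          ring
      have hnf : (⟪n z, f z⟫ : ℝ) = ρ z := real_inner_comm _ _
      have hpy : ∀ v, pd v (fun z => glue (n z, ρ z)) z = glue (pd v n z, ⟪f z, pd v n z⟫) := by
        intro v
        have e : HasFDerivAt (fun z => glue (n z, ρ z)) _ z :=
          glue.hasFDerivAt.comp z hd.hasFDerivAt
        rw [pd, e.fderiv, ← e5 v, ← pd_prodMk (hn.diffAt z) (hρd z e3)]
        rfl
      have hff : (⟪f z, n z⟫ : ℝ) = ρ z := rfl
      refine ⟨glue.differentiableAt.comp z hd, hρd z e3, e6.1, e6.2, ?_, ?_, fun v => ?_, ?_⟩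
      · rw [hm, inner_glue]
        simp only [inner_sub_left, inner_sub_right, inner_smul_left, inner_smul_right,
          conj_trivial, hnf, hff, i1]
        field_simp
        ring
      · rw [hm, e1, invStereo, inner_glue]
        simp only [inner_sub_left, inner_smul_left, inner_smul_right,
          conj_trivial, hnf]
        field_simp
        ring
      · rw [hm, pd_congr e2, pd_invStereo e3, inner_glue]
        simp only [inner_sub_left, inner_add_right, inner_smul_left, inner_smul_right,
          conj_trivial, hnf, i2]
        field_simp
        ring
      · rw [hpy, hpy, pd_congr e2, pd_congr e2, pd_invStereo e3, pd_invStereo e3, inner_glue,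
          inner_glue]
        simp only [inner_add_left, inner_smul_left, conj_trivial]
        -- `i3` is the minimality of `f`: the trace of its second fundamental form vanishes.
        linear_combination 2 * (1 + ⟪f z, f z⟫)⁻¹ * i3)
  have hY' : confGauss X =ᶠ[𝓝 z₀] fun z => s • nullGlue (n z, ρ z) := hY
  have hpd : ∀ᶠ z in 𝓝 z₀, ∀ v, pd v (confGauss X) z
      = s • nullGlue (pd v n z, ⟪f z, pd v n z⟫) := by
    filter_upwards [hY'.eventually_nhds, hf, hρv] with z e1 e2 e3 v
    rw [pd_congr e1, pd_nullGlue ((hn.diffAt z).prodMk (hρd z e2)),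
      pd_prodMk (hn.diffAt z) (hρd z e2), e3]
  have hpp : ∀ v, pd v (pd v (confGauss X)) z₀ = s • nullGlue (pd v (pd v n) z₀,
      ⟪pd v f z₀, pd v n z₀⟫ + ⟪f z₀, pd v (pd v n) z₀⟫) := by
    intro v
    have e1 : pd v (confGauss X) =ᶠ[𝓝 z₀] fun z => s • nullGlue (pd v n z, ⟪f z, pd v n z⟫) :=
      hpd.mono fun z hz => hz v
    have e2 := (contDiff_pd hn v).diffAt z₀
    have e3 := hf.self_of_nhds
    rw [pd_congr e1, pd_nullGlue (e2.prodMk (e3.inner ℝ e2)), pd_prodMk e2 (e3.inner ℝ e2),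
      pd_inner e3 e2]
  have hp0 := hpd.self_of_nhds
  have hlor : ∀ u v, lor (pd u (confGauss X) z₀) (pd v (confGauss X) z₀)
      = ⟪pd u n z₀, pd v n z₀⟫ := by
    intro u v
    rw [hp0, hp0, lor_smul_left, lor_smul_right, lor_nullGlue]
    linear_combination (⟪pd u n z₀, pd v n z₀⟫ : ℝ) * hs
  refine ⟨hconf.self_of_nhds.1, hconf.self_of_nhds.2, (hlor _ _).trans h12, ?_, ?_, hlor _ _⟩
  · rw [hlor, hlor, h22]
  · rw [hpp, hpp, hY'.self_of_nhds, smul_comm c s, ← smul_add, ← map_add]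
    congr 1
    rw [← map_smul]
    congr 1
    ext1
    · exact hc
    -- The Laplacian of `ρ` is `⟪f, Δn⟫` plus the sum of the `⟪f_v, n_v⟫`; the sum vanishes by
    -- minimality, so `ρ` satisfies the same equation as `n`.
    · have i := h.self_of_nhds.2.2.2.2
      have j := congrArg (fun v => (⟪f z₀, v⟫ : ℝ)) hc
      simp only [inner_add_right, inner_smul_right] at j
      change _ + _ + (_ + _) = c * ρ z₀
      linear_combination i + j

/-! ### Wirtinger derivatives -/

open ComplexConjugate in
/-- The real-linear map `v ↦ a v + b v̄`. -/
def wirtingerMap (a b : ℂ) : ℂ →L[ℝ] ℂ :=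
  a • ContinuousLinearMap.id ℝ ℂ + b • (Complex.conjCLE : ℂ →L[ℝ] ℂ)

open ComplexConjugate in
theorem wirtingerMap_apply (a b v : ℂ) : wirtingerMap a b v = a * v + b * conj v := rfl

/-- `F` is real-differentiable at `z` with Wirtinger derivatives `a` and `b`. -/
def HasWirtinger (F : ℂ → ℂ) (a b z : ℂ) : Prop := HasFDerivAt F (wirtingerMap a b) z

namespace HasWirtinger

open ComplexConjugate

variable {F G : ℂ → ℂ} {a b c d z : ℂ}

theorem of_fderiv {L : ℂ →L[ℝ] ℂ} (h : HasFDerivAt F L z) (hL : ∀ v, L v = a * v + b * conj v) :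
    HasWirtinger F a b z := by
  have : L = wirtingerMap a b := ContinuousLinearMap.ext hL
  rwa [this] at h

theorem of_hasDerivAt (h : HasDerivAt F a z) : HasWirtinger F a 0 z :=
  of_fderiv (h.hasFDerivAt.restrictScalars ℝ) fun v => by simp [mul_comm]

theorem of_differentiable (h : Differentiable ℂ F) (z : ℂ) : HasWirtinger F (deriv F z) 0 z :=
  of_hasDerivAt (h z).hasDerivAt

theorem congr_deriv (h : HasWirtinger F a b z) (ha : a = c) (hb : b = d) : HasWirtinger F c d z := by
  rwa [← ha, ← hb]

theorem conj' (h : HasWirtinger F a b z) : HasWirtinger (fun w => conj (F w)) (conj b) (conj a) z :=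
  of_fderiv ((Complex.conjCLE : ℂ →L[ℝ] ℂ).hasFDerivAt.comp z h) fun v => by
    change conj (wirtingerMap a b v) = _
    rw [wirtingerMap_apply]
    simp
    ring

theorem add (hF : HasWirtinger F a b z) (hG : HasWirtinger G c d z) :
    HasWirtinger (fun w => F w + G w) (a + c) (b + d) z :=
  of_fderiv (HasFDerivAt.add hF hG) fun v => by
    change wirtingerMap a b v + wirtingerMap c d v = _
    rw [wirtingerMap_apply, wirtingerMap_apply]
    ring

theorem sub (hF : HasWirtinger F a b z) (hG : HasWirtinger G c d z) :
    HasWirtinger (fun w => F w - G w) (a - c) (b - d) z :=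
  of_fderiv (HasFDerivAt.sub hF hG) fun v => by
    change wirtingerMap a b v - wirtingerMap c d v = _
    rw [wirtingerMap_apply, wirtingerMap_apply]
    ring

theorem mul (hF : HasWirtinger F a b z) (hG : HasWirtinger G c d z) :
    HasWirtinger (fun w => F w * G w) (a * G z + F z * c) (b * G z + F z * d) z :=
  of_fderiv (HasFDerivAt.mul hF hG) fun v => by
    change F z * wirtingerMap c d v + G z * wirtingerMap a b v = _
    rw [wirtingerMap_apply, wirtingerMap_apply]
    ring

theorem const_mul (hF : HasWirtinger F a b z) (c : ℂ) :
    HasWirtinger (fun w => c * F w) (c * a) (c * b) z :=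
  of_fderiv (HasFDerivAt.const_mul hF c) fun v => by
    change c * wirtingerMap a b v = _
    rw [wirtingerMap_apply]
    ring

theorem inv (hF : HasWirtinger F a b z) (h0 : F z ≠ 0) :
    HasWirtinger (fun w => (F w)⁻¹) (-a / F z ^ 2) (-b / F z ^ 2) z :=
  of_fderiv (((hasDerivAt_inv h0).hasFDerivAt.restrictScalars ℝ).comp z hF) fun v => by
    change wirtingerMap a b v * (-(F z ^ 2)⁻¹) = _
    rw [wirtingerMap_apply]
    ring

theorem div (hF : HasWirtinger F a b z) (hG : HasWirtinger G c d z) (h0 : G z ≠ 0) :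
    HasWirtinger (fun w => F w / G w) ((a * G z - F z * c) / G z ^ 2)
      ((b * G z - F z * d) / G z ^ 2) z := by
  simp only [div_eq_mul_inv]
  refine (hF.mul (hG.inv h0)).congr_deriv ?_ ?_ <;> · field_simp; try ring

end HasWirtinger

/-! ### Real parts of vectors of `ℂ³` -/

/-- The real part of a vector of `ℂ³`. -/
def re3 : (Fin 3 → ℂ) →L[ℝ] E3 :=
  LinearMap.toContinuousLinearMap
    { toFun := fun v => WithLp.toLp 2 fun i => (v i).re
      map_add' := fun p q => by ext i; simp
      map_smul' := fun c p => by ext i; simp }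

theorem re3_apply (v : Fin 3 → ℂ) (i : Fin 3) : re3 v i = (v i).re := rfl

theorem inner_re3 (a b : Fin 3 → ℂ) :
    ⟪re3 a, re3 b⟫ = (a 0).re * (b 0).re + (a 1).re * (b 1).re + (a 2).re * (b 2).re := by
  rw [inner_E3]
  rfl

open ComplexConjugate in
theorem inner_re3_complex (a b : Fin 3 → ℂ) :
    ((⟪re3 a, re3 b⟫ : ℝ) : ℂ) = ((a 0 + conj (a 0)) * (b 0 + conj (b 0))
      + (a 1 + conj (a 1)) * (b 1 + conj (b 1)) + (a 2 + conj (a 2)) * (b 2 + conj (b 2))) / 4 := by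
  rw [inner_re3]
  push_cast
  simp only [Complex.re_eq_add_conj]
  ring

/-- The sum of the squares of the absolute values of the coordinates. -/
def nsq3 (q : Fin 3 → ℂ) : ℝ := Complex.normSq (q 0) + Complex.normSq (q 1) + Complex.normSq (q 2)

/-- Writing real parts as half sums with conjugates, the terms in `q · q` and its conjugate vanish
by isotropy and only the Hermitian product survives. This is how conformality enters. -/
theorem inner_re3_isotropic {q : Fin 3 → ℂ} (hq : q 0 ^ 2 + q 1 ^ 2 + q 2 ^ 2 = 0) (α β : ℂ) :
    (⟪re3 (α • q), re3 (β • q)⟫ : ℝ) = (α * (starRingEnd ℂ) β).re * nsq3 q / 2 := by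
  have hq' := congrArg (starRingEnd ℂ) hq
  simp only [map_add, map_pow, map_zero] at hq'
  apply Complex.ofReal_injective
  rw [inner_re3_complex, nsq3]
  push_cast
  rw [Complex.re_eq_add_conj]
  simp only [Complex.normSq_eq_conj_mul_self, Pi.smul_apply, smul_eq_mul, map_mul, Complex.conj_conj]
  linear_combination α * β / 4 * hq + (starRingEnd ℂ) α * (starRingEnd ℂ) β / 4 * hq'

theorem inner_re3_isotropic_conj {q : Fin 3 → ℂ} (hq : q 0 ^ 2 + q 1 ^ 2 + q 2 ^ 2 = 0) (α β : ℂ) :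
    (⟪re3 (α • q), re3 (β • fun j => (starRingEnd ℂ) (q j))⟫ : ℝ) = (α * β).re * nsq3 q / 2 := by
  have hq' := congrArg (starRingEnd ℂ) hq
  simp only [map_add, map_pow, map_zero] at hq'
  apply Complex.ofReal_injective
  rw [inner_re3_complex, nsq3]
  push_cast
  rw [Complex.re_eq_add_conj]
  simp only [Complex.normSq_eq_conj_mul_self, Pi.smul_apply, smul_eq_mul, map_mul, Complex.conj_conj]
  linear_combination α * (starRingEnd ℂ) β / 4 * hq + (starRingEnd ℂ) α * β / 4 * hq'

theorem pd_re3 {G : ℂ → Fin 3 → ℂ} {a b : Fin 3 → ℂ} {z : ℂ}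
    (h : ∀ j, HasWirtinger (fun w => G w j) (a j) (b j) z) :
    DifferentiableAt ℝ (fun w => re3 (G w)) z ∧
      ∀ v, pd v (fun w => re3 (G w)) z = re3 (v • a + (starRingEnd ℂ) v • b) := by
  have h1 : HasFDerivAt G (ContinuousLinearMap.pi fun j => wirtingerMap (a j) (b j)) z :=
    hasFDerivAt_pi.2 h
  have h2 : HasFDerivAt (fun w => re3 (G w)) _ z := re3.hasFDerivAt.comp z h1
  refine ⟨h2.differentiableAt, fun v => ?_⟩
  rw [pd, h2.fderiv]
  simp only [ContinuousLinearMap.comp_apply]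
  congr 1
  funext j
  simp only [ContinuousLinearMap.pi_apply, wirtingerMap_apply, Pi.add_apply, Pi.smul_apply,
    smul_eq_mul]
  ring

/-! ### The Gauss map of a spinor field -/

section Spinors

open ComplexConjugate

/-- The isotropic vector of the spinor `(P, Q)`. -/
def isoVec (P Q : ℂ) : Fin 3 → ℂ := ![2 * P * Q, -Complex.I * (P ^ 2 + Q ^ 2), Q ^ 2 - P ^ 2]

/-- The squared norm of the spinor `(P, Q)`, as a complex number. -/
def spinNorm (P Q : ℂ) : ℂ := P * conj P + Q * conj Q

/-- The unit vector of the spinor `(P, Q)`, with complex coordinates. -/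
def spinVec (P Q : ℂ) : Fin 3 → ℂ :=
  ![(P * conj P - Q * conj Q) / spinNorm P Q, Complex.I * (P * conj Q - conj P * Q) / spinNorm P Q,
    (P * conj Q + conj P * Q) / spinNorm P Q]

theorem isoVec_isotropic (P Q : ℂ) :
    isoVec P Q 0 ^ 2 + isoVec P Q 1 ^ 2 + isoVec P Q 2 ^ 2 = 0 := by
  simp only [isoVec, Matrix.cons_val_zero, Matrix.cons_val_one, Matrix.cons_val]
  linear_combination (P ^ 2 + Q ^ 2) ^ 2 * Complex.I_sq

theorem spinNorm_eq (P Q : ℂ) :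
    spinNorm P Q = ((Complex.normSq P + Complex.normSq Q : ℝ) : ℂ) := by
  rw [spinNorm, Complex.mul_conj, Complex.mul_conj]
  push_cast
  rfl

theorem normSq_add_normSq_pos {P Q : ℂ} (h : P ≠ 0 ∨ Q ≠ 0) :
    0 < Complex.normSq P + Complex.normSq Q := by
  rcases h with h | h
  · have := Complex.normSq_pos.2 h
    have := Complex.normSq_nonneg Q
    linarith
  · have := Complex.normSq_pos.2 h
    have := Complex.normSq_nonneg P
    linarith

theorem spinNorm_ne_zero {P Q : ℂ} (h : P ≠ 0 ∨ Q ≠ 0) : spinNorm P Q ≠ 0 := by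
  rw [spinNorm_eq]
  exact_mod_cast (normSq_add_normSq_pos h).ne'

theorem conj_spinNorm (P Q : ℂ) : conj (spinNorm P Q) = spinNorm P Q := by
  rw [spinNorm_eq, Complex.conj_ofReal]

theorem nsq3_isoVec (P Q : ℂ) :
    nsq3 (isoVec P Q) = 2 * (Complex.normSq P + Complex.normSq Q) ^ 2 := by
  apply Complex.ofReal_injective
  rw [nsq3]
  push_cast
  simp only [Complex.normSq_eq_conj_mul_self]
  simp only [isoVec, Matrix.cons_val_zero, Matrix.cons_val_one,
    Matrix.cons_val, map_mul, map_sub, map_add, map_pow, map_neg, Complex.conj_I,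
    map_ofNat]
  linear_combination -(P ^ 2 + Q ^ 2) * (conj P ^ 2 + conj Q ^ 2) * Complex.I_sq

theorem conj_spinVec (P Q : ℂ) (j : Fin 3) : conj (spinVec P Q j) = spinVec P Q j := by
  fin_cases j <;> simp [spinVec, conj_spinNorm] <;> ring

theorem inner_spinVec {P Q : ℂ} (h : P ≠ 0 ∨ Q ≠ 0) :
    ⟪re3 (spinVec P Q), re3 (spinVec P Q)⟫ = (1 : ℝ) := by
  have h0 := spinNorm_ne_zero h
  apply Complex.ofReal_injective
  rw [inner_re3_complex]
  simp only [conj_spinVec]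
  simp only [spinVec, Matrix.cons_val_zero, Matrix.cons_val_one, Matrix.cons_val]
  field_simp
  rw [Complex.I_sq, spinNorm]
  push_cast
  ring

/-- The complex bilinear product of `spinVec` and `isoVec` is zero, and `spinVec` is real; so it is
orthogonal to the real part of every multiple of `isoVec`. -/
theorem inner_spinVec_isoVec (P Q c : ℂ) :
    ⟪re3 (spinVec P Q), re3 (c • isoVec P Q)⟫ = (0 : ℝ) := by
  apply Complex.ofReal_injective
  rw [inner_re3_complex]
  have e : spinVec P Q 0 * isoVec P Q 0 + spinVec P Q 1 * isoVec P Q 1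
      + spinVec P Q 2 * isoVec P Q 2 = 0 := by
    simp only [spinVec, isoVec, Matrix.cons_val_zero, Matrix.cons_val_one, Matrix.cons_val]
    linear_combination (-(P ^ 2 + Q ^ 2) * (P * conj Q - conj P * Q) / spinNorm P Q) * Complex.I_sq
  have e' := congrArg conj e
  simp only [map_add, map_mul, conj_spinVec, map_zero] at e'
  simp only [conj_spinVec, Pi.smul_apply, smul_eq_mul, map_mul]
  push_cast
  linear_combination c / 2 * e + conj c / 2 * e'

variable {P Q : ℂ → ℂ} {P' Q' z : ℂ}

theorem hasWirtinger_spinNorm (hP : HasWirtinger P P' 0 z) (hQ : HasWirtinger Q Q' 0 z) :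
    HasWirtinger (fun w => spinNorm (P w) (Q w)) (P' * conj (P z) + Q' * conj (Q z))
      (P z * conj P' + Q z * conj Q') z :=
  ((hP.mul hP.conj').add (hQ.mul hQ.conj')).congr_deriv (by simp) (by simp)

/-- The vector depends only on the ratio of `P` and `Q`, so its derivative involves them only
through the Wronskian. It is real, so the second Wirtinger derivative is the conjugate of the first.
-/
theorem hasWirtinger_spinVec (hP : HasWirtinger P P' 0 z) (hQ : HasWirtinger Q Q' 0 z)
    (h0 : P z ≠ 0 ∨ Q z ≠ 0) (j : Fin 3) :
    HasWirtinger (fun w => spinVec (P w) (Q w) j)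
      ((P' * Q z - P z * Q') / spinNorm (P z) (Q z) ^ 2 * conj (isoVec (P z) (Q z) j))
      (conj ((P' * Q z - P z * Q') / spinNorm (P z) (Q z) ^ 2 * conj (isoVec (P z) (Q z) j))) z := by
  have hn := spinNorm_ne_zero h0
  have hN := hasWirtinger_spinNorm hP hQ
  have hPc := hP.conj'
  have hQc := hQ.conj'
  fin_cases j
  · refine (((hP.mul hPc).sub (hQ.mul hQc)).div hN hn).congr_deriv ?_ ?_
    all_goals
      simp only [isoVec, map_mul, map_div₀, map_sub, map_pow, conj_spinNorm, Complex.conj_conj,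
        Fin.zero_eta, Matrix.cons_val_zero, map_ofNat, map_zero]
      field_simp
      simp only [spinNorm]
      ring
  · refine ((((hP.mul hQc).sub (hPc.mul hQ)).const_mul Complex.I).div hN hn).congr_deriv ?_ ?_
    all_goals
      simp only [isoVec, map_mul, map_div₀, map_sub, map_add, map_neg, map_pow, conj_spinNorm,
        Complex.conj_conj, Fin.mk_one, Matrix.cons_val_one, Matrix.cons_val_zero, map_zero,
        Complex.conj_I]
      field_simp
      simp only [spinNorm]
      ring
  · refine (((hP.mul hQc).add (hPc.mul hQ)).div hN hn).congr_deriv ?_ ?_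
    all_goals
      simp only [isoVec, map_mul, map_div₀, map_sub, map_pow, conj_spinNorm, Complex.conj_conj,
        Fin.reduceFinMk, Matrix.cons_val, map_zero]
      field_simp
      simp only [spinNorm]
      ring

end Spinors

/-! ### Gauss maps of minimal surfaces -/

section GaussMaps

open ComplexConjugate

/-- The Gauss map of a spinor field. -/
def gaussMap (P Q : ℂ → ℂ) (z : ℂ) : E3 := re3 (spinVec (P z) (Q z))

/-- The Wronskian. -/
def wronsk (P Q : ℂ → ℂ) (z : ℂ) : ℂ := deriv P z * Q z - P z * deriv Q z

/-- The derivative `∂n / ∂z` of the Gauss map. -/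
def gaussDeriv (P Q : ℂ → ℂ) (z : ℂ) : Fin 3 → ℂ :=
  (wronsk P Q z / spinNorm (P z) (Q z) ^ 2) • fun j => conj (isoVec (P z) (Q z) j)

theorem exists_gaussDeriv_eq (P Q : ℂ → ℂ) (z : ℂ) : ∃ q : Fin 3 → ℂ,
    q 0 ^ 2 + q 1 ^ 2 + q 2 ^ 2 = 0 ∧
    nsq3 q = 2 * (Complex.normSq (P z) + Complex.normSq (Q z)) ^ 2 ∧
    gaussDeriv P Q z = (wronsk P Q z /
      ((Complex.normSq (P z) + Complex.normSq (Q z) : ℝ) : ℂ) ^ 2) • q := by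
  refine ⟨fun j => conj (isoVec (P z) (Q z) j), ?_, ?_, ?_⟩
  · have := congrArg conj (isoVec_isotropic (P z) (Q z))
    rwa [map_add, map_add, map_pow, map_pow, map_pow, map_zero] at this
  · rw [← nsq3_isoVec]
    simp only [nsq3, Complex.normSq_conj]
  · rw [gaussDeriv, spinNorm_eq, Complex.ofReal_add]

theorem re_mul_conj_scale (u v c : ℂ) (h : ℝ) :
    (2 * u * (c / (h : ℂ) ^ 2) * conj (2 * v * (c / (h : ℂ) ^ 2))).re =
      4 * Complex.normSq c / h ^ 4 * (u * conj v).re := by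
  rw [← Complex.re_ofReal_mul]
  congr 1
  simp only [map_mul, map_div₀, map_pow, Complex.conj_ofReal, map_ofNat]
  push_cast
  rw [Complex.normSq_eq_conj_mul_self]
  ring

variable {P Q : ℂ → ℂ} (hP : Differentiable ℂ P) (hQ : Differentiable ℂ Q)
  (h0 : ∀ z, P z ≠ 0 ∨ Q z ≠ 0)
include hP hQ h0

theorem pd_gaussMap (v z : ℂ) : pd v (gaussMap P Q) z = re3 ((2 * v) • gaussDeriv P Q z) := by
  have h := (pd_re3 (a := gaussDeriv P Q z) (b := fun j => conj (gaussDeriv P Q z j)) fun j =>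
    hasWirtinger_spinVec (HasWirtinger.of_differentiable hP z)
      (HasWirtinger.of_differentiable hQ z) (h0 z) j).2 v
  have e : gaussMap P Q = fun w => re3 (spinVec (P w) (Q w)) := rfl
  rw [e, h]
  ext i
  simp only [re3_apply, Pi.add_apply, Pi.smul_apply, smul_eq_mul]
  rw [← map_mul, Complex.add_re, Complex.conj_re, mul_assoc, Complex.mul_re 2]
  simp
  ring

theorem contDiff_gaussMap : ContDiff ℝ ∞ (gaussMap P Q) := by
  have hPr : ContDiff ℝ ∞ P := hP.contDiff.restrict_scalars ℝ
  have hQr : ContDiff ℝ ∞ Q := hQ.contDiff.restrict_scalars ℝ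
  have hPc : ContDiff ℝ ∞ fun z => conj (P z) := Complex.conjCLE.contDiff.comp hPr
  have hQc : ContDiff ℝ ∞ fun z => conj (Q z) := Complex.conjCLE.contDiff.comp hQr
  have hn : ContDiff ℝ ∞ fun z => (spinNorm (P z) (Q z))⁻¹ :=
    ((hPr.mul hPc).add (hQr.mul hQc)).inv fun z => spinNorm_ne_zero (h0 z)
  refine re3.contDiff.comp (contDiff_pi.2 fun j => ?_)
  fin_cases j
  · exact ((hPr.mul hPc).sub (hQr.mul hQc)).mul hn
  · exact (contDiff_const.mul ((hPr.mul hQc).sub (hPc.mul hQr))).mul hn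
  · exact ((hPr.mul hQc).add (hPc.mul hQr)).mul hn

/-- `gaussDeriv` is a multiple of an isotropic vector, so the Gauss map is conformal where it is
immersed; the factor is the pulled-back round metric. -/
theorem inner_pd_gaussMap (u v z : ℂ) :
    (⟪pd u (gaussMap P Q) z, pd v (gaussMap P Q) z⟫ : ℝ) = (u * conj v).re *
      (4 * Complex.normSq (wronsk P Q z) / (Complex.normSq (P z) + Complex.normSq (Q z)) ^ 2) := by
  have hn := (normSq_add_normSq_pos (h0 z)).ne'
  obtain ⟨q, hq, hns, hd⟩ := exists_gaussDeriv_eq P Q z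
  rw [pd_gaussMap hP hQ h0, pd_gaussMap hP hQ h0, hd, smul_smul, smul_smul,
    inner_re3_isotropic hq, hns, re_mul_conj_scale]
  generalize Complex.normSq (P z) + Complex.normSq (Q z) = h at hn ⊢
  field_simp

/-- The mixed derivative `∂̄∂n` is a real multiple of `n`: the Gauss map is harmonic into the
sphere. The pure derivative `a` is left unspecified because it cancels in the Laplacian. -/
theorem hasWirtinger_gaussDeriv (z : ℂ) (j : Fin 3) :
    ∃ a, HasWirtinger (fun w => gaussDeriv P Q w j) a
      (-(2 * wronsk P Q z * conj (wronsk P Q z) / spinNorm (P z) (Q z) ^ 2)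
        * spinVec (P z) (Q z) j) z := by
  have hn := spinNorm_ne_zero (h0 z)
  have wP := HasWirtinger.of_differentiable hP z
  have wQ := HasWirtinger.of_differentiable hQ z
  have wP' := HasWirtinger.of_differentiable (hP.contDiff.differentiable_deriv_two) z
  have wQ' := HasWirtinger.of_differentiable (hQ.contDiff.differentiable_deriv_two) z
  have wW := (wP'.mul wQ).sub (wP.mul wQ')
  have wN := hasWirtinger_spinNorm wP wQ
  have wm := wW.div (wN.mul wN) (mul_ne_zero hn hn)
  have wPc := wP.conj'
  have wQc := wQ.conj'
  have hW : ∀ w, wronsk P Q w / spinNorm (P w) (Q w) ^ 2 =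
    (deriv P w * Q w - P w * deriv Q w) / (spinNorm (P w) (Q w) * spinNorm (P w) (Q w)) :=
    fun w => by rw [wronsk, sq]
  fin_cases j
  · have e : (fun w => gaussDeriv P Q w 0) = fun w =>
        (deriv P w * Q w - P w * deriv Q w) / (spinNorm (P w) (Q w) * spinNorm (P w) (Q w))
        * (2 * (conj (P w) * conj (Q w))) := by
      funext w
      change wronsk P Q w / _ * conj (isoVec (P w) (Q w) 0) = _
      rw [hW]
      simp only [isoVec, Matrix.cons_val_zero, map_mul, map_ofNat]
      ring
    have := wm.mul ((wPc.mul wQc).const_mul 2)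
    refine ⟨_, (show HasWirtinger (fun w => gaussDeriv P Q w 0) _ _ z from e ▸ this).congr_deriv
      rfl ?_⟩
    simp only [wronsk, spinVec, Matrix.cons_val_zero, Fin.zero_eta, map_sub, map_mul]
    field_simp
    simp only [spinNorm]
    ring
  · have e : (fun w => gaussDeriv P Q w 1) = fun w =>
        (deriv P w * Q w - P w * deriv Q w) / (spinNorm (P w) (Q w) * spinNorm (P w) (Q w))
        * (Complex.I * (conj (P w) * conj (P w) + conj (Q w) * conj (Q w))) := by
      funext w
      change wronsk P Q w / _ * conj (isoVec (P w) (Q w) 1) = _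
      rw [hW]
      simp only [isoVec, Matrix.cons_val_zero, Matrix.cons_val_one, map_mul, map_neg,
        Complex.conj_I, map_add, map_pow]
      ring
    have := wm.mul (((wPc.mul wPc).add (wQc.mul wQc)).const_mul Complex.I)
    refine ⟨_, (show HasWirtinger (fun w => gaussDeriv P Q w 1) _ _ z from e ▸ this).congr_deriv
      rfl ?_⟩
    simp only [wronsk, spinVec, Matrix.cons_val_zero, Matrix.cons_val_one, Fin.mk_one, map_sub,
      map_mul]
    field_simp
    simp only [spinNorm]
    ring
  · have e : (fun w => gaussDeriv P Q w 2) = fun w =>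
        (deriv P w * Q w - P w * deriv Q w) / (spinNorm (P w) (Q w) * spinNorm (P w) (Q w))
        * (conj (Q w) * conj (Q w) - conj (P w) * conj (P w)) := by
      funext w
      change wronsk P Q w / _ * conj (isoVec (P w) (Q w) 2) = _
      rw [hW]
      simp only [isoVec, Matrix.cons_val, map_sub, map_pow]
      ring
    have := wm.mul ((wQc.mul wQc).sub (wPc.mul wPc))
    refine ⟨_, (show HasWirtinger (fun w => gaussDeriv P Q w 2) _ _ z from e ▸ this).congr_deriv
      rfl ?_⟩
    simp only [wronsk, spinVec, Matrix.cons_val, Fin.reduceFinMk, map_sub, map_mul]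
    field_simp
    simp only [spinNorm]
    ring

theorem laplacian_gaussMap (z : ℂ) :
    pd 1 (pd 1 (gaussMap P Q)) z + pd Complex.I (pd Complex.I (gaussMap P Q)) z =
      (-(8 * Complex.normSq (wronsk P Q z) / (Complex.normSq (P z) + Complex.normSq (Q z)) ^ 2)) •
        gaussMap P Q z := by
  choose a ha using fun j => hasWirtinger_gaussDeriv hP hQ h0 z j
  set b : Fin 3 → ℂ := fun j => -(2 * wronsk P Q z * conj (wronsk P Q z)
    / spinNorm (P z) (Q z) ^ 2) * spinVec (P z) (Q z) j with hb
  have key : ∀ v, pd v (pd v (gaussMap P Q)) z = re3 (v • ((2 * v) • a) + conj v • ((2 * v) • b)) := by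
    intro v
    have e : pd v (gaussMap P Q) = fun w => re3 ((2 * v) • gaussDeriv P Q w) :=
      funext fun w => pd_gaussMap hP hQ h0 v w
    rw [e]
    exact (pd_re3 (G := fun w => (2 * v) • gaussDeriv P Q w)
      fun j => (ha j).const_mul (2 * v)).2 v
  -- Adding the directions `1` and `i`, the coefficient of `a` is `2 + 2 i² = 0` and that of `b` is
  -- `4`.
  rw [key, key, ← map_add, gaussMap, ← map_smul]
  congr 1
  funext j
  simp only [Pi.add_apply, Pi.smul_apply, smul_eq_mul, map_one, Complex.conj_I, hb,
    Complex.real_smul, spinNorm_eq]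
  push_cast
  rw [Complex.normSq_eq_conj_mul_self (z := wronsk P Q z)]
  linear_combination (2 * a j - 2 * (-(2 * wronsk P Q z * conj (wronsk P Q z) /
    (Complex.normSq (P z) + Complex.normSq (Q z) : ℂ) ^ 2) * spinVec (P z) (Q z) j)) * Complex.I_sq

end GaussMaps

/-! ### Surfaces in `S³` from null curves -/

section ConformalImmersions

variable {F : Type*} [NormedAddCommGroup F] [InnerProductSpace ℝ F]

/-- `X` is differentiable at `z` with conformal differential. -/
def IsConformalImmersionAt (X : ℂ → F) (z : ℂ) : Prop :=
  DifferentiableAt ℝ X z ∧ ∃ c : ℝ, 0 < c ∧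
    ∀ u v, (⟪pd u X z, pd v X z⟫ : ℝ) = c * (u * (starRingEnd ℂ) v).re

theorem IsConformalImmersionAt.congr {X Y : ℂ → F} {z : ℂ} (h : IsConformalImmersionAt X z)
    (e : Y =ᶠ[𝓝 z] X) : IsConformalImmersionAt Y z := by
  obtain ⟨h1, c, hc, h2⟩ := h
  refine ⟨h1.congr_of_eventuallyEq e, c, hc, fun u v => ?_⟩
  rw [pd_congr e, pd_congr e, h2]

theorem IsConformalImmersionAt.conformalAt {X : ℂ → F} {z : ℂ} (h : IsConformalImmersionAt X z) :
    ConformalAt X z := by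
  obtain ⟨h1, c, hc, h2⟩ := h
  refine ⟨_, h1.hasFDerivAt, (isConformalMap_iff _).2 ⟨c, hc, fun u v => ?_⟩⟩
  rw [Complex.inner, real_inner_comm]
  exact (h2 v u).trans (by rw [mul_comm v])

theorem IsConformalImmersionAt.injective {X : ℂ → F} {z : ℂ} (h : IsConformalImmersionAt X z) :
    Function.Injective (fderiv ℝ X z) := by
  obtain ⟨h1, c, hc, h2⟩ := h
  rw [injective_iff_map_eq_zero]
  intro v hv
  have h3 := h2 v v
  rw [pd, hv, inner_zero_left, Complex.mul_conj, Complex.ofReal_re] at h3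
  exact Complex.normSq_eq_zero.1 ((mul_eq_zero.1 h3.symm).resolve_left hc.ne')

theorem IsConformalImmersionAt.comp_add_left {X : ℂ → F} {z : ℂ} (h : IsConformalImmersionAt X z) :
    IsConformalImmersionAt (fun w => X (z + w)) 0 := by
  obtain ⟨h1, c, hc, h2⟩ := h
  refine ⟨(differentiableAt_comp_add_left z).2 (by rwa [add_zero]), c, hc, fun u v => ?_⟩
  rw [pd, pd, fderiv_comp_add_left, add_zero]
  exact h2 u v

theorem pd_comp_add_left {G : Type*} [NormedAddCommGroup G] [NormedSpace ℝ G] (X : ℂ → G)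
    (v z : ℂ) : pd v (fun w => X (z + w)) = fun w => pd v X (z + w) := by
  funext w
  rw [pd, fderiv_comp_add_left]
  rfl

theorem meanCurvatureVector_comp_add_left [FiniteDimensional ℝ F] (N : Set F) (X : ℂ → F) (z : ℂ) :
    meanCurvatureVector N (fun w => X (z + w)) 0 = meanCurvatureVector N X z := by
  simp only [meanCurvatureVector, detg, g11, g12, g22, pd_comp_add_left, add_zero]

/-- In a conformal coordinate the mean curvature vector is the projection of a multiple of the
Laplacian. -/
theorem meanCurvatureVector_eq_zero [FiniteDimensional ℝ F] {N : Set F} {X f : ℂ → F} {z : ℂ}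
    (e : X =ᶠ[𝓝 z] f) (h : IsConformalImmersionAt f z)
    (hΔ : pd 1 (pd 1 f) z + pd Complex.I (pd Complex.I f) z = 0) :
    meanCurvatureVector N X z = 0 := by
  obtain ⟨h1, c, hc, h2⟩ := h
  have e2 : ∀ u v, pd u (pd v X) z = pd u (pd v f) z := fun u v =>
    pd_congr (e.eventually_nhds.mono fun w hw => pd_congr hw v) u
  have h12 : g12 X z = 0 := by rw [g12, pd_congr e, pd_congr e, h2]; simp
  have h11 : g11 X z = c := by rw [g11, pd_congr e, h2]; simp
  have h22 : g22 X z = c := by rw [g22, pd_congr e, h2]; simp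
  rw [meanCurvatureVector, h12, h11, h22, e2 1 1, e2 Complex.I Complex.I, mul_zero, zero_smul, sub_zero, ← smul_add, hΔ,
    smul_zero, smul_zero, map_zero]

end ConformalImmersions

theorem IsPlaneImmersion.continuous_gaussEnergy {X : ℂ → E4} (hX : IsPlaneImmersion X) :
    Continuous (gaussEnergy X) := by
  have hG := fun u v => (contDiff_lor (contDiff_pd hX.contDiff_confGauss u)
    (contDiff_pd hX.contDiff_confGauss v)).continuous
  have h11 := hX.contDiff_g11.continuous
  have h12 := hX.contDiff_g12.continuous
  have h22 := hX.contDiff_g22.continuous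
  refine Continuous.mul (Continuous.inv₀ (continuous_const.mul
    (Real.continuous_sqrt.comp hX.contDiff_detg.continuous)) fun z => ?_) ?_
  · exact mul_ne_zero two_ne_zero (Real.sqrt_pos.2 (hX.detg_pos z)).ne'
  · exact ((h22.mul (hG _ _)).sub ((continuous_const.mul h12).mul (hG _ _))).add
      (h11.mul (hG _ _))

/-- A null curve `[p₀ : … : p₄]` in the quadric `p₁² + p₂² + p₃² = 2 p₀ p₄` of `ℂℙ⁴` with polynomial
spinor `(P, Q)`. -/
structure NullData (p : Fin 5 → ℂ → ℂ) (P Q : ℂ → ℂ) (κ : ℂ) : Prop where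
  differentiable : ∀ j, Differentiable ℂ (p j)
  differentiable_left : Differentiable ℂ P
  differentiable_right : Differentiable ℂ Q
  quadric : ∀ z, p 1 z ^ 2 + p 2 z ^ 2 + p 3 z ^ 2 = 2 * p 0 z * p 4 z
  wronskian : ∀ z (j : Fin 3), deriv (p j.succ.castSucc) z * p 4 z
    - p j.succ.castSucc z * deriv (p 4) z = κ * isoVec (P z) (Q z) j
  spinor_ne_zero : ∀ z, P z ≠ 0 ∨ Q z ≠ 0
  const_ne_zero : κ ≠ 0

/-- The middle coordinates of a curve in `ℂ⁵`. -/
def midVec (p : Fin 5 → ℂ → ℂ) (z : ℂ) (j : Fin 3) : ℂ := p j.succ.castSucc z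

/-- The affine surface in `ℝ³`. -/
def nullSurface (p : Fin 5 → ℂ → ℂ) (z : ℂ) : E3 := re3 fun j => midVec p z j / p 4 z

/-- The conformal factor of the surface in `S³`. -/
def nullScale (p : Fin 5 → ℂ → ℂ) (z : ℂ) : ℝ :=
  (p 0 z * (starRingEnd ℂ) (p 4 z)).re + nsq3 (midVec p z) / 2 + Complex.normSq (p 4 z)

/-- The surface in `S³` of a null curve. -/
def nullSphere (p : Fin 5 → ℂ → ℂ) (z : ℂ) : E4 :=
  glue ((2 * (nullScale p z)⁻¹) • re3 ((starRingEnd ℂ) (p 4 z) • midVec p z),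
    1 - 2 * (nullScale p z)⁻¹ * Complex.normSq (p 4 z))

/-! ### The surface of a null curve, with its poles removed in the 3-sphere -/

namespace NullData

open ComplexConjugate

variable {p : Fin 5 → ℂ → ℂ} {P Q : ℂ → ℂ} {κ : ℂ} (h : NullData p P Q κ)
include h

theorem nsq3_pos (z : ℂ) : 0 < nsq3 (isoVec (P z) (Q z)) := by
  rw [nsq3_isoVec]
  have := normSq_add_normSq_pos (h.spinor_ne_zero z)
  positivity

theorem exists_isoVec_ne_zero (z : ℂ) : ∃ j, isoVec (P z) (Q z) j ≠ 0 := by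
  by_contra! h0
  have := h.nsq3_pos z
  simp [nsq3, h0] at this

/-- At a zero of `p 4` the Wronskian identity reduces to `-pⱼ p₄' = κ * isoVec`, and some coordinate
of `isoVec` is nonzero. So the zeros are simple; the same relation shows `nsq3_midVec_pos`. -/
theorem deriv_ne_zero {z : ℂ} (h4 : p 4 z = 0) : deriv (p 4) z ≠ 0 := by
  intro h0
  obtain ⟨j, hj⟩ := h.exists_isoVec_ne_zero z
  have := h.wronskian z j
  rw [h4, h0, mul_zero, mul_zero, sub_zero] at this
  exact (mul_ne_zero h.const_ne_zero hj) this.symm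

theorem nsq3_midVec_pos {z : ℂ} (h4 : p 4 z = 0) : 0 < nsq3 (midVec p z) := by
  obtain ⟨j, hj⟩ := h.exists_isoVec_ne_zero z
  have h1 := h.wronskian z j
  have h2 : midVec p z j ≠ 0 := by
    intro h0
    rw [h4, mul_zero, show p j.succ.castSucc z = 0 from h0, zero_mul, sub_zero] at h1
    exact (mul_ne_zero h.const_ne_zero hj) h1.symm
  have h3 : ∀ i, 0 ≤ Complex.normSq (midVec p z i) := fun i => Complex.normSq_nonneg _
  have h4 := Complex.normSq_pos.2 h2
  rw [nsq3]
  fin_cases j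
  · exact add_pos_of_pos_of_nonneg (add_pos_of_pos_of_nonneg h4 (h3 _)) (h3 _)
  · exact add_pos_of_pos_of_nonneg (add_pos_of_nonneg_of_pos (h3 _) h4) (h3 _)
  · exact add_pos_of_nonneg_of_pos (add_nonneg (h3 _) (h3 _)) h4

/-- For `F = midVec / p₄` one has `|Re F|² = (|F|² + Re (F · F)) / 2`, and the quadric gives `F · F
= 2 p₀ / p₄`. Multiplying by `|p₄|²` leaves no denominator, so `nullScale` is smooth across the
ends. -/
theorem nullScale_eq {z : ℂ} (h4 : p 4 z ≠ 0) : nullScale p z =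
    Complex.normSq (p 4 z) * (1 + ⟪nullSurface p z, nullSurface p z⟫) := by
  have h4' : conj (p 4 z) ≠ 0 := (map_ne_zero _).2 h4
  have hq := h.quadric z
  have hq' := congrArg conj hq
  simp only [map_add, map_mul, map_pow, map_ofNat] at hq'
  apply Complex.ofReal_injective
  rw [nullScale, nsq3, nullSurface, Complex.ofReal_mul, Complex.ofReal_add 1, inner_re3_complex]
  push_cast
  rw [Complex.re_eq_add_conj]
  simp only [Complex.normSq_eq_conj_mul_self, map_mul, map_div₀, Complex.conj_conj]
  change _ + (conj (p 1 z) * p 1 z + conj (p 2 z) * p 2 z + conj (p 3 z) * p 3 z) / 2 + _ =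
    _ * (1 + ((p 1 z / p 4 z + conj (p 1 z) / conj (p 4 z)) * (p 1 z / p 4 z
      + conj (p 1 z) / conj (p 4 z)) + (p 2 z / p 4 z + conj (p 2 z) / conj (p 4 z)) *
      (p 2 z / p 4 z + conj (p 2 z) / conj (p 4 z)) + (p 3 z / p 4 z + conj (p 3 z) / conj (p 4 z)) *
      (p 3 z / p 4 z + conj (p 3 z) / conj (p 4 z))) / 4)
  field_simp
  linear_combination (-2 * (conj (p 4 z)) ^ 2) * hq - 2 * (p 4 z) ^ 2 * hq'

omit h in
theorem nullScale_of_eq_zero {z : ℂ} (h4 : p 4 z = 0) :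
    nullScale p z = nsq3 (midVec p z) / 2 := by
  simp [nullScale, h4]

theorem nullScale_pos (z : ℂ) : 0 < nullScale p z := by
  by_cases h4 : p 4 z = 0
  · rw [nullScale_of_eq_zero h4]
    exact half_pos (h.nsq3_midVec_pos h4)
  · rw [h.nullScale_eq h4]
    exact mul_pos (Complex.normSq_pos.2 h4) (one_add_inner_self_pos _)

theorem nullSphere_eq {z : ℂ} (h4 : p 4 z ≠ 0) : nullSphere p z = invStereo (nullSurface p z) := by
  have hn : Complex.normSq (p 4 z) ≠ 0 := (Complex.normSq_pos.2 h4).ne'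
  have hs := (one_add_inner_self_pos (nullSurface p z)).ne'
  have e : re3 (conj (p 4 z) • midVec p z) = Complex.normSq (p 4 z) • nullSurface p z := by
    rw [nullSurface, ← map_smul]
    congr 1
    funext j
    simp only [Pi.smul_apply, smul_eq_mul, Complex.real_smul, Complex.normSq_eq_conj_mul_self]
    field_simp
  rw [nullSphere, invStereo, h.nullScale_eq h4, e, smul_smul]
  congr 3
  · field_simp
  · field_simp

omit h in
theorem nullSphere_of_eq_zero {z : ℂ} (h4 : p 4 z = 0) : nullSphere p z = northPole := by
  rw [nullSphere, h4, map_zero, zero_smul, map_zero, smul_zero, map_zero, mul_zero, sub_zero]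
  ext i
  fin_cases i <;> simp [glue_apply, northPole]

theorem norm_nullSphere (z : ℂ) : ‖nullSphere p z‖ = 1 := by
  by_cases h4 : p 4 z = 0
  · rw [nullSphere_of_eq_zero h4]
    simp [EuclideanSpace.norm_eq, northPole, Fin.sum_univ_four]
  · rw [h.nullSphere_eq h4, norm_invStereo]

theorem nullSphere_eq_northPole_iff (z : ℂ) : nullSphere p z = northPole ↔ p 4 z = 0 := by
  refine ⟨fun e => ?_, nullSphere_of_eq_zero⟩
  have := congrArg (fun x : E4 => x 3) e
  simp only [nullSphere, glue_apply, northPole] at this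
  have hs := (h.nullScale_pos z).ne'
  simpa [hs] using this

theorem stereo_nullSphere {z : ℂ} (h4 : p 4 z ≠ 0) :
    stereo (nullSphere p z) = nullSurface p z := by
  have hs := (one_add_inner_self_pos (nullSurface p z)).ne'
  rw [h.nullSphere_eq h4, invStereo, stereo]
  ext i
  fin_cases i <;> simp [glue_apply] <;> field_simp

theorem contDiff_coord (j : Fin 5) : ContDiff ℝ ∞ (p j) :=
  (h.differentiable j).contDiff.restrict_scalars ℝ

theorem contDiff_nullScale : ContDiff ℝ ∞ (nullScale p) := by
  have hc := fun j => Complex.conjCLE.contDiff.comp (h.contDiff_coord j)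
  have hn : ∀ j, ContDiff ℝ ∞ fun z => Complex.normSq (p j z) := by
    intro j
    have : (fun z => Complex.normSq (p j z)) = fun z => (p j z * conj (p j z)).re := by
      funext z
      rw [Complex.mul_conj, Complex.ofReal_re]
    rw [this]
    exact Complex.reCLM.contDiff.comp ((h.contDiff_coord j).mul (hc j))
  exact ((Complex.reCLM.contDiff.comp ((h.contDiff_coord 0).mul (hc 4))).add
    ((((hn _).add (hn _)).add (hn _)).div_const 2)).add (hn 4)

theorem contDiff_nullSphere : ContDiff ℝ ∞ (nullSphere p) := by
  have hs : ContDiff ℝ ∞ fun z => 2 * (nullScale p z)⁻¹ :=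
    contDiff_const.mul (h.contDiff_nullScale.inv fun z => (h.nullScale_pos z).ne')
  have hc : ContDiff ℝ ∞ fun z => conj (p 4 z) := Complex.conjCLE.contDiff.comp (h.contDiff_coord 4)
  have hn : ContDiff ℝ ∞ fun z => Complex.normSq (p 4 z) := by
    have : (fun z => Complex.normSq (p 4 z)) = fun z => (p 4 z * conj (p 4 z)).re := by
      funext z
      rw [Complex.mul_conj, Complex.ofReal_re]
    rw [this]
    exact Complex.reCLM.contDiff.comp ((h.contDiff_coord 4).mul hc)
  refine glue.contDiff.comp (ContDiff.prodMk (hs.smul (re3.contDiff.comp ?_))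
    (contDiff_const.sub (hs.mul hn)))
  exact contDiff_pi.2 fun j => hc.mul (h.contDiff_coord _)

end NullData

/-! ### Conformality across the ends, harmonicity and the energy density -/

namespace NullData

open ComplexConjugate

variable {p : Fin 5 → ℂ → ℂ} {P Q : ℂ → ℂ} {κ : ℂ} (h : NullData p P Q κ)
include h

theorem hasDerivAt_coord (j : Fin 5) (z : ℂ) : HasDerivAt (p j) (deriv (p j) z) z :=
  (h.differentiable j z).hasDerivAt

/-- The Weierstrass representation: by the quotient rule and the Wronskian identity `F' = κ isoVec /
p₄²`. -/
theorem pd_nullSurface {z : ℂ} (h4 : p 4 z ≠ 0) :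
    DifferentiableAt ℝ (nullSurface p) z ∧ ∀ v, pd v (nullSurface p) z =
      re3 ((v * (κ / p 4 z ^ 2)) • isoVec (P z) (Q z)) := by
  have hd : ∀ j : Fin 3, HasWirtinger (fun w => midVec p w j / p 4 w)
      (κ / p 4 z ^ 2 * isoVec (P z) (Q z) j) 0 z := fun j => by
    refine (HasWirtinger.of_hasDerivAt ((h.hasDerivAt_coord j.succ.castSucc z).div
      (h.hasDerivAt_coord 4 z) h4)).congr_deriv ?_ rfl
    rw [h.wronskian z j]
    ring
  obtain ⟨h1, h2⟩ := pd_re3 (G := fun w j => midVec p w j / p 4 w)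
    (a := fun j => κ / p 4 z ^ 2 * isoVec (P z) (Q z) j) (b := 0) hd
  refine ⟨h1, fun v => (h2 v).trans ?_⟩
  rw [smul_zero, add_zero]
  congr 1
  funext j
  simp only [Pi.smul_apply, smul_eq_mul]
  ring

theorem eventually_ne {z : ℂ} (h4 : p 4 z ≠ 0) : ∀ᶠ w in 𝓝 z, p 4 w ≠ 0 :=
  (h.differentiable 4).continuous.continuousAt.eventually_ne h4

theorem laplacian_nullSurface {z : ℂ} (h4 : p 4 z ≠ 0) :
    pd 1 (pd 1 (nullSurface p)) z + pd Complex.I (pd Complex.I (nullSurface p)) z = 0 := by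
  have hq : ∀ j, Differentiable ℂ fun w => isoVec (P w) (Q w) j := by
    intro j
    have hP := h.differentiable_left
    have hQ := h.differentiable_right
    fin_cases j
    · exact (hP.const_mul 2).mul hQ
    · exact ((hP.pow 2).add (hQ.pow 2)).const_mul (-Complex.I)
    · exact (hQ.pow 2).sub (hP.pow 2)
  have hG : ∀ (v : ℂ) (j : Fin 3), HasDerivAt (fun w => (v * (κ / p 4 w ^ 2)) * isoVec (P w) (Q w) j)
      (v * deriv (fun w => κ / p 4 w ^ 2 * isoVec (P w) (Q w) j) z) z := by
    intro v j
    have hd : DifferentiableAt ℂ (fun w => κ / p 4 w ^ 2 * isoVec (P w) (Q w) j) z :=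
      (((differentiableAt_const κ).div ((h.differentiable 4 z).pow 2) (pow_ne_zero 2 h4)).mul
        (hq j z))
    exact (hd.hasDerivAt.const_mul v).congr_of_eventuallyEq
      (Filter.Eventually.of_forall fun w => by ring)
  have key : ∀ v, pd v (pd v (nullSurface p)) z = re3 ((v * v) • fun j =>
      deriv (fun w => κ / p 4 w ^ 2 * isoVec (P w) (Q w) j) z) := by
    intro v
    have e : pd v (nullSurface p) =ᶠ[𝓝 z] fun w =>
        re3 ((v * (κ / p 4 w ^ 2)) • isoVec (P w) (Q w)) :=
      (h.eventually_ne h4).mono fun w hw => (h.pd_nullSurface hw).2 v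
    rw [pd_congr e, (pd_re3 (G := fun w => (v * (κ / p 4 w ^ 2)) • isoVec (P w) (Q w)) (b := 0)
      fun j => HasWirtinger.of_hasDerivAt (hG v j)).2 v, smul_zero, add_zero]
    congr 1
    funext j
    simp only [Pi.smul_apply, smul_eq_mul]
    ring
  rw [key, key, ← map_add, ← add_smul, Complex.I_mul_I, one_mul, add_neg_cancel, zero_smul, map_zero]

theorem inner_pd_nullSurface {z : ℂ} (h4 : p 4 z ≠ 0) (u v : ℂ) :
    (⟪pd u (nullSurface p) z, pd v (nullSurface p) z⟫ : ℝ) =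
      Complex.normSq (κ / p 4 z ^ 2) * nsq3 (isoVec (P z) (Q z)) / 2 * (u * conj v).re := by
  rw [(h.pd_nullSurface h4).2, (h.pd_nullSurface h4).2,
    inner_re3_isotropic (isoVec_isotropic _ _)]
  have e : u * (κ / p 4 z ^ 2) * conj (v * (κ / p 4 z ^ 2)) =
      (Complex.normSq (κ / p 4 z ^ 2) : ℂ) * (u * conj v) := by
    rw [Complex.normSq_eq_conj_mul_self, map_mul]
    ring
  rw [e, Complex.re_ofReal_mul]
  ring

theorem isConformalImmersionAt_nullSurface {z : ℂ} (h4 : p 4 z ≠ 0) :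
    IsConformalImmersionAt (nullSurface p) z := by
  refine ⟨(h.pd_nullSurface h4).1, _, ?_, h.inner_pd_nullSurface h4⟩
  have h1 := Complex.normSq_pos.2 (div_ne_zero h.const_ne_zero (pow_ne_zero 2 h4))
  have h2 := h.nsq3_pos z
  positivity

theorem isConformalImmersionAt_nullSphere_of_ne {z : ℂ} (h4 : p 4 z ≠ 0) :
    IsConformalImmersionAt (nullSphere p) z := by
  obtain ⟨h1, c, hc, h2⟩ := h.isConformalImmersionAt_nullSurface h4
  have e : nullSphere p =ᶠ[𝓝 z] fun w => invStereo (nullSurface p w) :=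
    (h.eventually_ne h4).mono fun w hw => h.nullSphere_eq hw
  have h0 := one_add_inner_self_pos (nullSurface p z)
  refine ⟨(h.contDiff_nullSphere.diffAt z),
    4 * ((1 + ⟪nullSurface p z, nullSurface p z⟫)⁻¹) ^ 2 * c, by positivity, fun u v => ?_⟩
  rw [pd_congr e, pd_congr e, inner_pd_invStereo h1, h2]
  ring

/-- At an end the quadric makes `midVec` isotropic, and to first order the surface is the real part
of the conjugate of `v * p₄'` times `midVec`. The real part of a nonzero antilinear multiple of an
isotropic vector is a conformal immersion. -/
theorem isConformalImmersionAt_nullSphere_of_eq {z : ℂ} (h4 : p 4 z = 0) :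
    IsConformalImmersionAt (nullSphere p) z := by
  have hs0 := (h.nullScale_pos z).ne'
  have hn := h.nsq3_midVec_pos h4
  have hiso : midVec p z 0 ^ 2 + midVec p z 1 ^ 2 + midVec p z 2 ^ 2 = 0 := by
    have := h.quadric z
    rwa [h4, mul_zero] at this
  have hw : ∀ j, HasWirtinger (fun w => conj (p 4 w) * midVec p w j) 0
      (conj (deriv (p 4) z) * midVec p z j) z := fun j =>
    ((HasWirtinger.of_hasDerivAt (h.hasDerivAt_coord 4 z)).conj'.mul
      (HasWirtinger.of_hasDerivAt (h.hasDerivAt_coord j.succ.castSucc z))).congr_deriv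
      (by simp [h4]) (by simp [h4, midVec])
  obtain ⟨h1, h2⟩ := pd_re3 (G := fun w => conj (p 4 w) • midVec p w) hw
  have hs : DifferentiableAt ℝ (fun w => 2 * (nullScale p w)⁻¹) z :=
    ((h.contDiff_nullScale.diffAt z).inv hs0).const_mul 2
  -- `|p₄|²` vanishes to second order at the end, so the last coordinate has zero differential
  -- there.
  have hN : HasFDerivAt (fun w => Complex.normSq (p 4 w)) (0 : ℂ →L[ℝ] ℝ) z := by
    have hmul := (HasWirtinger.of_hasDerivAt (h.hasDerivAt_coord 4 z)).mul
      (HasWirtinger.of_hasDerivAt (h.hasDerivAt_coord 4 z)).conj'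
    have e : (fun w => Complex.normSq (p 4 w)) = fun w => (p 4 w * conj (p 4 w)).re := by
      funext w
      rw [Complex.mul_conj, Complex.ofReal_re]
    rw [e]
    refine (Complex.reCLM.hasFDerivAt.comp z hmul).congr_fderiv ?_
    ext v
    simp [h4, wirtingerMap_apply]
  have hd := glue.hasFDerivAt.comp z ((hs.hasFDerivAt.smul h1.hasFDerivAt).prodMk
    ((hs.hasFDerivAt.mul hN).const_sub 1))
  have key : ∀ v, pd v (nullSphere p) z = glue ((2 * (nullScale p z)⁻¹) •
      re3 ((conj v * conj (deriv (p 4) z)) • midVec p z), 0) := by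
    intro v
    have h5 : fderiv ℝ (fun w => re3 (conj (p 4 w) • midVec p w)) z v =
        re3 ((conj v * conj (deriv (p 4) z)) • midVec p z) := by
      refine (h2 v).trans ?_
      congr 1
      funext j
      simp only [Pi.add_apply, Pi.smul_apply, smul_eq_mul, mul_assoc, mul_zero, zero_add]
    change fderiv ℝ (nullSphere p) z v = _
    rw [show fderiv ℝ (nullSphere p) z = _ from hd.fderiv]
    simp [h5, h4]
  refine ⟨h.contDiff_nullSphere.diffAt z, (2 * (nullScale p z)⁻¹) ^ 2 *
    (Complex.normSq (deriv (p 4) z) * nsq3 (midVec p z) / 2), ?_, fun u v => ?_⟩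
  · have := Complex.normSq_pos.2 (h.deriv_ne_zero h4)
    have := h.nullScale_pos z
    positivity
  · rw [key, key, inner_glue, real_inner_smul_left, real_inner_smul_right,
      inner_re3_isotropic hiso]
    have e : conj u * conj (deriv (p 4) z) * conj (conj v * conj (deriv (p 4) z)) =
        (Complex.normSq (deriv (p 4) z) : ℂ) * conj (u * conj v) := by
      rw [Complex.normSq_eq_conj_mul_self, map_mul, map_mul]
      simp only [Complex.conj_conj]
      ring
    rw [e, Complex.re_ofReal_mul, Complex.conj_re]
    ring

theorem isConformalImmersionAt_nullSphere (z : ℂ) : IsConformalImmersionAt (nullSphere p) z := by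
  by_cases h4 : p 4 z = 0
  · exact h.isConformalImmersionAt_nullSphere_of_eq h4
  · exact h.isConformalImmersionAt_nullSphere_of_ne h4

theorem isPlaneImmersion : IsPlaneImmersion (nullSphere p) :=
  isPlaneImmersion_of_injective h.contDiff_nullSphere h.norm_nullSphere fun z =>
    (h.isConformalImmersionAt_nullSphere z).injective

/-- The zeros of `p 4` are simple, hence isolated. -/
theorem dense_setOf_ne : Dense {z | p 4 z ≠ 0} := by
  intro z
  by_cases h4 : p 4 z = 0
  · have h1 := (h.hasDerivAt_coord 4 z).eventually_ne (c := 0) (h.deriv_ne_zero h4)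
    rw [mem_closure_iff_frequently]
    exact (h1.frequently).filter_mono nhdsWithin_le_nhds
  · exact subset_closure h4

theorem harmonic {z : ℂ} (h4 : p 4 z ≠ 0) :
    g12 (nullSphere p) z = 0 ∧ g22 (nullSphere p) z = g11 (nullSphere p) z ∧
      lor (pd 1 (confGauss (nullSphere p)) z) (pd Complex.I (confGauss (nullSphere p)) z) = 0 ∧
      lor (pd Complex.I (confGauss (nullSphere p)) z) (pd Complex.I (confGauss (nullSphere p)) z) =
        lor (pd 1 (confGauss (nullSphere p)) z) (pd 1 (confGauss (nullSphere p)) z) ∧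
      (pd 1 (pd 1 (confGauss (nullSphere p))) z
        + pd Complex.I (pd Complex.I (confGauss (nullSphere p))) z
        = (-(8 * Complex.normSq (wronsk P Q z) / (Complex.normSq (P z) + Complex.normSq (Q z)) ^ 2))
          • confGauss (nullSphere p) z) ∧
      lor (pd 1 (confGauss (nullSphere p)) z) (pd 1 (confGauss (nullSphere p)) z) =
        4 * Complex.normSq (wronsk P Q z) / (Complex.normSq (P z) + Complex.normSq (Q z)) ^ 2 := by
  have hP := h.differentiable_left
  have hQ := h.differentiable_right
  have h0 := h.spinor_ne_zero
  have hev := h.eventually_ne h4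
  have key := h.isPlaneImmersion.harmonic_confGauss (f := nullSurface p) (n := gaussMap P Q)
    (z₀ := z) (hev.mono fun w hw => h.nullSphere_eq hw) (hev.mono fun w hw => (h.pd_nullSurface hw).1)
    (contDiff_gaussMap hP hQ h0) (hev.mono fun w hw => ⟨inner_spinVec (h0 w), fun v => by
        rw [(h.pd_nullSurface hw).2]
        exact inner_spinVec_isoVec _ _ _, by
        rw [h.inner_pd_nullSurface hw]; simp, by
        rw [h.inner_pd_nullSurface hw, h.inner_pd_nullSurface hw]; simp, by
        rw [(h.pd_nullSurface hw).2, (h.pd_nullSurface hw).2, pd_gaussMap hP hQ h0,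
          pd_gaussMap hP hQ h0, gaussDeriv, smul_smul, smul_smul,
          inner_re3_isotropic_conj (isoVec_isotropic _ _),
          inner_re3_isotropic_conj (isoVec_isotropic _ _), ← add_div, ← add_mul, ← Complex.add_re]
        -- Minimality: `f_v` is the real part of `v c q` and `n_v` that of `2 v m` times the
        -- conjugate of `q`, so their product is proportional to `Re (v² c m)`, and `1² + i² = 0`.
        rw [show ∀ c m : ℂ, 1 * c * (2 * 1 * m) + Complex.I * c * (2 * Complex.I * m) = 0 from
          fun c m => by linear_combination 2 * c * m * Complex.I_sq]
        simp⟩)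
    (by rw [inner_pd_gaussMap hP hQ h0]; simp)
    (by rw [inner_pd_gaussMap hP hQ h0, inner_pd_gaussMap hP hQ h0]; simp)
    (laplacian_gaussMap hP hQ h0 z)
  rw [inner_pd_gaussMap hP hQ h0, map_one, mul_one, Complex.one_re, one_mul] at key
  exact key

/-- Off the ends both the surface and its conformal Gauss map are conformal, so the energy density
is the metric coefficient of the Gauss map. Continuity gives the formula at the ends. -/
theorem gaussEnergy_nullSphere (z : ℂ) : gaussEnergy (nullSphere p) z =
    4 * Complex.normSq (wronsk P Q z) / (Complex.normSq (P z) + Complex.normSq (Q z)) ^ 2 := by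
  have hX := h.isPlaneImmersion
  have hP := h.differentiable_left
  have hQ := h.differentiable_right
  have hW : Continuous (wronsk P Q) :=
    ((hP.contDiff (n := 1)).continuous_deriv_one.mul hQ.continuous).sub
      (hP.continuous.mul (hQ.contDiff (n := 1)).continuous_deriv_one)
  refine congrFun (Continuous.ext_on h.dense_setOf_ne hX.continuous_gaussEnergy (g := fun z =>
    4 * Complex.normSq (wronsk P Q z) / (Complex.normSq (P z) + Complex.normSq (Q z)) ^ 2) ?_ ?_) z
  · refine (continuous_const.mul (Complex.continuous_normSq.comp hW)).div₀
      (((Complex.continuous_normSq.comp hP.continuous).add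
        (Complex.continuous_normSq.comp hQ.continuous)).pow 2) fun z => ?_
    exact pow_ne_zero 2 (normSq_add_normSq_pos (h.spinor_ne_zero z)).ne'
  · intro w hw
    obtain ⟨h1, h2, h3, h4, -, h5⟩ := h.harmonic hw
    have hd := hX.detg_pos w
    have hdet : detg (nullSphere p) w = g11 (nullSphere p) w ^ 2 := by
      rw [detg, h1, h2]
      ring
    have hp : 0 < g11 (nullSphere p) w := by
      refine lt_of_le_of_ne (real_inner_self_nonneg) fun h0 => ?_
      rw [hdet, ← h0] at hd
      norm_num at hd
    rw [gaussEnergy, h3, h4, h5, h2, hdet, Real.sqrt_sq hp.le]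
    field_simp
    ring

end NullData

/-- Scale and numerators are all multiplied by `|c|²`, so the surface depends only on the point of
projective space. -/
theorem nullSphere_congr {p q : Fin 5 → ℂ → ℂ} {z w c : ℂ} (hc : c ≠ 0)
    (h : ∀ j, q j w = c * p j z) : nullSphere q w = nullSphere p z := by
  have hn : Complex.normSq c ≠ 0 := (Complex.normSq_pos.2 hc).ne'
  have hS : nullScale q w = Complex.normSq c * nullScale p z := by
    rw [nullScale, nullScale, nsq3, nsq3]
    simp only [midVec, h, map_mul]
    rw [show c * p 0 z * ((starRingEnd ℂ) c * (starRingEnd ℂ) (p 4 z)) =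
      (Complex.normSq c : ℂ) * (p 0 z * (starRingEnd ℂ) (p 4 z)) by
        rw [Complex.normSq_eq_conj_mul_self]; ring, Complex.re_ofReal_mul]
    ring
  have hv : re3 ((starRingEnd ℂ) (q 4 w) • midVec q w) =
      Complex.normSq c • re3 ((starRingEnd ℂ) (p 4 z) • midVec p z) := by
    rw [← map_smul]
    congr 1
    funext j
    simp only [Pi.smul_apply, smul_eq_mul, Complex.real_smul, Complex.normSq_eq_conj_mul_self,
      midVec, h, map_mul]
    ring
  rw [nullSphere, nullSphere, hS, hv, h, map_mul, smul_smul, mul_inv]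
  congr 3
  · field_simp
  · field_simp

/-- The null curve in the coordinate at infinity. -/
theorem NullData.reverse {p q : Fin 5 → ℂ → ℂ} {P Q P' Q' : ℂ → ℂ} {κ : ℂ}
    (h : NullData p P Q κ) {d : ℕ} (hq : ∀ j, Differentiable ℂ (q j)) (hP : Differentiable ℂ P')
    (hQ : Differentiable ℂ Q') (eq : ∀ j w, w ≠ 0 → q j w = w ^ (d + 1) * p j w⁻¹)
    (eP : ∀ w, w ≠ 0 → P' w = w ^ d * P w⁻¹) (eQ : ∀ w, w ≠ 0 → Q' w = w ^ d * Q w⁻¹)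
    (h0 : P' 0 ≠ 0 ∨ Q' 0 ≠ 0) : NullData q P' Q' (-κ) := by
  have hd : ∀ j, Continuous (deriv (q j)) := fun j => ((hq j).contDiff (n := 1)).continuous_deriv_one
  have hne : Dense {w : ℂ | w ≠ 0} := dense_compl_singleton 0
  refine ⟨hq, hP, hQ, fun z => ?_, fun z j => ?_, fun z => ?_, neg_ne_zero.2 h.const_ne_zero⟩
  · refine congrFun (Continuous.ext_on hne
      (f := fun z => q 1 z ^ 2 + q 2 z ^ 2 + q 3 z ^ 2) (g := fun z => 2 * q 0 z * q 4 z) ?_ ?_ ?_) z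
    · have := fun j => (hq j).continuous
      fun_prop
    · have := fun j => (hq j).continuous
      fun_prop
    · intro w hw
      have := h.quadric w⁻¹
      simp only [eq _ w hw]
      linear_combination (w ^ (d + 1)) ^ 2 * this
  · refine congrFun (Continuous.ext_on hne (f := fun z => deriv (q j.succ.castSucc) z * q 4 z
      - q j.succ.castSucc z * deriv (q 4) z) (g := fun z => -κ * isoVec (P' z) (Q' z) j) ?_ ?_ ?_) z
    · exact ((hd _).mul (hq _).continuous).sub ((hq _).continuous.mul (hd _))
    · refine continuous_const.mul ?_
      have h1 := hP.continuous
      have h2 := hQ.continuous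
      fin_cases j
      · exact (continuous_const.mul h1).mul h2
      · exact continuous_const.mul ((h1.pow 2).add (h2.pow 2))
      · exact (h2.pow 2).sub (h1.pow 2)
    · intro w hw
      -- The first term, from the power of `w`, cancels in the Wronskian; the second carries the
      -- sign of the derivative of `1 / w`, whence `-κ`. The exponent `d + 1`, one more than the
      -- spinor's, absorbs the remaining `w⁻²`.
      have hder : ∀ j, deriv (q j) w = (d + 1) * w ^ d * p j w⁻¹
          - w ^ (d + 1) * (w ^ 2)⁻¹ * deriv (p j) w⁻¹ := by
        intro j
        have e : q j =ᶠ[𝓝 w] fun w => w ^ (d + 1) * p j w⁻¹ :=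
          (eventually_ne_nhds hw).mono fun w hw => eq j w hw
        have h1 := (hasDerivAt_pow (d + 1) w).mul
          ((h.hasDerivAt_coord j w⁻¹).comp w (hasDerivAt_inv hw))
        rw [e.deriv_eq]
        refine h1.deriv.trans ?_
        push_cast
        simp only [Function.comp]
        ring
      have hiso : isoVec (P' w) (Q' w) j = (w ^ d) ^ 2 * isoVec (P w⁻¹) (Q w⁻¹) j := by
        rw [eP w hw, eQ w hw]
        fin_cases j <;> simp only [isoVec, Fin.zero_eta, Fin.mk_one, Fin.reduceFinMk,
          Matrix.cons_val_zero, Matrix.cons_val_one, Matrix.cons_val] <;> ring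
      have hw2 := h.wronskian w⁻¹ j
      simp only [hder, eq _ w hw, hiso]
      have e1 : w ^ (d + 1) * (w ^ 2)⁻¹ * w ^ (d + 1) = (w ^ d) ^ 2 := by
        have hw' : w ≠ 0 := hw
        field_simp
        ring
      linear_combination (-(w ^ (d + 1) * (w ^ 2)⁻¹ * w ^ (d + 1))) * hw2
        - κ * isoVec (P w⁻¹) (Q w⁻¹) j * e1
  · by_cases hz : z = 0
    · rwa [hz]
    · rw [eP z hz, eQ z hz]
      exact (h.spinor_ne_zero z⁻¹).imp (mul_ne_zero (pow_ne_zero d hz))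
        (mul_ne_zero (pow_ne_zero d hz))

/-- The map on the sphere given by its restrictions to the two coordinate charts. -/
def glueCharts {F : Type*} (X₀ X₁ : ℂ → F) : CP1 → F
  | none => X₁ 0
  | some z => X₀ z

theorem chart₁_glueCharts {F : Type*} {X₀ X₁ : ℂ → F} (h : ∀ w, w ≠ 0 → X₁ w = X₀ w⁻¹) :
    chart₁ (glueCharts X₀ X₁) = X₁ := by
  funext w
  by_cases hw : w = 0
  · rw [chart₁, hw, coord_infty_zero]
    rfl
  · rw [chart₁, coord_infty hw, h w hw]
    rfl

/-- A property of germs of maps holds in all standard coordinates if it is invariant under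
translations and holds in the two charts. -/
theorem forall_coord {F : Type*} {φ : CP1 → F} {A : (ℂ → F) → ℂ → Prop}
    (htr : ∀ X z, A X z → A (fun w => X (z + w)) 0) (h₀ : ∀ z, A (chart₀ φ) z)
    (h₁ : A (chart₁ φ) 0) (q : CP1) : A (fun w => φ (coord q w)) 0 := by
  induction q using OnePoint.rec with
  | infty => exact h₁
  | coe z => exact htr _ z (h₀ z)

/-! ### Spheres covered by the null curves of two charts -/

section TwoCharts

variable {p q : Fin 5 → ℂ → ℂ} {P Q P' Q' : ℂ → ℂ} {κ κ' : ℂ} (h₀ : NullData p P Q κ)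
  (h₁ : NullData q P' Q' κ') {φ : CP1 → E4} (e₀ : chart₀ φ = nullSphere p)
  (e₁ : chart₁ φ = nullSphere q)
include h₀ h₁ e₀ e₁

theorem isConformalImmersionAt_of_nullData (s : CP1) :
    IsConformalImmersionAt (fun w => φ (coord s w)) 0 := by
  refine forall_coord (A := IsConformalImmersionAt) (fun X z h => h.comp_add_left) ?_ ?_ s
  · rw [e₀]
    exact h₀.isConformalImmersionAt_nullSphere
  · rw [e₁]
    exact h₁.isConformalImmersionAt_nullSphere 0

theorem isSphericalImmersion_of_nullData : IsSphericalImmersion φ := by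
  intro s
  refine ⟨?_, ?_, (isConformalImmersionAt_of_nullData h₀ h₁ e₀ e₁ s).injective⟩
  · induction s using OnePoint.rec with
    | infty => rw [← coord_infty_zero, show φ (coord OnePoint.infty 0) = _ from congrFun e₁ 0,
        h₁.norm_nullSphere]
    | coe z => rw [show φ (z : CP1) = _ from congrFun e₀ z, h₀.norm_nullSphere]
  · refine forall_coord (A := fun X z => ContDiffAt ℝ ∞ X z) (fun X z h => ?_) ?_ ?_ s
    · refine ContDiffAt.comp (0 : ℂ) (by rwa [add_zero]) (contDiffAt_const.add contDiffAt_id)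
    · rw [e₀]
      exact fun z => h₀.contDiff_nullSphere.contDiffAt
    · rw [e₁]
      exact h₁.contDiff_nullSphere.contDiffAt

theorem minimal_of_nullData (s : CP1) (hs : φ s ≠ northPole) :
    ConformalAt (fun w => stereo (φ (coord s w))) 0 ∧
      meanCurvatureVector ∅ (fun w => stereo (φ (coord s w))) 0 = 0 := by
  have key : ∀ {p : Fin 5 → ℂ → ℂ} {P Q : ℂ → ℂ} {κ : ℂ}, NullData p P Q κ → ∀ z,
      nullSphere p z ≠ northPole → IsConformalImmersionAt (fun w => stereo (nullSphere p w)) z ∧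
      meanCurvatureVector ∅ (fun w => stereo (nullSphere p w)) z = 0 := by
    intro p P Q κ h z hz
    have h4 := (h.nullSphere_eq_northPole_iff z).not.1 hz
    have e := (h.eventually_ne h4).mono fun w hw => h.stereo_nullSphere hw
    exact ⟨(h.isConformalImmersionAt_nullSurface h4).congr e, meanCurvatureVector_eq_zero e
      (h.isConformalImmersionAt_nullSurface h4) (h.laplacian_nullSurface h4)⟩
  have := forall_coord (φ := φ) (A := fun X z => X z ≠ northPole →
    IsConformalImmersionAt (fun w => stereo (X w)) z ∧
      meanCurvatureVector ∅ (fun w => stereo (X w)) z = 0) (fun X z h hX => ?_)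
    (by rw [e₀]; exact key h₀) (by rw [e₁]; exact key h₁ 0) s ?_
  · exact ⟨this.1.conformalAt, this.2⟩
  · replace hX : X (z + 0) ≠ northPole := hX
    rw [add_zero] at hX
    refine ⟨(h hX).1.comp_add_left, ?_⟩
    rw [meanCurvatureVector_comp_add_left ∅ (fun w => stereo (X w)), (h hX).2]
  · have : coord s 0 = s := by
      induction s using OnePoint.rec with
      | infty => exact coord_infty_zero
      | coe z => rw [coord_coe, add_zero]
    change φ (coord s 0) ≠ northPole
    rwa [this]

theorem isWillmoreSphere_of_nullData : IsWillmoreSphere φ := by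
  refine isWillmoreSphere_of_harmonic (isSphericalImmersion_of_nullData h₀ h₁ e₀ e₁)
    h₀.dense_setOf_ne fun z hz => ?_
  obtain ⟨a, b, c, d, e, -⟩ := h₀.harmonic hz
  rw [e₀]
  exact ⟨a, b, c, d, _, e⟩

theorem willmoreEnergy_of_nullData : willmoreEnergy φ =
    ∫ z, 4 * Complex.normSq (wronsk P Q z) / (Complex.normSq (P z) + Complex.normSq (Q z)) ^ 2 := by
  rw [(isSphericalImmersion_of_nullData h₀ h₁ e₀ e₁).willmoreEnergy_eq, e₀]
  exact MeasureTheory.integral_congr_ae (Filter.Eventually.of_forall h₀.gaussEnergy_nullSphere)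

end TwoCharts

/-! ### The area of the Gauss map -/

section SpinorArea

open ComplexConjugate MeasureTheory

/-- The density `|P'Q - PQ'|² / (|P|² + |Q|²)²`. -/
def spinDensity (P Q : ℂ → ℂ) (z : ℂ) : ℝ :=
  4 * Complex.normSq (wronsk P Q z) / (Complex.normSq (P z) + Complex.normSq (Q z)) ^ 2

/-- The logarithm of the squared norm of a spinor field. -/
def logNorm (P Q : ℂ → ℂ) (z : ℂ) : ℝ :=
  Real.log (Complex.normSq (P z) + Complex.normSq (Q z))

theorem hasFDerivAt_of_wirtinger_ofReal {f : ℂ → ℝ} {a b z : ℂ}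
    (h : HasWirtinger (fun w => (f w : ℂ)) a b z) :
    HasFDerivAt f (Complex.reCLM.comp (wirtingerMap a b)) z :=
  Complex.reCLM.hasFDerivAt.comp z h

variable {P Q : ℂ → ℂ} (hP : Differentiable ℂ P) (hQ : Differentiable ℂ Q)
  (h0 : ∀ z, P z ≠ 0 ∨ Q z ≠ 0)
include hP hQ h0

theorem pd_logNorm (v z : ℂ) : pd v (logNorm P Q) z =
    2 * (v * ((deriv P z * conj (P z) + deriv Q z * conj (Q z)) / spinNorm (P z) (Q z))).re := by
  have hn := (normSq_add_normSq_pos (h0 z)).ne'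
  have h1 := hasWirtinger_spinNorm (HasWirtinger.of_differentiable hP z)
    (HasWirtinger.of_differentiable hQ z)
  have h2 : HasWirtinger
      (fun w => ((Complex.normSq (P w) + Complex.normSq (Q w) : ℝ) : ℂ))
      (deriv P z * conj (P z) + deriv Q z * conj (Q z))
      (P z * conj (deriv P z) + Q z * conj (deriv Q z)) z := by
    convert h1 using 2
    rw [spinNorm_eq, Complex.ofReal_add]
  have h3 := (hasFDerivAt_of_wirtinger_ofReal h2).log hn
  change fderiv ℝ (logNorm P Q) z v = _
  rw [show fderiv ℝ (logNorm P Q) z = _ from h3.fderiv]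
  simp only [smul_apply, ContinuousLinearMap.comp_apply, wirtingerMap_apply,
    Complex.reCLM_apply, smul_eq_mul]
  have e : (deriv P z * conj (P z) + deriv Q z * conj (Q z)) * v
      + (P z * conj (deriv P z) + Q z * conj (deriv Q z)) * conj v =
      ((2 * ((deriv P z * conj (P z) + deriv Q z * conj (Q z)) * v).re : ℝ) : ℂ) := by
    rw [Complex.ofReal_mul, Complex.re_eq_add_conj]
    simp only [map_mul, map_add, Complex.conj_conj]
    push_cast
    ring
  rw [e, Complex.ofReal_re, spinNorm_eq, ← mul_div_assoc,
    Complex.div_ofReal_re, mul_comm v]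
  ring

theorem contDiff_logNorm : ContDiff ℝ ∞ (logNorm P Q) := by
  have hPr : ContDiff ℝ ∞ P := hP.contDiff.restrict_scalars ℝ
  have hQr : ContDiff ℝ ∞ Q := hQ.contDiff.restrict_scalars ℝ
  have hn : ∀ {f : ℂ → ℂ}, ContDiff ℝ ∞ f → ContDiff ℝ ∞ fun z => Complex.normSq (f z) := by
    intro f hf
    have : (fun z => Complex.normSq (f z)) = fun z => (f z * conj (f z)).re := by
      funext z
      rw [Complex.mul_conj, Complex.ofReal_re]
    rw [this]
    exact Complex.reCLM.contDiff.comp (hf.mul (Complex.conjCLE.contDiff.comp hf))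
  exact ((hn hPr).add (hn hQr)).log fun z => (normSq_add_normSq_pos (h0 z)).ne'

/-- The Fubini–Study computation: `∂̄∂ log (|P|² + |Q|²)` is the squared modulus of the Wronskian
over `(|P|² + |Q|²)²`. As in `laplacian_gaussMap`, the pure second derivative `a` cancels. -/
theorem laplacian_logNorm (z : ℂ) :
    pd 1 (pd 1 (logNorm P Q)) z + pd Complex.I (pd Complex.I (logNorm P Q)) z =
      spinDensity P Q z := by
  have hn := spinNorm_ne_zero (h0 z)
  have wP := HasWirtinger.of_differentiable hP z
  have wQ := HasWirtinger.of_differentiable hQ z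
  have wP' := HasWirtinger.of_differentiable (hP.contDiff.differentiable_deriv_two) z
  have wQ' := HasWirtinger.of_differentiable (hQ.contDiff.differentiable_deriv_two) z
  have wG := ((wP'.mul wP.conj').add (wQ'.mul wQ.conj')).div (hasWirtinger_spinNorm wP wQ) hn
  obtain ⟨a, ha⟩ : ∃ a, HasWirtinger (fun z => (deriv P z * conj (P z) + deriv Q z * conj (Q z))
      / spinNorm (P z) (Q z)) a (wronsk P Q z * conj (wronsk P Q z) / spinNorm (P z) (Q z) ^ 2) z := by
    refine ⟨_, wG.congr_deriv rfl ?_⟩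
    simp only [wronsk, map_sub, map_mul]
    field_simp
    simp only [spinNorm]
    ring
  have key : ∀ v, pd v (pd v (logNorm P Q)) z = 2 * (v * (a * v +
      wronsk P Q z * conj (wronsk P Q z) / spinNorm (P z) (Q z) ^ 2 * conj v)).re := by
    intro v
    have e : pd v (logNorm P Q) = _ := funext (pd_logNorm hP hQ h0 v)
    have hd := ((Complex.reCLM.hasFDerivAt.comp z (ha.const_mul v)).const_mul 2).fderiv
    rw [e]
    change fderiv ℝ _ z v = _
    refine (congrArg (fun L : ℂ →L[ℝ] ℝ => L v) hd).trans ?_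
    simp only [smul_apply, ContinuousLinearMap.comp_apply, wirtingerMap_apply,
      Complex.reCLM_apply, smul_eq_mul]
    congr 2
    ring
  rw [key, key, ← mul_add, ← Complex.add_re, spinDensity]
  have e : 1 * (a * 1 + wronsk P Q z * conj (wronsk P Q z) / spinNorm (P z) (Q z) ^ 2 * conj 1)
      + Complex.I * (a * Complex.I
        + wronsk P Q z * conj (wronsk P Q z) / spinNorm (P z) (Q z) ^ 2 * conj Complex.I) =
      ((2 * Complex.normSq (wronsk P Q z) /
        (Complex.normSq (P z) + Complex.normSq (Q z)) ^ 2 : ℝ) : ℂ) := by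
    rw [spinNorm_eq, Complex.mul_conj, map_one, Complex.conj_I]
    push_cast
    linear_combination (a - (Complex.normSq (wronsk P Q z) : ℂ) /
      ((Complex.normSq (P z) : ℂ) + (Complex.normSq (Q z) : ℂ)) ^ 2) * Complex.I_sq
  rw [e, Complex.ofReal_re]
  ring

theorem continuous_spinDensity : Continuous (spinDensity P Q) := by
  have hW : Continuous (wronsk P Q) :=
    ((hP.contDiff (n := 1)).continuous_deriv_one.mul hQ.continuous).sub
      (hP.continuous.mul (hQ.contDiff (n := 1)).continuous_deriv_one)
  refine (continuous_const.mul (Complex.continuous_normSq.comp hW)).div₀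
    (((Complex.continuous_normSq.comp hP.continuous).add
      (Complex.continuous_normSq.comp hQ.continuous)).pow 2) fun z => ?_
  exact pow_ne_zero 2 (normSq_add_normSq_pos (h0 z)).ne'

-- A common factor of the spinor multiplies the Wronskian by its square, with no derivative of the
-- factor, and so disappears from the density; what remains is the Jacobian of `1 / z`.
omit h0 in
theorem spinDensity_of_inv {P' Q' : ℂ → ℂ} {n : ℕ} (eP : ∀ w, w ≠ 0 → P' w = w ^ n * P w⁻¹)
    (eQ : ∀ w, w ≠ 0 → Q' w = w ^ n * Q w⁻¹) {z : ℂ} (hz : z ≠ 0) :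
    spinDensity P Q z = (‖z‖ ^ 4)⁻¹ * spinDensity P' Q' z⁻¹ := by
  have hw := inv_ne_zero hz
  have hder : ∀ {f g : ℂ → ℂ}, Differentiable ℂ f → (∀ w, w ≠ 0 → g w = w ^ n * f w⁻¹) →
      deriv g z⁻¹ = n * z⁻¹ ^ (n - 1) * f z - z⁻¹ ^ n * z ^ 2 * deriv f z := by
    intro f g hf e
    have e : g =ᶠ[𝓝 z⁻¹] fun w => w ^ n * f w⁻¹ :=
      (eventually_ne_nhds hw).mono fun w hw => e w hw
    have hfz : HasDerivAt f (deriv f z) z⁻¹⁻¹ := by rw [inv_inv]; exact (hf z).hasDerivAt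
    have h1 := (hasDerivAt_pow n z⁻¹).mul (hfz.comp z⁻¹ (hasDerivAt_inv hw))
    rw [e.deriv_eq]
    refine h1.deriv.trans ?_
    simp only [Function.comp, inv_inv, inv_pow]
    ring
  have hW : wronsk P' Q' z⁻¹ = -((z⁻¹ ^ n) ^ 2 * z ^ 2) * wronsk P Q z := by
    rw [wronsk, wronsk, hder hP eP, hder hQ eQ, eP _ hw, eQ _ hw, inv_inv]
    ring
  have hN : ‖z‖ ≠ 0 := norm_ne_zero_iff.2 hz
  rw [spinDensity, spinDensity, hW, eP _ hw, eQ _ hw, inv_inv]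
  simp only [map_mul, map_pow, Complex.normSq_neg, map_inv₀]
  rw [← mul_add, mul_pow, Complex.normSq_eq_norm_sq z]
  field_simp

theorem integrable_spinDensity {P' Q' : ℂ → ℂ} {n : ℕ} (hP' : Differentiable ℂ P')
    (hQ' : Differentiable ℂ Q') (h0' : ∀ z, P' z ≠ 0 ∨ Q' z ≠ 0)
    (eP : ∀ w, w ≠ 0 → P' w = w ^ n * P w⁻¹) (eQ : ∀ w, w ≠ 0 → Q' w = w ^ n * Q w⁻¹) :
    Integrable (spinDensity P Q) := by
  obtain ⟨C, hC⟩ := IsSphereFamily.exists_bound_of_density (f₀ := fun _ => spinDensity P Q)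
    (f₁ := fun _ => spinDensity P' Q') ((continuous_spinDensity hP hQ h0).comp continuous_snd)
    ((continuous_spinDensity hP' hQ' h0').comp continuous_snd)
    fun _ z hz => spinDensity_of_inv hP hQ eP eQ hz
  exact (integrable_inv_one_add_norm_sq_sq.const_mul C).mono'
    (continuous_spinDensity hP hQ h0).aestronglyMeasurable
    (Filter.Eventually.of_forall fun z => hC 0 (by simp) z)

omit hP hQ h0 in
theorem spinDensity_id_one (z : ℂ) : spinDensity id (fun _ => 1) z = 4 * ((1 + ‖z‖ ^ 2) ^ 2)⁻¹ := by
  rw [spinDensity, wronsk, Complex.normSq_eq_norm_sq (id z), add_comm]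
  simp [div_eq_mul_inv]

omit hP hQ h0 in
theorem integral_spinDensity_id_one : ∫ z, spinDensity id (fun _ => 1) z = 4 * Real.pi := by
  simp only [spinDensity_id_one]
  rw [← Complex.integral_comp_polarCoord_symm, polarCoord_target]
  have e : ∀ p : ℝ × ℝ, p.1 • (4 * ((1 + ‖Complex.polarCoord.symm p‖ ^ 2) ^ 2)⁻¹) =
      (p.1 * (4 * ((1 + p.1 ^ 2) ^ 2)⁻¹)) * (fun _ : ℝ => (1 : ℝ)) p.2 := by
    intro p
    rw [Complex.norm_polarCoord_symm, sq_abs, smul_eq_mul, mul_one]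
  simp only [e]
  rw [Measure.volume_eq_prod, setIntegral_prod_mul (fun r : ℝ => r * (4 * ((1 + r ^ 2) ^ 2)⁻¹)) (fun _ : ℝ => (1 : ℝ))]
  have h1 : ∫ r in Set.Ioi (0 : ℝ), r * (4 * ((1 + r ^ 2) ^ 2)⁻¹) = 2 := by
    have hd : ∀ r : ℝ, HasDerivAt (fun r : ℝ => -2 * (1 + r ^ 2)⁻¹)
        (r * (4 * ((1 + r ^ 2) ^ 2)⁻¹)) r := by
      intro r
      have hr : 1 + r ^ 2 ≠ 0 := by positivity
      refine (((((hasDerivAt_pow 2 r).const_add 1).inv hr).const_mul (-2))).congr_deriv ?_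
      push_cast
      field_simp
      ring
    have ht : Filter.Tendsto (fun r : ℝ => -2 * (1 + r ^ 2)⁻¹) Filter.atTop (𝓝 (-2 * 0)) :=
      ((Filter.tendsto_atTop_add_const_left _ 1
        (Filter.tendsto_pow_atTop two_ne_zero)).inv_tendsto_atTop).const_mul (-2)
    rw [integral_Ioi_of_hasDerivAt_of_nonneg' (fun r _ => hd r) (fun r hr => ?_) ht]
    · norm_num
    · have : 0 < r := hr
      positivity
  have h2 : ∫ _ in Set.Ioo (-Real.pi) Real.pi, (1 : ℝ) = 2 * Real.pi := by
    have := Real.pi_pos.le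
    simp [two_mul, this]
  rw [h1, h2]
  ring

/-- The total area of the spherical image of a rational spinor field of degree `n`. -/
theorem integral_spinDensity {P' Q' : ℂ → ℂ} {n : ℕ} (hP' : Differentiable ℂ P')
    (hQ' : Differentiable ℂ Q') (h0' : ∀ z, P' z ≠ 0 ∨ Q' z ≠ 0)
    (eP : ∀ w, w ≠ 0 → P' w = w ^ n * P w⁻¹) (eQ : ∀ w, w ≠ 0 → Q' w = w ^ n * Q w⁻¹) :
    ∫ z, spinDensity P Q z = 4 * Real.pi * n := by
  have h1 : ∀ z : ℂ, id z ≠ 0 ∨ (fun _ : ℂ => (1 : ℂ)) z ≠ 0 := fun z => Or.inr one_ne_zero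
  have d1 : Differentiable ℂ (fun _ : ℂ => (1 : ℂ)) := differentiable_const _
  have cL := contDiff_logNorm hP hQ h0
  have cI := contDiff_logNorm differentiable_id d1 h1
  have cL' := contDiff_logNorm hP' hQ' h0'
  -- Under `z ↦ 1 / z` both logarithms acquire the same term `n log |w|²`, so `L` is smooth on the
  -- whole sphere, its gradient decays like `|z|⁻²`, and its Laplacian integrates to zero.
  set L : ℂ → ℝ := fun z => logNorm P Q z - n * logNorm id (fun _ => 1) z with hL
  have hLs : ContDiff ℝ ∞ L := cL.sub (contDiff_const.mul cI)
  have hlog : ∀ {f g f' g' : ℂ → ℂ} {m : ℕ}, (∀ z, f z ≠ 0 ∨ g z ≠ 0) →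
      (∀ w, w ≠ 0 → f' w = w ^ m * f w⁻¹) → (∀ w, w ≠ 0 → g' w = w ^ m * g w⁻¹) → ∀ w, w ≠ 0 →
      logNorm f' g' w = m * Real.log (Complex.normSq w) + logNorm f g w⁻¹ := by
    intro f g f' g' m hfg ef eg w hw
    rw [logNorm, logNorm, ef w hw, eg w hw, map_mul, map_mul, ← mul_add, map_pow,
      Real.log_mul (pow_ne_zero m (Complex.normSq_pos.2 hw).ne') (normSq_add_normSq_pos (hfg _)).ne',
      Real.log_pow]
  have hlogI : ∀ w, w ≠ 0 → logNorm id (fun _ => 1) w =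
      Real.log (Complex.normSq w) + logNorm id (fun _ => 1) w⁻¹ := by
    intro w hw
    have h2 : (0 : ℝ) < Complex.normSq w := Complex.normSq_pos.2 hw
    have h3 := normSq_add_normSq_pos (h1 w⁻¹)
    rw [logNorm, logNorm, ← Real.log_mul h2.ne' h3.ne']
    congr 1
    simp only [id, map_inv₀, map_one]
    field_simp
    ring
  have hinv : ∀ z, z ≠ 0 → L z = (fun w => logNorm P' Q' w - n * logNorm id (fun _ => 1) w) z⁻¹ := by
    intro z hz
    have hz' := inv_ne_zero hz
    simp only [hL]
    rw [hlog h0 eP eQ z⁻¹ hz', hlogI z⁻¹ hz', inv_inv]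
    ring
  obtain ⟨C, hC⟩ := exists_norm_fderiv_le_of_inv hinv hLs (cL'.sub (contDiff_const.mul cI))
  have hb : ∀ v : ℂ, ‖v‖ = 1 → ∀ z, |pd v L z| ≤ C * (1 + ‖z‖ ^ 2)⁻¹ := by
    intro v hv z
    refine le_trans ?_ (hC z)
    have := (fderiv ℝ L z).le_opNorm v
    rwa [hv, mul_one] at this
  have hpd : ∀ v z, pd v L z = pd v (logNorm P Q) z - n * pd v (logNorm id (fun _ => 1)) z := by
    intro v z
    have := ((cL.diffAt z).hasFDerivAt.sub ((cI.diffAt z).hasFDerivAt.const_mul (n : ℝ))).fderiv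
    exact congrArg (fun T : ℂ →L[ℝ] ℝ => T v) this
  have hpd2 : ∀ v z, pd v (pd v L) z = pd v (pd v (logNorm P Q)) z
      - n * pd v (pd v (logNorm id (fun _ => 1))) z := by
    intro v z
    rw [show pd v L = _ from funext (hpd v)]
    have := (((contDiff_pd cL v).diffAt z).hasFDerivAt.sub
      (((contDiff_pd cI v).diffAt z).hasFDerivAt.const_mul (n : ℝ))).fderiv
    exact congrArg (fun T : ℂ →L[ℝ] ℝ => T v) this
  have hdiv : ∀ z, pd 1 (pd 1 L) z + pd Complex.I (pd Complex.I L) z =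
      spinDensity P Q z - n * spinDensity id (fun _ => 1) z := by
    intro z
    rw [hpd2, hpd2, ← laplacian_logNorm hP hQ h0, ← laplacian_logNorm differentiable_id d1 h1]
    ring
  have hi1 := integrable_spinDensity hP hQ h0 hP' hQ' h0' eP eQ
  have hi2 : Integrable (spinDensity id (fun _ => 1)) := by
    rw [funext spinDensity_id_one]
    exact integrable_inv_one_add_norm_sq_sq.const_mul 4
  have key := integral_divergence_eq_zero (contDiff_pd hLs 1) (contDiff_pd hLs Complex.I)
    (hb 1 (by simp)) (hb Complex.I (by simp)) (by
      rw [funext hdiv]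
      exact hi1.sub (hi2.const_mul _))
  simp only [hdiv] at key
  rw [integral_sub hi1 (hi2.const_mul _), integral_const_mul, integral_spinDensity_id_one] at key
  linarith

end SpinorArea

/-! ### Local lifts of holomorphic curves -/

section Lifts

open Filter

variable {V : Type*} [NormedAddCommGroup V] [NormedSpace ℂ V]

theorem exists_eq_smul_of_mem {c : Projectivization ℂ V} {x y : V} (hx : x ∈ c.submodule)
    (hx0 : x ≠ 0) (hy : y ∈ c.submodule) : ∃ a : ℂ, y = a • x := by
  rw [Projectivization.submodule_eq, Submodule.mem_span_singleton] at hx hy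
  obtain ⟨a, rfl⟩ := hx
  obtain ⟨b, rfl⟩ := hy
  refine ⟨b * a⁻¹, ?_⟩
  have ha : a ≠ 0 := fun h => hx0 (by rw [h, zero_smul])
  rw [smul_smul, inv_mul_cancel_right₀ ha]

theorem eq_of_mem_of_mem {c c' : Projectivization ℂ V} {x : V} (hx : x ∈ c.submodule)
    (hx' : x ∈ c'.submodule) (hx0 : x ≠ 0) : c = c' := by
  apply Projectivization.submodule_injective
  have key : ∀ {c c' : Projectivization ℂ V}, x ∈ c.submodule → x ∈ c'.submodule →
      c.submodule ≤ c'.submodule := by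
    intro c c' h h' y hy
    obtain ⟨a, rfl⟩ := exists_eq_smul_of_mem h hx0 hy
    exact Submodule.smul_mem _ _ h'
  exact le_antisymm (key hx hx') (key hx' hx)

theorem mem_submodule_mk {x : V} (hx : x ≠ 0) : x ∈ (Projectivization.mk ℂ x hx).submodule := by
  rw [Projectivization.submodule_mk]
  exact Submodule.mem_span_singleton_self x

/-- Two analytic vector functions whose values are proportional near `0`, except possibly at `0`,
and which do not vanish at `0`, differ by an analytic factor. -/
theorem exists_analyticAt_smul {u v : ℂ → V} (hu : AnalyticAt ℂ u 0) (hv : AnalyticAt ℂ v 0)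
    (hu0 : u 0 ≠ 0) (hv0 : v 0 ≠ 0) (h : ∀ᶠ w in 𝓝[≠] (0 : ℂ), ∃ a : ℂ, u w = a • v w) :
    ∃ f : ℂ → ℂ, AnalyticAt ℂ f 0 ∧ f 0 ≠ 0 ∧ ∀ᶠ w in 𝓝 (0 : ℂ), u w = f w • v w := by
  -- A functional not vanishing on `v 0` exhibits the proportionality factor as the quotient of two
  -- analytic functions; the value at `0` follows by continuity.
  obtain ⟨l, hl⟩ := SeparatingDual.exists_ne_zero (R := ℂ) hv0
  have hlu : AnalyticAt ℂ (fun w => l (u w)) 0 := (l.analyticAt _).comp hu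
  have hlv : AnalyticAt ℂ (fun w => l (v w)) 0 := (l.analyticAt _).comp hv
  have hf : AnalyticAt ℂ (fun w => l (u w) / l (v w)) 0 := hlu.div hlv hl
  have hev : ∀ᶠ w in 𝓝[≠] (0 : ℂ), u w = (l (u w) / l (v w)) • v w := by
    filter_upwards [h, (hlv.continuousAt.eventually_ne hl).filter_mono nhdsWithin_le_nhds]
      with w hw hw'
    obtain ⟨a, ha⟩ := hw
    rw [ha, map_smul, smul_eq_mul, mul_div_cancel_right₀ _ hw']
  have h00 : u 0 = (l (u 0) / l (v 0)) • v 0 := by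
    refine tendsto_nhds_unique_of_eventuallyEq
      (hu.continuousAt.tendsto.mono_left nhdsWithin_le_nhds)
      ((hf.continuousAt.smul hv.continuousAt).tendsto.mono_left nhdsWithin_le_nhds) hev
  refine ⟨_, hf, fun h0 => hu0 ?_, ?_⟩
  · rw [h00, h0, zero_smul]
  · rw [eventually_nhdsWithin_iff] at hev
    filter_upwards [hev] with w hw
    by_cases hw0 : w = 0
    · rw [hw0, ← h00]
    · exact hw hw0

/-- Properties quantified over all local lifts are reduced through this to a single lift, with the
derivative given by the Leibniz rule. -/
theorem IsLiftAt.exists_smul [CompleteSpace V] {c : CP1 → Projectivization ℂ V} {p : CP1} {u v : ℂ → V}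
    (hu : IsLiftAt c p u) (hv : IsLiftAt c p v) :
    ∃ f : ℂ → ℂ, AnalyticAt ℂ f 0 ∧ f 0 ≠ 0 ∧ ∀ᶠ w in 𝓝 (0 : ℂ),
      u w = f w • v w ∧ deriv u w = deriv f w • v w + f w • deriv v w := by
  obtain ⟨f, hf, hf0, h⟩ := exists_analyticAt_smul hu.1 hv.1 hu.2.1 hv.2.1 (by
    refine Eventually.filter_mono nhdsWithin_le_nhds ?_
    filter_upwards [hu.2.2, hv.2.2, hv.1.continuousAt.eventually_ne hv.2.1] with w h1 h2 h3
    exact exists_eq_smul_of_mem h2 h3 h1)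
  refine ⟨f, hf, hf0, ?_⟩
  filter_upwards [h, h.eventually_nhds, hf.eventually_analyticAt, hv.1.eventually_analyticAt]
    with w h1 h2 h3 h4
  refine ⟨h1, ?_⟩
  rw [EventuallyEq.deriv_eq h2, add_comm]
  exact (h3.differentiableAt.hasDerivAt.smul h4.differentiableAt.hasDerivAt).deriv

theorem IsLiftAt.map {U : Type*} [NormedAddCommGroup U] [NormedSpace ℂ U]
    {c : CP1 → Projectivization ℂ V} {p : CP1} {u : ℂ → V} (hu : IsLiftAt c p u) (T : V →L[ℂ] U)
    (hT : Function.Injective T.toLinearMap) :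
    IsLiftAt (fun p => (c p).map T.toLinearMap hT) p fun w => T (u w) := by
  refine ⟨(T.analyticAt _).comp hu.1, fun h => hu.2.1 (hT (h.trans (map_zero T).symm)), ?_⟩
  filter_upwards [hu.2.2] with w hw
  generalize c (coord p w) = x at hw
  induction x using Projectivization.ind with
  | h x hx =>
    obtain ⟨a, ha⟩ := exists_eq_smul_of_mem (mem_submodule_mk hx) hx hw
    rw [ha, map_smul, Projectivization.map_mk]
    exact Submodule.smul_mem _ _ (mem_submodule_mk _)

/-! ### Independence of the choice of lift -/

section Wedge

variable {n : ℕ}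

theorem wedge_leibniz (a b : ℂ) (x y : Fin n → ℂ) :
    wedge (a • x) (b • x + a • y) = a ^ 2 • wedge x y := by
  funext i j
  simp only [wedge, Pi.smul_apply, Pi.add_apply, smul_eq_mul]
  ring

theorem analyticAt_wedge {u : ℂ → Fin n → ℂ} (hu : AnalyticAt ℂ u 0) :
    AnalyticAt ℂ (fun w => wedge (u w) (deriv u w)) 0 := by
  have h1 := analyticAt_pi_iff.1 hu
  have h2 := analyticAt_pi_iff.1 hu.deriv
  refine analyticAt_pi_iff.2 fun i => analyticAt_pi_iff.2 fun j => ?_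
  exact ((h1 i).mul (h2 j)).sub ((h1 j).mul (h2 i))

/-- Replacing `v` by `f • v` multiplies `v ∧ v'` by `f²`, a unit at `0`; so the infimum defining the
branch order runs over a constant family. -/
theorem IsLiftAt.branchOrder_eq {c : CP1 → Projectivization ℂ (Fin n → ℂ)} {p : CP1}
    {v : ℂ → Fin n → ℂ} (hv : IsLiftAt c p v) :
    branchOrder c p = analyticOrderAt (fun w => wedge (v w) (deriv v w)) 0 := by
  have key : ∀ u : {u : ℂ → (Fin n → ℂ) // IsLiftAt c p u},
      analyticOrderAt (fun w => wedge (u.1 w) (deriv u.1 w)) 0 =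
        analyticOrderAt (fun w => wedge (v w) (deriv v w)) 0 := by
    rintro ⟨u, hu⟩
    obtain ⟨f, hf, hf0, h⟩ := hu.exists_smul hv
    have e : (fun w => wedge (u w) (deriv u w)) =ᶠ[𝓝 0]
        f ^ 2 • fun w => wedge (v w) (deriv v w) := by
      filter_upwards [h] with w hw
      rw [hw.1, hw.2, wedge_leibniz]
      rfl
    rw [analyticOrderAt_congr e, analyticOrderAt_smul (hf.pow 2) (analyticAt_wedge hv.1),
      (hf.pow 2).analyticOrderAt_eq_zero.2 (pow_ne_zero 2 hf0), zero_add]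
  have : Nonempty {u : ℂ → (Fin n → ℂ) // IsLiftAt c p u} := ⟨⟨v, hv⟩⟩
  rw [branchOrder, iInf_congr key, ciInf_const]

theorem isContactCurve_of_lifts {c : CP1 → Projectivization ℂ (Fin 4 → ℂ)}
    {l : CP1 → ℂ → Fin 4 → ℂ} (hl : ∀ p, IsLiftAt c p (l p))
    (h : ∀ p, ∀ᶠ w in 𝓝 (0 : ℂ), Omega (wedge (l p w) (deriv (l p) w)) = 0) :
    IsContactCurve c := by
  intro p u hu
  obtain ⟨f, -, -, hf⟩ := hu.exists_smul (hl p)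
  filter_upwards [hf, h p] with w h1 h2
  rw [h1.1, h1.2, wedge_leibniz]
  simp only [Omega, Pi.smul_apply, smul_eq_mul] at h2 ⊢
  linear_combination f w ^ 2 * h2

theorem isSecondAssociatedCurve_of_lifts {c : CP1 → Projectivization ℂ (Fin 4 → ℂ)}
    {c₂ : CP1 → Projectivization ℂ W} {l : CP1 → ℂ → Fin 4 → ℂ} (hl : ∀ p, IsLiftAt c p (l p))
    (hc : IsHolomorphicCurve c₂) (h : ∀ p, ∀ᶠ w in 𝓝 (0 : ℂ), wedge (l p w) (deriv (l p) w) ∈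
      Submodule.map W.subtype (c₂ (coord p w)).submodule) : IsSecondAssociatedCurve c c₂ := by
  refine ⟨hc, fun p u hu => ?_⟩
  obtain ⟨f, -, -, hf⟩ := hu.exists_smul (hl p)
  filter_upwards [hf, h p] with w h1 h2
  rw [h1.1, h1.2, wedge_leibniz]
  exact Submodule.smul_mem _ _ h2

end Wedge

/-- For `u = f v`, the value `B(u', u')` contains the cross term `B(v, v')`, which is why its
vanishing is also required of the chosen lifts. -/
theorem isNullCurve_of_lifts [CompleteSpace V] {B : V → V → ℂ} {c : CP1 → Projectivization ℂ V}
    (hB : ∀ a b x y, B (a • x + b • y) (a • x + b • y) =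
      a ^ 2 * B x x + 2 * (a * b) * B x y + b ^ 2 * B y y)
    {l : CP1 → ℂ → V} (hl : ∀ p, IsLiftAt c p (l p))
    (h : ∀ p, ∀ᶠ w in 𝓝 (0 : ℂ), B (l p w) (l p w) = 0 ∧ B (l p w) (deriv (l p) w) = 0 ∧
      B (deriv (l p) w) (deriv (l p) w) = 0) : IsNullCurve B c := by
  intro p u hu
  obtain ⟨f, -, -, hf⟩ := hu.exists_smul (hl p)
  filter_upwards [hf, h p] with w h1 h2
  obtain ⟨a, b, d⟩ := h2
  rw [h1.1, h1.2, hB, a, b, d]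
  have := hB (f w) 0 (l p w) (deriv (l p) w)
  rw [zero_smul, add_zero] at this
  rw [this, a, b, d]
  simp

/-- The curve with given lifts in the two coordinate charts. -/
def curveOfCharts (h h' : ℂ → V) (h0 : ∀ z, h z ≠ 0) (h0' : h' 0 ≠ 0) :
    CP1 → Projectivization ℂ V
  | none => Projectivization.mk ℂ (h' 0) h0'
  | some z => Projectivization.mk ℂ (h z) (h0 z)

/-- The local lifts given by lifts in the two coordinate charts. -/
def chartLift (h h' : ℂ → V) : CP1 → ℂ → V
  | none => h'
  | some z => fun w => h (z + w)

omit [NormedAddCommGroup V] [NormedSpace ℂ V] in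
/-- A property of germs holds for all local lifts if it holds in the two charts. -/
theorem forall_chartLift {h h' : ℂ → V} {A : (ℂ → V) → ℂ → Prop}
    (htr : ∀ X z, A X z → A (fun w => X (z + w)) 0) (h₀ : ∀ z, A h z) (h₁ : A h' 0) (q : CP1) :
    A (chartLift h h' q) 0 := by
  induction q using OnePoint.rec with
  | infty => exact h₁
  | coe z => exact htr _ z (h₀ z)

theorem eventually_deriv_comp_add {X : ℂ → V} {z : ℂ} {A : V → V → Prop}
    (h : ∀ᶠ w in 𝓝 z, A (X w) (deriv X w)) :
    ∀ᶠ w in 𝓝 (0 : ℂ), A ((fun w => X (z + w)) w) (deriv (fun w => X (z + w)) w) := by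
  have ht : Tendsto (fun w : ℂ => z + w) (𝓝 0) (𝓝 z) := by
    have : ContinuousAt (fun w : ℂ => z + w) 0 := by fun_prop
    simpa using this.tendsto
  filter_upwards [ht.eventually h] with w hw
  rwa [deriv_comp_const_add]

variable [CompleteSpace V]

theorem isLiftAt_chartLift {h h' : ℂ → V} {h0 : ∀ z, h z ≠ 0} {h0' : h' 0 ≠ 0}
    (hd : Differentiable ℂ h) (hd' : Differentiable ℂ h') {d : ℕ}
    (e : ∀ w, w ≠ 0 → h' w = w ^ d • h w⁻¹) (p : CP1) :
    IsLiftAt (curveOfCharts h h' h0 h0') p (chartLift h h' p) := by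
  induction p using OnePoint.rec with
  | infty =>
    refine ⟨hd'.analyticAt 0, h0', Eventually.of_forall fun w => ?_⟩
    by_cases hw : w = 0
    · rw [hw, coord_infty_zero]
      exact mem_submodule_mk h0'
    · rw [coord_infty hw]
      change h' w ∈ _
      rw [e w hw]
      exact Submodule.smul_mem _ _ (mem_submodule_mk (h0 _))
  | coe z =>
    refine ⟨(hd.comp (differentiable_id.const_add z)).analyticAt 0, ?_,
      Eventually.of_forall fun w => mem_submodule_mk (h0 _)⟩
    change h (z + 0) ≠ 0
    exact h0 _

theorem isCurveOfLift_curveOfCharts {h h' : ℂ → V} {h0 : ∀ z, h z ≠ 0} {h0' : h' 0 ≠ 0}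
    (hd : Differentiable ℂ h) (hd' : Differentiable ℂ h') {d : ℕ}
    (e : ∀ w, w ≠ 0 → h' w = w ^ d • h w⁻¹) : IsCurveOfLift h (curveOfCharts h h' h0 h0') :=
  ⟨fun p => ⟨_, isLiftAt_chartLift hd hd' e p⟩, fun z _ => mem_submodule_mk (h0 z)⟩

-- The lift determines the curve on `ℂ`. Near infinity lifts of the two curves are proportional off
-- the centre, hence also at the centre.
omit [CompleteSpace V] in
theorem IsCurveOfLift.unique {h : ℂ → V} (h0 : ∀ z, h z ≠ 0) {c c' : CP1 → Projectivization ℂ V}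
    (hc : IsCurveOfLift h c) (hc' : IsCurveOfLift h c') : c = c' := by
  have hz : ∀ z : ℂ, c z = c' z := fun z => eq_of_mem_of_mem (hc.2 z (h0 z)) (hc'.2 z (h0 z)) (h0 z)
  funext p
  induction p using OnePoint.rec with
  | coe z => exact hz z
  | infty =>
    obtain ⟨u, hu⟩ := hc.1 OnePoint.infty
    obtain ⟨v, hv⟩ := hc'.1 OnePoint.infty
    obtain ⟨f, -, -, hf⟩ := exists_analyticAt_smul hu.1 hv.1 hu.2.1 hv.2.1 (by
      filter_upwards [self_mem_nhdsWithin, hu.2.2.filter_mono nhdsWithin_le_nhds,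
        hv.2.2.filter_mono nhdsWithin_le_nhds,
        (hv.1.continuousAt.eventually_ne hv.2.1).filter_mono nhdsWithin_le_nhds] with w hw h1 h2 h3
      rw [coord_infty hw] at h1 h2
      rw [hz] at h1
      exact exists_eq_smul_of_mem h2 h3 h1)
    have h1 := hu.2.2.self_of_nhds
    have h2 := hv.2.2.self_of_nhds
    rw [coord_infty_zero] at h1 h2
    refine eq_of_mem_of_mem h1 ?_ hu.2.1
    rw [hf.self_of_nhds]
    exact Submodule.smul_mem _ _ h2

end Lifts

/-! ### Algebra of the explicit curve -/

section Explicit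

/-- The explicit contact curve as a function of `z` and `y = z ^ K`. -/
def psiVec (K z y : ℂ) : Fin 4 → ℂ :=
  ![z ^ 3,
    (K - 1) * (K - 2) * (2 * K - 3) / 6 + (2 * (2 * K - 3) / (K - 3) + K * (2 * K - 3) / 2) * y - y ^ 2,
    (2 * K - 3) / 2 * z * (K - 2 + 2 * y),
    z ^ 2 * (K - 1 + y)]

/-- The derivative of `psiVec`, where `y'` is the derivative of `y`. -/
def psiVecDeriv (K z y y' : ℂ) : Fin 4 → ℂ :=
  ![3 * z ^ 2,
    (2 * (2 * K - 3) / (K - 3) + K * (2 * K - 3) / 2) * y' - 2 * y * y',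
    (2 * K - 3) / 2 * (K - 2 + 2 * y) + (2 * K - 3) * z * y',
    2 * z * (K - 1 + y) + z ^ 2 * y']

/-- The explicit null curve in the quadric of `ℂℙ⁴` as a function of `z` and `y = z ^ K`. -/
def nullVec (K z y : ℂ) : Fin 5 → ℂ :=
  ![2 * (2 * K - 3) * (K - 2) ^ 2 * z ^ 3,
    -Complex.I * (2 * K - 3) * z ^ 2 * (2 * y - (K - 1) * (K - 2)),
    (2 * K - 3) * (K - 1) / (K - 3) *
      (-((K - 3) * (K - 2) ^ 2 * (2 * K - 3) / 12) + (2 * K - 3) * (K - 2) * y + (K - 3) * y ^ 2)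
      + (K - 1) * z ^ 4,
    Complex.I * ((K - 1) * z ^ 4 - (2 * K - 3) * (K - 1) / (K - 3) *
      (-((K - 3) * (K - 2) ^ 2 * (2 * K - 3) / 12) + (2 * K - 3) * (K - 2) * y + (K - 3) * y ^ 2)),
    z * (-((K - 1) ^ 2 * (2 * K - 3) / 3) + 2 * (2 * K - 3) * (K - 1) / (K - 3) * y + y ^ 2)]

/-- The derivative of `nullVec`. -/
def nullVecDeriv (K z y y' : ℂ) : Fin 5 → ℂ :=
  ![6 * (2 * K - 3) * (K - 2) ^ 2 * z ^ 2,
    -Complex.I * (2 * K - 3) * (2 * z * (2 * y - (K - 1) * (K - 2)) + 2 * z ^ 2 * y'),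
    (2 * K - 3) * (K - 1) / (K - 3) * ((2 * K - 3) * (K - 2) * y' + (K - 3) * (2 * y * y'))
      + 4 * (K - 1) * z ^ 3,
    Complex.I * (4 * (K - 1) * z ^ 3 - (2 * K - 3) * (K - 1) / (K - 3) *
      ((2 * K - 3) * (K - 2) * y' + (K - 3) * (2 * y * y'))),
    (-((K - 1) ^ 2 * (2 * K - 3) / 3) + 2 * (2 * K - 3) * (K - 1) / (K - 3) * y + y ^ 2)
      + z * (2 * (2 * K - 3) * (K - 1) / (K - 3) * y' + 2 * y * y')]

/-- The bivector with given image in `ℂ⁵`, up to the factor `√2`. -/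
def bivector (K : ℂ) (x : Fin 5 → ℂ) : Fin 4 → Fin 4 → ℂ :=
  ![![0, -(Complex.I * x 1 / 2), x 0 / (2 * (K - 2)), (x 2 - Complex.I * x 3) / 2],
    ![Complex.I * x 1 / 2, 0, (x 2 + Complex.I * x 3) / 2, (K - 2) * x 4],
    ![-(x 0 / (2 * (K - 2))), -((x 2 + Complex.I * x 3) / 2), 0, Complex.I * x 1 / 2],
    ![-((x 2 - Complex.I * x 3) / 2), -((K - 2) * x 4), -(Complex.I * x 1 / 2), 0]]

theorem nullVec_quadric {K : ℂ} (hK : K - 3 ≠ 0) (z y : ℂ) :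
    nullVec K z y 1 ^ 2 + nullVec K z y 2 ^ 2 + nullVec K z y 3 ^ 2 =
      2 * nullVec K z y 0 * nullVec K z y 4 := by
  simp only [nullVec, Matrix.cons_val_zero, Matrix.cons_val_one, Matrix.cons_val]
  field_simp
  ring_nf
  simp only [Complex.I_sq]
  ring

/-- The exponent is eliminated by writing `y = t z⁴` and `y' = K t z³`, later with `t = z ^ (k -
4)`. This encodes `z y' = K y` without division, and the claim becomes an identity of rational
functions in `K`, `z`, `t`. -/
theorem nullVec_wronskian {K : ℂ} (hK : K - 3 ≠ 0) (z t : ℂ) (j : Fin 3) :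
    nullVecDeriv K z (t * z ^ 4) (K * (t * z ^ 3)) j.succ.castSucc * nullVec K z (t * z ^ 4) 4
      - nullVec K z (t * z ^ 4) j.succ.castSucc * nullVecDeriv K z (t * z ^ 4) (K * (t * z ^ 3)) 4
      = -(Complex.I * ((2 * K - 3) * (K - 1))) *
        isoVec (psiVec K z (t * z ^ 4) 1) (psiVec K z (t * z ^ 4) 3) j := by
  fin_cases j
  · change nullVecDeriv K z (t * z ^ 4) (K * (t * z ^ 3)) 1 * nullVec K z (t * z ^ 4) 4
      - nullVec K z (t * z ^ 4) 1 * nullVecDeriv K z (t * z ^ 4) (K * (t * z ^ 3)) 4 = _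
    simp only [nullVec, nullVecDeriv, isoVec, psiVec, Fin.zero_eta, Matrix.cons_val_zero,
      Matrix.cons_val_one, Matrix.cons_val]
    field_simp
    ring
  · change nullVecDeriv K z (t * z ^ 4) (K * (t * z ^ 3)) 2 * nullVec K z (t * z ^ 4) 4
      - nullVec K z (t * z ^ 4) 2 * nullVecDeriv K z (t * z ^ 4) (K * (t * z ^ 3)) 4 = _
    simp only [nullVec, nullVecDeriv, isoVec, psiVec, Fin.mk_one, Matrix.cons_val_zero,
      Matrix.cons_val_one, Matrix.cons_val]
    field_simp
    ring_nf
    simp only [Complex.I_sq]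
    ring
  · change nullVecDeriv K z (t * z ^ 4) (K * (t * z ^ 3)) 3 * nullVec K z (t * z ^ 4) 4
      - nullVec K z (t * z ^ 4) 3 * nullVecDeriv K z (t * z ^ 4) (K * (t * z ^ 3)) 4 = _
    simp only [nullVec, nullVecDeriv, isoVec, psiVec, Fin.reduceFinMk, Matrix.cons_val_zero,
      Matrix.cons_val_one, Matrix.cons_val]
    field_simp
    ring

/-- All six Plücker coordinates share the factor `y - 1`: this is the source of the branch points at
the roots of unity, and the remaining bivector is the second associated curve. -/
theorem wedge_psiVec {K : ℂ} (hK : K - 3 ≠ 0) (hK2 : K - 2 ≠ 0) (z t : ℂ) :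
    wedge (psiVec K z (t * z ^ 4)) (psiVecDeriv K z (t * z ^ 4) (K * (t * z ^ 3))) =
      (t * z ^ 4 - 1) • bivector K (nullVec K z (t * z ^ 4)) := by
  have h01 : wedge (psiVec K z (t * z ^ 4)) (psiVecDeriv K z (t * z ^ 4) (K * (t * z ^ 3))) 0 1 =
      (t * z ^ 4 - 1) * bivector K (nullVec K z (t * z ^ 4)) 0 1 := by
    simp only [wedge, psiVec, psiVecDeriv, bivector, nullVec, Matrix.cons_val_zero,
      Matrix.cons_val_one, Matrix.cons_val]
    field_simp
    ring_nf
    simp only [Complex.I_sq]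
    ring
  have h02 : wedge (psiVec K z (t * z ^ 4)) (psiVecDeriv K z (t * z ^ 4) (K * (t * z ^ 3))) 0 2 =
      (t * z ^ 4 - 1) * bivector K (nullVec K z (t * z ^ 4)) 0 2 := by
    simp only [wedge, psiVec, psiVecDeriv, bivector, nullVec, Matrix.cons_val_zero,
      Matrix.cons_val_one, Matrix.cons_val]
    field_simp
    ring
  have h03 : wedge (psiVec K z (t * z ^ 4)) (psiVecDeriv K z (t * z ^ 4) (K * (t * z ^ 3))) 0 3 =
      (t * z ^ 4 - 1) * bivector K (nullVec K z (t * z ^ 4)) 0 3 := by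
    simp only [wedge, psiVec, psiVecDeriv, bivector, nullVec, Matrix.cons_val_zero,
      Matrix.cons_val_one, Matrix.cons_val]
    field_simp
    ring_nf
    simp only [Complex.I_sq]
    ring
  have h12 : wedge (psiVec K z (t * z ^ 4)) (psiVecDeriv K z (t * z ^ 4) (K * (t * z ^ 3))) 1 2 =
      (t * z ^ 4 - 1) * bivector K (nullVec K z (t * z ^ 4)) 1 2 := by
    simp only [wedge, psiVec, psiVecDeriv, bivector, nullVec, Matrix.cons_val_zero,
      Matrix.cons_val_one, Matrix.cons_val]
    field_simp
    ring_nf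
    simp only [Complex.I_sq]
    ring
  have h13 : wedge (psiVec K z (t * z ^ 4)) (psiVecDeriv K z (t * z ^ 4) (K * (t * z ^ 3))) 1 3 =
      (t * z ^ 4 - 1) * bivector K (nullVec K z (t * z ^ 4)) 1 3 := by
    simp only [wedge, psiVec, psiVecDeriv, bivector, nullVec, Matrix.cons_val_zero,
      Matrix.cons_val_one, Matrix.cons_val]
    field_simp
    ring
  have h23 : wedge (psiVec K z (t * z ^ 4)) (psiVecDeriv K z (t * z ^ 4) (K * (t * z ^ 3))) 2 3 =
      (t * z ^ 4 - 1) * bivector K (nullVec K z (t * z ^ 4)) 2 3 := by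
    simp only [wedge, psiVec, psiVecDeriv, bivector, nullVec, Matrix.cons_val_zero,
      Matrix.cons_val_one, Matrix.cons_val]
    field_simp
    ring_nf
    simp only [Complex.I_sq]
    ring
  have hs : ∀ (x y : Fin 4 → ℂ) (i j : Fin 4), wedge x y i j = -wedge x y j i := by
    intro x y i j
    simp only [wedge]
    ring
  have hb : ∀ (x : Fin 5 → ℂ) (i j : Fin 4), bivector K x i j = -bivector K x j i := by
    intro x i j
    fin_cases i <;> fin_cases j <;> simp [bivector]
  have hd : ∀ x y (i : Fin 4), wedge x y i i = 0 := fun x y i => by simp only [wedge]; ring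
  have hbd : ∀ x (i : Fin 4), bivector K x i i = 0 := fun x i => by
    fin_cases i <;> simp [bivector]
  have key : ∀ i j : Fin 4, i < j → wedge (psiVec K z (t * z ^ 4))
      (psiVecDeriv K z (t * z ^ 4) (K * (t * z ^ 3))) i j =
      (t * z ^ 4 - 1) * bivector K (nullVec K z (t * z ^ 4)) i j := by
    intro i j hij
    fin_cases i <;> fin_cases j <;> first | exact absurd hij (by decide) | assumption
  funext i j
  rw [Pi.smul_apply, Pi.smul_apply, smul_eq_mul]
  rcases lt_trichotomy i j with h | h | h
  · exact key i j h
  · rw [h, hd, hbd, mul_zero]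
  · rw [hs, hb, key j i h, mul_neg]

end Explicit

/-! ### The isometry with `ℂ⁵` and the polynomials of the explicit curve -/

section Isometry

theorem bivector_mem {K : ℂ} (x : Fin 5 → ℂ) : bivector K x ∈ W := by
  refine ⟨fun i j => ?_, ?_⟩
  · fin_cases i <;> fin_cases j <;> simp [bivector]
  · simp [Omega, bivector]

/-- The isometry `W → ℂ⁵`, for `s ^ 2 = 1 / 2`. -/
def kleinEquiv {K s : ℂ} (hK : K - 2 ≠ 0) (hs : s ≠ 0) : W ≃ₗ[ℂ] (Fin 5 → ℂ) where
  toFun η := s • ![2 * (K - 2) * η.1 0 2, -2 * Complex.I * η.1 2 3, η.1 1 2 + η.1 0 3,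
    Complex.I * (η.1 0 3 - η.1 1 2), (K - 2)⁻¹ * η.1 1 3]
  map_add' η ξ := by
    funext i
    fin_cases i <;> simp <;> ring
  map_smul' c η := by
    funext i
    fin_cases i <;> simp <;> ring
  invFun x := ⟨bivector K (s⁻¹ • x), bivector_mem _⟩
  left_inv η := by
    obtain ⟨η, h, h0⟩ := η
    have h0' : η 0 1 = -η 2 3 := eq_neg_of_add_eq_zero_left h0
    have hd : ∀ i, η i i = 0 := fun i => self_eq_neg.1 (h i i)
    have h12 : (η 1 2 + η 0 3 - Complex.I * (Complex.I * (η 0 3 - η 1 2))) / 2 = η 0 3 := by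
      linear_combination (-(η 0 3 - η 1 2) / 2) * Complex.I_sq
    have h03 : (η 1 2 + η 0 3 + Complex.I * (Complex.I * (η 0 3 - η 1 2))) / 2 = η 1 2 := by
      linear_combination ((η 0 3 - η 1 2) / 2) * Complex.I_sq
    have h23 : Complex.I * (-2 * Complex.I * η 2 3) / 2 = η 2 3 := by
      linear_combination (-η 2 3) * Complex.I_sq
    have h02 : 2 * (K - 2) * η 0 2 / (2 * (K - 2)) = η 0 2 := by field_simp
    have h13 : (K - 2) * ((K - 2)⁻¹ * η 1 3) = η 1 3 := by field_simp
    apply Subtype.ext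
    funext i j
    simp only [smul_smul, inv_mul_cancel₀ hs, one_smul, bivector]
    fin_cases i <;> fin_cases j <;>
      simp only [Fin.zero_eta, Fin.mk_one, Fin.reduceFinMk, Matrix.cons_val_zero,
        Matrix.cons_val_one, Matrix.cons_val, h12, h03, h23, h02, h13, hd, h0'] <;>
      first | rfl | exact (h _ _).symm | rw [h 1 0, h0', neg_neg]
  right_inv x := by
    funext i
    fin_cases i <;> simp [bivector] <;> field_simp <;> ring_nf <;> simp

theorem kleinEquiv_symm_apply {K s : ℂ} (hK : K - 2 ≠ 0) (hs : s ≠ 0) (x : Fin 5 → ℂ) :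
    ((kleinEquiv hK hs).symm x).1 = s⁻¹ • bivector K x := by
  change bivector K (s⁻¹ • x) = _
  funext i j
  fin_cases i <;> fin_cases j <;> simp [bivector] <;> ring

/-- On `W` the coordinate `η 0 1` equals `-η 2 3`; after this elimination the unscaled map doubles
the form, and `s ^ 2 = 1 / 2` compensates. -/
theorem form5_kleinEquiv {K s : ℂ} (hK : K - 2 ≠ 0) (hs : s ≠ 0) (h2 : s ^ 2 = 1 / 2) (η ξ : W) :
    form5 (kleinEquiv hK hs η) (kleinEquiv hK hs ξ) = kleinForm η ξ := by
  have e1 : η.1 0 1 = -η.1 2 3 := eq_neg_of_add_eq_zero_left η.2.2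
  have e2 : ξ.1 0 1 = -ξ.1 2 3 := eq_neg_of_add_eq_zero_left ξ.2.2
  simp only [form5, kleinForm, kleinEquiv, LinearEquiv.coe_mk, LinearMap.coe_mk, AddHom.coe_mk,
    Pi.smul_apply, smul_eq_mul, Matrix.cons_val_zero, Matrix.cons_val_one, Matrix.cons_val, e1, e2]
  field_simp
  ring_nf
  simp only [Complex.I_sq, h2]
  ring

end Isometry

/-! ### Polynomial components and their reversal at infinity -/

section Polynomials

open Polynomial

/-- The value at `w` of the polynomial `w ^ d p(1 / w)`. -/
def revEval (d : ℕ) (p : ℂ[X]) (w : ℂ) : ℂ := (p.reflect d).eval w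

theorem revEval_eq {d : ℕ} {p : ℂ[X]} (hp : p.natDegree ≤ d) {w : ℂ} (hw : w ≠ 0) :
    revEval d p w = w ^ d * p.eval w⁻¹ := by
  let _ := invertibleOfNonzero (inv_ne_zero hw)
  have h := eval₂_reflect_mul_pow (RingHom.id ℂ) w⁻¹ d p hp
  have e : (⅟(w⁻¹) : ℂ) = w := by rw [invOf_eq_inv, inv_inv]
  rw [e] at h
  rw [revEval, eval, eval, ← h, inv_pow]
  field_simp

theorem revEval_zero {d : ℕ} (p : ℂ[X]) : revEval d p 0 = p.coeff d := by
  rw [revEval, ← coeff_zero_eq_eval_zero, coeff_reflect, revAt_le (Nat.zero_le d), Nat.sub_zero]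

theorem differentiable_revEval (d : ℕ) (p : ℂ[X]) : Differentiable ℂ (revEval d p) :=
  (p.reflect d).differentiable

/-- The components of the explicit contact curve. -/
def psiPoly (k : ℕ) : Fin 4 → ℂ[X] :=
  ![C 1 * X ^ 3,
    C (((k : ℂ) - 1) * (k - 2) * (2 * k - 3) / 6) * X ^ 0
      + C (2 * (2 * (k : ℂ) - 3) / (k - 3) + k * (2 * k - 3) / 2) * X ^ k + C (-1) * X ^ (2 * k),
    C ((2 * (k : ℂ) - 3) / 2 * (k - 2)) * X ^ 1 + C (2 * (k : ℂ) - 3) * X ^ (k + 1),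
    C ((k : ℂ) - 1) * X ^ 2 + C 1 * X ^ (k + 2)]

/-- The components of the explicit null curve. -/
def nullPoly (k : ℕ) : Fin 5 → ℂ[X] :=
  ![C (2 * (2 * (k : ℂ) - 3) * (k - 2) ^ 2) * X ^ 3,
    C (-(2 * Complex.I * (2 * (k : ℂ) - 3))) * X ^ (k + 2)
      + C (Complex.I * (2 * (k : ℂ) - 3) * ((k - 1) * (k - 2))) * X ^ 2,
    C (-((2 * (k : ℂ) - 3) * (k - 1) / (k - 3) * ((k - 3) * (k - 2) ^ 2 * (2 * k - 3) / 12))) * X ^ 0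
      + C ((2 * (k : ℂ) - 3) * (k - 1) / (k - 3) * ((2 * k - 3) * (k - 2))) * X ^ k
      + C ((2 * (k : ℂ) - 3) * (k - 1) / (k - 3) * (k - 3)) * X ^ (2 * k)
      + C ((k : ℂ) - 1) * X ^ 4,
    C (Complex.I * ((2 * (k : ℂ) - 3) * (k - 1) / (k - 3) *
        ((k - 3) * (k - 2) ^ 2 * (2 * k - 3) / 12))) * X ^ 0
      + C (-(Complex.I * ((2 * (k : ℂ) - 3) * (k - 1) / (k - 3) * ((2 * k - 3) * (k - 2))))) * X ^ k
      + C (-(Complex.I * ((2 * (k : ℂ) - 3) * (k - 1) / (k - 3) * (k - 3)))) * X ^ (2 * k)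
      + C (Complex.I * ((k : ℂ) - 1)) * X ^ 4,
    C (-(((k : ℂ) - 1) ^ 2 * (2 * k - 3) / 3)) * X ^ 1
      + C (2 * (2 * (k : ℂ) - 3) * (k - 1) / (k - 3)) * X ^ (k + 1) + C 1 * X ^ (2 * k + 1)]

theorem eval_psiPoly (k : ℕ) (z : ℂ) (i : Fin 4) :
    (psiPoly k i).eval z = psiVec k z (z ^ k) i := by
  fin_cases i <;> simp only [psiPoly, psiVec, Fin.zero_eta, Fin.mk_one, Fin.reduceFinMk,
    Matrix.cons_val_zero, Matrix.cons_val_one, Matrix.cons_val, eval_add, eval_mul, eval_C, eval_pow,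
    eval_X] <;> ring

theorem eval_nullPoly (k : ℕ) (z : ℂ) (i : Fin 5) :
    (nullPoly k i).eval z = nullVec k z (z ^ k) i := by
  fin_cases i <;> simp only [nullPoly, nullVec, Fin.zero_eta, Fin.mk_one, Fin.reduceFinMk,
    Matrix.cons_val_zero, Matrix.cons_val_one, Matrix.cons_val, eval_add, eval_mul, eval_C, eval_pow,
    eval_X] <;> ring

theorem psiLift_eq (k : ℕ) (z : ℂ) : psiLift k z = psiVec k z (z ^ k) := by
  have e : (-3 + k : ℂ) = k - 3 := by ring
  funext i
  fin_cases i <;> simp only [psiLift, psiVec, e, Fin.zero_eta, Fin.mk_one, Fin.reduceFinMk,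
    Matrix.cons_val_zero, Matrix.cons_val_one, Matrix.cons_val] <;> ring

theorem natDegree_psiPoly_le {k : ℕ} (hk : 4 ≤ k) (i : Fin 4) :
    (psiPoly k i).natDegree ≤ 2 * k := by
  fin_cases i <;> simp only [psiPoly, Fin.zero_eta, Fin.mk_one, Fin.reduceFinMk,
    Matrix.cons_val_zero, Matrix.cons_val_one, Matrix.cons_val] <;> compute_degree <;> omega

theorem natDegree_nullPoly_le {k : ℕ} (hk : 4 ≤ k) (i : Fin 5) :
    (nullPoly k i).natDegree ≤ 2 * k + 1 := by
  fin_cases i <;> simp only [nullPoly, Fin.zero_eta, Fin.mk_one, Fin.reduceFinMk,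
    Matrix.cons_val_zero, Matrix.cons_val_one, Matrix.cons_val] <;> compute_degree <;> omega

theorem coeff_psiPoly_one {k : ℕ} (hk : 4 ≤ k) : (psiPoly k 1).coeff (2 * k) = -1 := by
  have h1 : 2 * k ≠ k := by omega
  have h0 : 2 * k ≠ 0 := by omega
  simp only [psiPoly, Matrix.cons_val_one, Matrix.cons_val_zero, coeff_add, coeff_C_mul_X_pow,
    if_neg h0, if_neg h1, if_true, zero_add]

theorem coeff_nullPoly_four {k : ℕ} (hk : 4 ≤ k) : (nullPoly k 4).coeff (2 * k + 1) = 1 := by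
  have h1 : 2 * k + 1 ≠ k + 1 := by omega
  have h0 : 2 * k + 1 ≠ 1 := by omega
  simp only [nullPoly, Matrix.cons_val, coeff_add, coeff_C_mul_X_pow,
    if_neg h0, if_neg h1, if_true, zero_add]

end Polynomials

/-! ### Null curves as curves in the quadric -/

namespace NullData

variable {p : Fin 5 → ℂ → ℂ} {P Q : ℂ → ℂ} {κ : ℂ} (h : NullData p P Q κ)
include h

theorem deriv_vec (z : ℂ) : deriv (fun z j => p j z) z = fun j => deriv (p j) z :=
  deriv_pi fun j => h.differentiable j z

/-- The Plücker coordinates with first index `4` are the Wronskians, which are a nonzero constant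
times `isoVec`. So the null curve is unbranched, and in particular its lift has no zeros. -/
theorem wedge_ne_zero (z : ℂ) : wedge (fun j => p j z) (deriv (fun z j => p j z) z) ≠ 0 := by
  intro h0
  obtain ⟨j, hj⟩ := h.exists_isoVec_ne_zero z
  have h1 := congrFun (congrFun h0 4) j.succ.castSucc
  rw [h.deriv_vec] at h1
  have h2 := h.wronskian z j
  simp only [wedge, Pi.zero_apply] at h1
  refine mul_ne_zero h.const_ne_zero hj ?_
  rw [← h2]
  linear_combination h1

theorem vec_ne_zero (z : ℂ) : (fun j => p j z) ≠ 0 := by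
  intro h0
  refine h.wedge_ne_zero z ?_
  rw [h0]
  funext i j
  simp [wedge]

theorem form5_self (z : ℂ) : form5 (fun j => p j z) (fun j => p j z) = 0 := by
  have := h.quadric z
  simp only [form5]
  linear_combination this

theorem form5_deriv (z : ℂ) : form5 (fun j => p j z) (deriv (fun z j => p j z) z) = 0 := by
  have hd := fun j => h.hasDerivAt_coord j z
  have h1 := (((hd 1).pow 2).add ((hd 2).pow 2)).add ((hd 3).pow 2)
  have h2 := ((hd 0).const_mul 2).mul (hd 4)
  have h3 := h1.unique (h2.congr_of_eventuallyEq (Filter.Eventually.of_forall fun w => h.quadric w))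
  rw [h.deriv_vec]
  simp only [form5]
  simp only [Nat.cast_ofNat, Nat.add_one_sub_one, pow_one] at h3
  linear_combination h3 / 2

/-- The squares of the three Wronskians sum to zero because `isoVec` is isotropic. Modulo the
quadric and its derivative this sum is `p₄²` times the claimed expression; the zeros of `p 4` are
covered by density. -/
theorem form5_deriv_deriv (z : ℂ) :
    form5 (deriv (fun z j => p j z) z) (deriv (fun z j => p j z) z) = 0 := by
  have hc : ∀ j, Continuous (deriv (p j)) := fun j =>
    ((h.differentiable j).contDiff (n := 1)).continuous_deriv_one
  simp only [h.deriv_vec]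
  refine congrFun (Continuous.ext_on h.dense_setOf_ne (f := fun z =>
    form5 (fun j => deriv (p j) z) fun j => deriv (p j) z) (g := fun _ => 0) ?_ continuous_const ?_) z
  · simp only [form5]
    fun_prop
  · intro w hw
    have h0 := h.wronskian w 0
    have h1 := h.wronskian w 1
    have h2 := h.wronskian w 2
    have hq := h.quadric w
    have hd := h.form5_deriv w
    rw [h.deriv_vec] at hd
    have hi := isoVec_isotropic (P w) (Q w)
    change deriv (p 1) w * p 4 w - p 1 w * deriv (p 4) w = _ at h0
    change deriv (p 2) w * p 4 w - p 2 w * deriv (p 4) w = _ at h1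
    change deriv (p 3) w * p 4 w - p 3 w * deriv (p 4) w = _ at h2
    simp only [form5] at hd ⊢
    refine mul_left_cancel₀ (pow_ne_zero 2 hw) ?_
    have hs : (deriv (p 1) w * p 4 w - p 1 w * deriv (p 4) w) ^ 2
        + (deriv (p 2) w * p 4 w - p 2 w * deriv (p 4) w) ^ 2
        + (deriv (p 3) w * p 4 w - p 3 w * deriv (p 4) w) ^ 2 = 0 := by
      rw [h0, h1, h2]
      linear_combination κ ^ 2 * hi
    linear_combination hs + 2 * p 4 w * deriv (p 4) w * hd - deriv (p 4) w ^ 2 * hq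

end NullData

/-! ### The explicit null curve -/

section ExplicitNullCurve

open Polynomial

variable {k : ℕ} (hk : 4 ≤ k)
include hk

theorem natCast_sub_ne_zero {m : ℕ} (hm : m < 4) : (k : ℂ) - m ≠ 0 := by
  rw [sub_ne_zero]
  exact_mod_cast (show k ≠ m by omega)

theorem two_mul_sub_three_ne_zero : 2 * (k : ℂ) - 3 ≠ 0 := by
  rw [sub_ne_zero]
  exact_mod_cast (show 2 * k ≠ 3 by omega)

theorem eval_derivative_nullPoly (z : ℂ) (j : Fin 5) : (derivative (nullPoly k j)).eval z =
    nullVecDeriv k z (z ^ (k - 4) * z ^ 4) (k * (z ^ (k - 4) * z ^ 3)) j := by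
  obtain ⟨n, rfl⟩ := Nat.exists_eq_add_of_le' hk
  have h1 : 2 * (n + 4) - 1 = 2 * n + 7 := by omega
  have h2 : n + 4 - 1 = n + 3 := by omega
  have h3 : n + 4 + 1 - 1 = n + 4 := by omega
  have h4 : n + 4 + 2 - 1 = n + 5 := by omega
  have h5 : 2 * (n + 4) + 1 - 1 = 2 * n + 8 := by omega
  fin_cases j <;> simp only [nullPoly, nullVecDeriv, Fin.zero_eta, Fin.mk_one, Fin.reduceFinMk,
    Matrix.cons_val_zero, Matrix.cons_val_one, Matrix.cons_val, derivative_add,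
    derivative_C_mul_X_pow, eval_add, eval_mul, eval_C, eval_pow, eval_X, h1, h2, h3, h4, h5,
    Nat.add_sub_cancel] <;> push_cast <;> ring

theorem eval_derivative_psiPoly (z : ℂ) (j : Fin 4) : (derivative (psiPoly k j)).eval z =
    psiVecDeriv k z (z ^ (k - 4) * z ^ 4) (k * (z ^ (k - 4) * z ^ 3)) j := by
  obtain ⟨n, rfl⟩ := Nat.exists_eq_add_of_le' hk
  have h1 : 2 * (n + 4) - 1 = 2 * n + 7 := by omega
  have h2 : n + 4 - 1 = n + 3 := by omega
  have h3 : n + 4 + 1 - 1 = n + 4 := by omega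
  have h4 : n + 4 + 2 - 1 = n + 5 := by omega
  fin_cases j <;> simp only [psiPoly, psiVecDeriv, Fin.zero_eta, Fin.mk_one, Fin.reduceFinMk,
    Matrix.cons_val_zero, Matrix.cons_val_one, Matrix.cons_val, derivative_add,
    derivative_C_mul_X_pow, eval_add, eval_mul, eval_C, eval_pow, eval_X, h1, h2, h3, h4,
    Nat.add_sub_cancel] <;> push_cast <;> ring

theorem pow_eq_pow_sub_mul (z : ℂ) : z ^ k = z ^ (k - 4) * z ^ 4 := by
  rw [← pow_add, Nat.sub_add_cancel hk]

/-- The spinor has no zeros: `Q = z² (k - 1 + z ^ k)`, and `P` is a nonzero constant at `z = 0` and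
a negative real number where `z ^ k = 1 - k`. -/
theorem psiVec_one_ne_zero {z : ℂ} (h : (psiPoly k 3).eval z = 0) : (psiPoly k 1).eval z ≠ 0 := by
  have h1 : (k : ℂ) - 1 ≠ 0 := by exact_mod_cast natCast_sub_ne_zero hk (m := 1) (by norm_num)
  have h2 : (k : ℂ) - 2 ≠ 0 := natCast_sub_ne_zero hk (m := 2) (by norm_num)
  have h3 : (k : ℂ) - 3 ≠ 0 := natCast_sub_ne_zero hk (m := 3) (by norm_num)
  have h4 := two_mul_sub_three_ne_zero hk
  rw [eval_psiPoly] at h ⊢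
  rcases mul_eq_zero.1 (show z ^ 2 * ((k : ℂ) - 1 + z ^ k) = 0 from h) with h | h
  · have hz : z = 0 := by simpa using h
    simp only [hz, psiVec, Matrix.cons_val_one, Matrix.cons_val_zero,
      zero_pow (show k ≠ 0 by omega)]
    have : (k - 1 : ℂ) * (k - 2) * (2 * k - 3) ≠ 0 := mul_ne_zero (mul_ne_zero h1 h2) h4
    simpa using this
  · have hy : z ^ k = -((k : ℂ) - 1) := eq_neg_of_add_eq_zero_right h
    simp only [hy, psiVec, Matrix.cons_val_one, Matrix.cons_val_zero]
    intro h0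
    field_simp at h0
    obtain ⟨n, rfl⟩ := Nat.exists_eq_add_of_le' hk
    -- With `k = n + 4`, clearing denominators turns the assumed equation into the vanishing of this
    -- sum of positive terms, up to the factor `-2`.
    have hn : (((n + 3) * ((2 * n + 5) * (n + 1) * (2 * n + 10) + 12 * (2 * n + 5)
        + 6 * (n + 1) * (n + 3)) : ℕ) : ℂ) ≠ 0 := by
      exact_mod_cast (by positivity : ((n + 3) * ((2 * n + 5) * (n + 1) * (2 * n + 10)
        + 12 * (2 * n + 5) + 6 * (n + 1) * (n + 3))) ≠ 0)
    apply hn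
    push_cast at h0 ⊢
    linear_combination (-1 / 2) * h0

theorem nullData_explicit : NullData (fun j z => (nullPoly k j).eval z)
    (fun z => (psiPoly k 1).eval z) (fun z => (psiPoly k 3).eval z)
    (-(Complex.I * ((2 * k - 3) * (k - 1)))) := by
  have h1 : (k : ℂ) - 1 ≠ 0 := by exact_mod_cast natCast_sub_ne_zero hk (m := 1) (by norm_num)
  have h3 : (k : ℂ) - 3 ≠ 0 := natCast_sub_ne_zero hk (m := 3) (by norm_num)
  refine ⟨fun j => (nullPoly k j).differentiable, (psiPoly k 1).differentiable,
    (psiPoly k 3).differentiable, fun z => ?_, fun z j => ?_, fun z => ?_, ?_⟩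
  · simp only [eval_nullPoly]
    exact nullVec_quadric h3 _ _
  · have := nullVec_wronskian h3 z (z ^ (k - 4)) j
    simp only [Polynomial.deriv, eval_derivative_nullPoly hk]
    simp only [eval_nullPoly, eval_psiPoly]
    rwa [pow_eq_pow_sub_mul hk z]
  · by_cases h : (psiPoly k 3).eval z = 0
    · exact Or.inl (psiVec_one_ne_zero hk h)
    · exact Or.inr h
  · exact neg_ne_zero.2 (mul_ne_zero Complex.I_ne_zero
      (mul_ne_zero (two_mul_sub_three_ne_zero hk) h1))

theorem nullData_explicit_reverse : NullData (fun j => revEval (2 * k + 1) (nullPoly k j))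
    (revEval (2 * k) (psiPoly k 1)) (revEval (2 * k) (psiPoly k 3))
    (-(-(Complex.I * ((2 * k - 3) * (k - 1))))) := by
  refine (nullData_explicit hk).reverse (d := 2 * k) (fun j => differentiable_revEval _ _)
    (differentiable_revEval _ _) (differentiable_revEval _ _)
    (fun j w hw => revEval_eq (natDegree_nullPoly_le hk j) hw)
    (fun w hw => revEval_eq (natDegree_psiPoly_le hk 1) hw)
    (fun w hw => revEval_eq (natDegree_psiPoly_le hk 3) hw) (Or.inl ?_)
  rw [revEval_zero, coeff_psiPoly_one hk]
  exact neg_ne_zero.2 one_ne_zero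

end ExplicitNullCurve

/-! ### The explicit contact curve -/

section ExplicitCurve

open Polynomial Filter

/-- `bivector` as a continuous linear map. -/
def bivectorCLM (K : ℂ) : (Fin 5 → ℂ) →L[ℂ] (Fin 4 → Fin 4 → ℂ) :=
  LinearMap.toContinuousLinearMap
    { toFun := bivector K
      map_add' := fun x y => by
        funext i j
        fin_cases i <;> fin_cases j <;> simp [bivector] <;> ring
      map_smul' := fun c x => by
        funext i j
        fin_cases i <;> fin_cases j <;> simp [bivector] <;> ring }

theorem bivector_ne_zero {K : ℂ} (hK : K - 2 ≠ 0) {x : Fin 5 → ℂ} (hx : x ≠ 0) :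
    bivector K x ≠ 0 := by
  intro h
  have h1 := kleinEquiv_symm_apply hK one_ne_zero x
  rw [h, smul_zero] at h1
  have h2 : (kleinEquiv hK one_ne_zero).symm x = 0 := Subtype.ext h1
  exact hx ((LinearEquiv.map_eq_zero_iff _).1 h2)

theorem wedge_smul_add {n : ℕ} (a b c : ℂ) (x y : Fin n → ℂ) :
    wedge (c • x) (b • x + a • y) = (c * a) • wedge x y := by
  funext i j
  simp only [wedge, Pi.smul_apply, Pi.add_apply, smul_eq_mul]
  ring

/-- The vector with the given polynomial components. -/
def polyVec {n : ℕ} (p : Fin n → ℂ[X]) (z : ℂ) : Fin n → ℂ := fun i => (p i).eval z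

/-- The vector of the reversed polynomials. -/
def polyRev {n : ℕ} (d : ℕ) (p : Fin n → ℂ[X]) (w : ℂ) : Fin n → ℂ := fun i => revEval d (p i) w

section PolyVec

variable {n d : ℕ} {p : Fin n → ℂ[X]}

theorem differentiable_polyVec : Differentiable ℂ (polyVec p) :=
  differentiable_pi.2 fun i => (p i).differentiable

theorem differentiable_polyRev : Differentiable ℂ (polyRev d p) :=
  differentiable_pi.2 fun i => differentiable_revEval d (p i)

theorem deriv_polyVec (z : ℂ) : deriv (polyVec p) z = fun i => (derivative (p i)).eval z :=
  (hasDerivAt_pi.2 fun i => (p i).hasDerivAt z).deriv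

theorem polyRev_eq (h : ∀ i, (p i).natDegree ≤ d) (w : ℂ) (hw : w ≠ 0) :
    polyRev d p w = w ^ d • polyVec p w⁻¹ :=
  funext fun i => revEval_eq (h i) hw

theorem polyRev_zero : polyRev d p 0 = fun i => (p i).coeff d :=
  funext fun i => revEval_zero (p i)

theorem deriv_polyRev (h : ∀ i, (p i).natDegree ≤ d) {w : ℂ} (hw : w ≠ 0) :
    deriv (polyRev d p) w = (d * w ^ (d - 1)) • polyVec p w⁻¹
      + (w ^ d * -(w ^ 2)⁻¹) • deriv (polyVec p) w⁻¹ := by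
  have e : polyRev d p =ᶠ[𝓝 w] fun w => w ^ d • polyVec p w⁻¹ :=
    (eventually_ne_nhds hw).mono fun w hw => polyRev_eq h w hw
  have h1 := (hasDerivAt_pow d w).smul
    ((differentiable_polyVec (p := p) w⁻¹).hasDerivAt.scomp w (hasDerivAt_inv hw))
  rw [e.deriv_eq, mul_smul (w ^ d), add_comm]
  exact h1.deriv

theorem continuous_wedge_polyRev :
    Continuous fun w => wedge (polyRev d p w) (deriv (polyRev d p) w) := by
  have e : deriv (polyRev d p) = polyVec fun i => derivative ((p i).reflect d) := by
    funext w
    exact deriv_polyVec (p := fun i => (p i).reflect d) w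
  rw [e]
  have h1 := fun i => continuous_pi_iff.1 (differentiable_polyRev (d := d) (p := p)).continuous i
  have h2 := fun i => continuous_pi_iff.1
    (differentiable_polyVec (p := fun i => derivative ((p i).reflect d))).continuous i
  exact continuous_pi fun i => continuous_pi fun j => ((h1 i).mul (h2 j)).sub ((h1 j).mul (h2 i))

end PolyVec

variable {k : ℕ} (hk : 4 ≤ k)
include hk

theorem wedge_polyVec_psiPoly (z : ℂ) :
    wedge (polyVec (psiPoly k) z) (deriv (polyVec (psiPoly k)) z) =
      (z ^ k - 1) • bivector k (polyVec (nullPoly k) z) := by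
  have h2 : (k : ℂ) - 2 ≠ 0 := natCast_sub_ne_zero hk (m := 2) (by norm_num)
  have h3 : (k : ℂ) - 3 ≠ 0 := natCast_sub_ne_zero hk (m := 3) (by norm_num)
  have e1 : polyVec (psiPoly k) z = psiVec k z (z ^ (k - 4) * z ^ 4) := by
    rw [← pow_eq_pow_sub_mul hk]
    exact funext (eval_psiPoly k z)
  have e2 : polyVec (nullPoly k) z = nullVec k z (z ^ (k - 4) * z ^ 4) := by
    rw [← pow_eq_pow_sub_mul hk]
    exact funext (eval_nullPoly k z)
  rw [deriv_polyVec, funext (eval_derivative_psiPoly hk z), e1, e2, wedge_psiVec h3 h2,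
    pow_eq_pow_sub_mul hk]

/-- Count exponents for `w ≠ 0`: reversal contributes `w ^ (4 k)`, the derivative of `1 / w`
contributes `-w⁻²`, the factor `z ^ k - 1` becomes `w⁻ᵏ (1 - w ^ k)`, and the reversed null vector
takes `w ^ (2 k + 1)`. What is left is `4 k - 2 - k - (2 k + 1) = k - 3`. Continuity covers `w = 0`.
-/
theorem wedge_polyRev_psiPoly (w : ℂ) :
    wedge (polyRev (2 * k) (psiPoly k) w) (deriv (polyRev (2 * k) (psiPoly k)) w) =
      (-(w ^ (k - 3) * (1 - w ^ k))) • bivector k (polyRev (2 * k + 1) (nullPoly k) w) := by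
  refine congrFun (Continuous.ext_on (dense_compl_singleton (0 : ℂ)) continuous_wedge_polyRev
    (g := fun w => (-(w ^ (k - 3) * (1 - w ^ k))) •
      bivector k (polyRev (2 * k + 1) (nullPoly k) w)) ?_ ?_) w
  · exact Continuous.smul (f := fun w : ℂ => -(w ^ (k - 3) * (1 - w ^ k))) (by fun_prop)
      ((bivectorCLM k).continuous.comp differentiable_polyRev.continuous)
  · intro w hw
    have hw : w ≠ 0 := hw
    have hb : bivector k (w ^ (2 * k + 1) • polyVec (nullPoly k) w⁻¹) =
        w ^ (2 * k + 1) • bivector k (polyVec (nullPoly k) w⁻¹) := (bivectorCLM k).map_smul _ _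
    simp only [deriv_polyRev (natDegree_psiPoly_le hk) hw,
      polyRev_eq (natDegree_psiPoly_le hk) w hw, polyRev_eq (natDegree_nullPoly_le hk) w hw,
      wedge_smul_add, wedge_polyVec_psiPoly hk, hb, smul_smul]
    congr 1
    obtain ⟨n, rfl⟩ := Nat.exists_eq_add_of_le' hk
    rw [show n + 4 - 3 = n + 1 by omega, inv_pow]
    field_simp
    ring

theorem polyVec_psiPoly_ne_zero (z : ℂ) : polyVec (psiPoly k) z ≠ 0 := by
  intro h
  exact psiVec_one_ne_zero hk (congrFun h 3) (congrFun h 1)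

theorem polyRev_psiPoly_ne_zero : polyRev (2 * k) (psiPoly k) 0 ≠ 0 := by
  intro h
  have h1 : (psiPoly k 1).coeff (2 * k) = 0 := (congrFun polyRev_zero 1).symm.trans (congrFun h 1)
  rw [coeff_psiPoly_one hk] at h1
  exact neg_ne_zero.2 one_ne_zero h1

/-- The explicit contact curve. -/
def psiCurve : CP1 → Projectivization ℂ (Fin 4 → ℂ) :=
  curveOfCharts (polyVec (psiPoly k)) (polyRev (2 * k) (psiPoly k)) (polyVec_psiPoly_ne_zero hk)
    (polyRev_psiPoly_ne_zero hk)

omit hk in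
theorem psiLift_eq_polyVec : psiLift k = polyVec (psiPoly k) := by
  funext z i
  rw [psiLift_eq]
  exact (eval_psiPoly k z i).symm

theorem isCurveOfLift_psiCurve : IsCurveOfLift (psiLift k) (psiCurve hk) := by
  rw [psiLift_eq_polyVec]
  exact isCurveOfLift_curveOfCharts differentiable_polyVec differentiable_polyRev
    (polyRev_eq (natDegree_psiPoly_le hk))

theorem eq_psiCurve {ψ : CP1 → Projectivization ℂ (Fin 4 → ℂ)} (h : IsCurveOfLift (psiLift k) ψ) :
    ψ = psiCurve hk := by
  refine h.unique (fun z => ?_) (isCurveOfLift_psiCurve hk)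
  rw [psiLift_eq_polyVec]
  exact polyVec_psiPoly_ne_zero hk z

theorem isLiftAt_psiCurve (p : CP1) : IsLiftAt (psiCurve hk) p
    (chartLift (polyVec (psiPoly k)) (polyRev (2 * k) (psiPoly k)) p) :=
  isLiftAt_chartLift differentiable_polyVec differentiable_polyRev
    (polyRev_eq (natDegree_psiPoly_le hk)) p

theorem exists_wedge_chartLift (p : CP1) : ∃ g : ℂ → ℂ, ∀ w,
    wedge (chartLift (polyVec (psiPoly k)) (polyRev (2 * k) (psiPoly k)) p w)
      (deriv (chartLift (polyVec (psiPoly k)) (polyRev (2 * k) (psiPoly k)) p) w) =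
      g w • bivector k (chartLift (polyVec (nullPoly k)) (polyRev (2 * k + 1) (nullPoly k)) p w) := by
  induction p using OnePoint.rec with
  | infty => exact ⟨_, wedge_polyRev_psiPoly hk⟩
  | coe z =>
    refine ⟨fun w => (z + w) ^ k - 1, fun w => ?_⟩
    change wedge (polyVec (psiPoly k) (z + w)) (deriv (fun w => polyVec (psiPoly k) (z + w)) w) = _
    rw [deriv_comp_const_add, wedge_polyVec_psiPoly hk]
    rfl

theorem isContactCurve_psiCurve : IsContactCurve (psiCurve hk) := by
  refine isContactCurve_of_lifts (isLiftAt_psiCurve hk) fun p => Eventually.of_forall fun w => ?_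
  obtain ⟨g, hg⟩ := exists_wedge_chartLift hk p
  rw [hg]
  simp [Omega, bivector]

theorem hasDegree_psiCurve : HasDegree (psiCurve hk) (2 * k) := by
  refine ⟨psiPoly k, natDegree_psiPoly_le hk, fun z => ⟨polyVec_psiPoly_ne_zero hk z,
    mem_submodule_mk (polyVec_psiPoly_ne_zero hk z)⟩, ?_⟩
  rw [← polyRev_zero]
  exact ⟨polyRev_psiPoly_ne_zero hk, mem_submodule_mk (polyRev_psiPoly_ne_zero hk)⟩

/-- Because `k ≥ 4`, the coefficients of `z ^ 0`, `z ^ 1`, `z ^ 2`, `z ^ 3` in a linear relation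
each involve only one component of the lift, so all coefficients of the relation vanish. -/
theorem isNondegenerate_psiCurve : IsNondegenerate (psiCurve hk) := by
  have h1 : (k : ℂ) - 1 ≠ 0 := by exact_mod_cast natCast_sub_ne_zero hk (m := 1) (by norm_num)
  have h2 : (k : ℂ) - 2 ≠ 0 := natCast_sub_ne_zero hk (m := 2) (by norm_num)
  have h4 := two_mul_sub_three_ne_zero hk
  intro l hl
  by_contra! h
  apply hl
  set c : Fin 4 → ℂ := fun i => l (Pi.single i 1) with hc
  have hlc : ∀ x : Fin 4 → ℂ, l x = x 0 * c 0 + x 1 * c 1 + x 2 * c 2 + x 3 * c 3 := by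
    intro x
    rw [LinearMap.pi_apply_eq_sum_univ l x, Fin.sum_univ_four]
    simp only [smul_eq_mul, hc]
    have : ∀ i : Fin 4, (fun j => if i = j then (1 : ℂ) else 0) = Pi.single i 1 := by
      intro i
      funext j
      simp [Pi.single_apply, eq_comm]
    simp only [this]
  have hz : C (c 0) * psiPoly k 0 + C (c 1) * psiPoly k 1 + C (c 2) * psiPoly k 2
      + C (c 3) * psiPoly k 3 = 0 := by
    apply Polynomial.funext
    intro z
    have h5 : l (polyVec (psiPoly k) z) = 0 :=
      h (z : CP1) (mem_submodule_mk (polyVec_psiPoly_ne_zero hk z))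
    rw [hlc] at h5
    simp only [eval_add, eval_mul, eval_C, eval_zero]
    simp only [polyVec] at h5
    linear_combination h5
  have hco := fun n => congrArg (fun p : ℂ[X] => p.coeff n) hz
  simp only [psiPoly, Matrix.cons_val_zero, Matrix.cons_val_one, Matrix.cons_val, coeff_add,
    coeff_C_mul, coeff_X_pow, coeff_zero] at hco
  have e0 := hco 0
  have e1 := hco 1
  have e2 := hco 2
  have e3 := hco 3
  have n0 : ∀ m, m < 4 → m ≠ k ∧ m ≠ 2 * k ∧ m ≠ k + 1 ∧ m ≠ k + 2 := fun m hm => by omega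
  obtain ⟨a0, b0, c0, d0⟩ := n0 0 (by norm_num)
  obtain ⟨a1, b1, c1, d1⟩ := n0 1 (by norm_num)
  obtain ⟨a2, b2, c2, d2⟩ := n0 2 (by norm_num)
  obtain ⟨a3, b3, c3, d3⟩ := n0 3 (by norm_num)
  simp only [if_neg a0, if_neg b0, if_neg c0, if_neg d0, if_true] at e0
  simp only [if_neg a1, if_neg b1, if_neg c1, if_neg d1, if_true] at e1
  simp only [if_neg a2, if_neg b2, if_neg c2, if_neg d2, if_true] at e2
  simp only [if_neg a3, if_neg b3, if_neg c3, if_neg d3, if_true] at e3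
  norm_num [h1, h2, h4] at e0 e1 e2 e3
  apply LinearMap.ext
  intro x
  rw [hlc, LinearMap.zero_apply]
  simp [e0, e1, e2, e3]

end ExplicitCurve

/-! ### Branch orders of the explicit contact curve -/

section BranchOrders

open Polynomial Filter

variable {k : ℕ} (hk : 4 ≤ k)
include hk

theorem polyVec_nullPoly_ne_zero (z : ℂ) : polyVec (nullPoly k) z ≠ 0 :=
  (nullData_explicit hk).vec_ne_zero z

theorem polyRev_nullPoly_ne_zero (w : ℂ) : polyRev (2 * k + 1) (nullPoly k) w ≠ 0 :=
  (nullData_explicit_reverse hk).vec_ne_zero w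

/-- The bivector of a nonzero vector is nonzero, so the order of vanishing is that of the scalar
factor. -/
theorem analyticOrderAt_smul_bivector {g : ℂ → ℂ} {x : ℂ → Fin 5 → ℂ} {z : ℂ}
    (hg : AnalyticAt ℂ g z) (hx : Differentiable ℂ x) (h0 : x z ≠ 0) :
    analyticOrderAt (fun w => g w • bivector k (x w)) z = analyticOrderAt g z := by
  have h2 : (k : ℂ) - 2 ≠ 0 := natCast_sub_ne_zero hk (m := 2) (by norm_num)
  have hb : AnalyticAt ℂ (fun w => bivector k (x w)) z :=
    ((bivectorCLM k).analyticAt _).comp (hx.analyticAt z)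
  have e : (fun w => g w • bivector k (x w)) = g • fun w => bivector k (x w) := rfl
  rw [e, analyticOrderAt_smul hg hb, hb.analyticOrderAt_eq_zero.2 (bivector_ne_zero h2 h0), add_zero]

theorem branchOrder_psiCurve (z : ℂ) : branchOrder (psiCurve hk) (z : CP1) =
    analyticOrderAt (fun w : ℂ => (z + w) ^ k - 1) 0 := by
  rw [(isLiftAt_psiCurve hk z).branchOrder_eq]
  have e : (fun w => wedge (chartLift (polyVec (psiPoly k)) (polyRev (2 * k) (psiPoly k)) (z : CP1) w)
      (deriv (chartLift (polyVec (psiPoly k)) (polyRev (2 * k) (psiPoly k)) (z : CP1)) w)) =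
      fun w => ((z + w) ^ k - 1) • bivector k (polyVec (nullPoly k) (z + w)) := by
    funext w
    change wedge (polyVec (psiPoly k) (z + w)) (deriv (fun w => polyVec (psiPoly k) (z + w)) w) = _
    rw [deriv_comp_const_add, wedge_polyVec_psiPoly hk]
  rw [e]
  exact analyticOrderAt_smul_bivector hk (by fun_prop)
    (differentiable_polyVec.comp (differentiable_id.const_add z)) (polyVec_nullPoly_ne_zero hk _)

theorem branchOrder_psiCurve_of_eq {z : ℂ} (hz : z ^ k = 1) :
    branchOrder (psiCurve hk) (z : CP1) = 1 := by
  rw [branchOrder_psiCurve]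
  have hd : HasDerivAt (fun w : ℂ => (z + w) ^ k - 1) (k * (z + 0) ^ (k - 1) * 1) 0 :=
    (((hasDerivAt_id (0 : ℂ)).const_add z).pow k).sub_const 1
  refine AnalyticAt.analyticOrderAt_eq_one_of_zero_deriv_ne_zero (by fun_prop) (by simp [hz]) ?_
  rw [hd.deriv, add_zero, mul_one]
  have hz0 : z ≠ 0 := by
    rintro rfl
    rw [zero_pow (by omega)] at hz
    exact zero_ne_one hz
  exact mul_ne_zero (Nat.cast_ne_zero.2 (by omega)) (pow_ne_zero _ hz0)

theorem branchOrder_psiCurve_of_ne {z : ℂ} (hz : z ^ k ≠ 1) :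
    branchOrder (psiCurve hk) (z : CP1) = 0 := by
  rw [branchOrder_psiCurve, AnalyticAt.analyticOrderAt_eq_zero (by fun_prop), add_zero]
  exact sub_ne_zero.2 hz

theorem branchOrder_psiCurve_infty :
    branchOrder (psiCurve hk) OnePoint.infty = ((k - 3 : ℕ) : ℕ∞) := by
  rw [(isLiftAt_psiCurve hk OnePoint.infty).branchOrder_eq]
  have e : (fun w => wedge (chartLift (polyVec (psiPoly k)) (polyRev (2 * k) (psiPoly k))
      OnePoint.infty w) (deriv (chartLift (polyVec (psiPoly k)) (polyRev (2 * k) (psiPoly k))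
      OnePoint.infty) w)) = fun w => (-(w ^ (k - 3) * (1 - w ^ k))) •
        bivector k (polyRev (2 * k + 1) (nullPoly k) w) :=
    funext (wedge_polyRev_psiPoly hk)
  rw [e, analyticOrderAt_smul_bivector hk (by fun_prop) differentiable_polyRev
    (polyRev_nullPoly_ne_zero hk 0), AnalyticAt.analyticOrderAt_eq_natCast (by fun_prop)]
  refine ⟨fun w => -(1 - w ^ k), by fun_prop, ?_, Eventually.of_forall fun w => ?_⟩
  · change -(1 - (0 : ℂ) ^ k) ≠ 0
    rw [zero_pow (by omega), sub_zero]
    exact neg_ne_zero.2 one_ne_zero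
  · rw [sub_zero, smul_eq_mul]
    ring

theorem finsum_branchOrder_psiCurve :
    ∑ᶠ p : CP1, branchOrder (psiCurve hk) p = ((2 * k - 3 : ℕ) : ℕ∞) := by
  classical
  have hr : ∀ z : ℂ, z ∈ nthRootsFinset k (1 : ℂ) ↔ z ^ k = 1 := fun z =>
    mem_nthRootsFinset (by omega) 1
  have hcard : (nthRootsFinset k (1 : ℂ)).card = k :=
    (Complex.isPrimitiveRoot_exp k (by omega)).card_nthRootsFinset
  set s : Finset CP1 := (nthRootsFinset k (1 : ℂ)).map
    ⟨((↑) : ℂ → CP1), OnePoint.coe_injective⟩ with hs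
  have hinf : OnePoint.infty ∉ s := by
    rw [hs, Finset.mem_map]
    rintro ⟨z, -, hz⟩
    exact OnePoint.coe_ne_infty z hz
  -- The support lies among infinity and the `k` distinct roots of unity, giving `(k - 3) + k`.
  rw [finsum_eq_sum_of_support_subset (s := insert OnePoint.infty s), Finset.sum_insert hinf,
    branchOrder_psiCurve_infty, hs, Finset.sum_map]
  · refine (congrArg _ (Finset.sum_congr rfl fun z hz =>
      branchOrder_psiCurve_of_eq hk ((hr z).1 hz))).trans ?_
    rw [Finset.sum_const, hcard, nsmul_one]
    norm_cast
    omega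
  · intro p hp
    rw [Finset.coe_insert, Set.mem_insert_iff]
    induction p using OnePoint.rec with
    | infty => exact Or.inl rfl
    | coe z =>
      refine Or.inr (Finset.mem_coe.2 (Finset.mem_map.2 ⟨z, (hr z).2 ?_, rfl⟩))
      by_contra hz
      exact hp (branchOrder_psiCurve_of_ne hk hz)

end BranchOrders

/-! ### The second associated curve -/

section SecondCurve

open Polynomial Filter

instance : CompleteSpace W := FiniteDimensional.complete ℂ W

theorem map_mem_map_submodule {V U : Type*} [NormedAddCommGroup V] [NormedSpace ℂ V]
    [NormedAddCommGroup U] [NormedSpace ℂ U] {c : Projectivization ℂ V} {x : V}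
    (hx : x ∈ c.submodule) (T : V →ₗ[ℂ] U) (hT : Function.Injective T) :
    T x ∈ (c.map T hT).submodule := by
  induction c using Projectivization.ind with
  | h y hy =>
    obtain ⟨a, rfl⟩ := exists_eq_smul_of_mem (mem_submodule_mk hy) hy hx
    rw [map_smul, Projectivization.map_mk]
    exact Submodule.smul_mem _ _ (mem_submodule_mk _)

theorem kleinForm_comb (a b : ℂ) (x y : W) : kleinForm (a • x + b • y) (a • x + b • y) =
    a ^ 2 * kleinForm x x + 2 * (a * b) * kleinForm x y + b ^ 2 * kleinForm y y := by
  simp only [kleinForm, Submodule.coe_add, Submodule.coe_smul, Pi.add_apply, Pi.smul_apply,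
    smul_eq_mul]
  ring

variable {k : ℕ} (hk : 4 ≤ k) {s : ℂ} (hs : s ^ 2 = 1 / 2)

include hk in
theorem sub_two_ne_zero : (k : ℂ) - 2 ≠ 0 := natCast_sub_ne_zero hk (m := 2) (by norm_num)

include hs in
theorem ne_zero_of_sq_eq_half : s ≠ 0 := by
  rintro rfl
  norm_num at hs

/-- The isometry `W → ℂ⁵` adapted to the explicit curve. -/
def explicitIsometry : W ≃L[ℂ] (Fin 5 → ℂ) :=
  (kleinEquiv (sub_two_ne_zero hk) (ne_zero_of_sq_eq_half hs)).toContinuousLinearEquiv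

theorem explicitIsometry_symm_coe (x : Fin 5 → ℂ) :
    ((explicitIsometry hk hs).symm x).1 = s⁻¹ • bivector k x :=
  kleinEquiv_symm_apply (sub_two_ne_zero hk) (ne_zero_of_sq_eq_half hs) x

theorem form5_explicitIsometry (η ξ : W) :
    form5 (explicitIsometry hk hs η) (explicitIsometry hk hs ξ) = kleinForm η ξ :=
  form5_kleinEquiv (sub_two_ne_zero hk) (ne_zero_of_sq_eq_half hs) hs η ξ

/-- The lift of the second associated curve. -/
def secondLift (z : ℂ) : W := (explicitIsometry hk hs).symm (polyVec (nullPoly k) z)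

/-- The lift of the second associated curve at infinity. -/
def secondRev (w : ℂ) : W := (explicitIsometry hk hs).symm (polyRev (2 * k + 1) (nullPoly k) w)

theorem secondLift_ne_zero (z : ℂ) : secondLift hk hs z ≠ 0 := fun h =>
  polyVec_nullPoly_ne_zero hk z ((ContinuousLinearEquiv.map_eq_zero_iff _).1 h)

theorem secondRev_ne_zero (w : ℂ) : secondRev hk hs w ≠ 0 := fun h =>
  polyRev_nullPoly_ne_zero hk w ((ContinuousLinearEquiv.map_eq_zero_iff _).1 h)

/-- The second associated curve of the explicit curve. -/
def secondCurve : CP1 → Projectivization ℂ W :=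
  curveOfCharts (secondLift hk hs) (secondRev hk hs) (secondLift_ne_zero hk hs)
    (secondRev_ne_zero hk hs 0)

theorem isLiftAt_secondCurve (p : CP1) : IsLiftAt (secondCurve hk hs) p
    (chartLift (secondLift hk hs) (secondRev hk hs) p) :=
  isLiftAt_chartLift
    ((explicitIsometry hk hs).symm.differentiable.comp differentiable_polyVec)
    ((explicitIsometry hk hs).symm.differentiable.comp differentiable_polyRev) (d := 2 * k + 1)
    (fun w hw => by
      change (explicitIsometry hk hs).symm _ = _ • (explicitIsometry hk hs).symm _
      rw [polyRev_eq (natDegree_nullPoly_le hk) w hw, map_smul]) p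

theorem isSecondAssociatedCurve_secondCurve :
    IsSecondAssociatedCurve (psiCurve hk) (secondCurve hk hs) := by
  refine isSecondAssociatedCurve_of_lifts (isLiftAt_psiCurve hk)
    (fun p => ⟨_, isLiftAt_secondCurve hk hs p⟩) fun p => ?_
  obtain ⟨g, hg⟩ := exists_wedge_chartLift hk p
  filter_upwards [(isLiftAt_secondCurve hk hs p).2.2] with w hw
  rw [hg]
  -- The extra factor `s` undoes the `s⁻¹` in the inverse isometry.
  refine ⟨_, Submodule.smul_mem _ (g w * s) hw, ?_⟩
  have e : ∀ x : Fin 5 → ℂ, W.subtype ((g w * s) • (explicitIsometry hk hs).symm x) =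
      g w • bivector k x := by
    intro x
    change (g w * s) • ((explicitIsometry hk hs).symm x).1 = _
    rw [explicitIsometry_symm_coe, smul_smul, mul_inv_cancel_right₀ (ne_zero_of_sq_eq_half hs)]
  cases p with
  | none => exact e _
  | some z => exact e _

/-- The isometry transports the three relations for `form5` along the null curve to `kleinForm`;
being constant and linear, it commutes with the derivative. -/
theorem isNullCurve_secondCurve : IsNullCurve kleinForm (secondCurve hk hs) := by
  have key : ∀ {f : ℂ → Fin 5 → ℂ}, Differentiable ℂ f → (∀ z, form5 (f z) (f z) = 0) →
      (∀ z, form5 (f z) (deriv f z) = 0) → (∀ z, form5 (deriv f z) (deriv f z) = 0) → ∀ z,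
      ∀ᶠ w in 𝓝 z, (fun x y => kleinForm x x = 0 ∧ kleinForm x y = 0 ∧ kleinForm y y = 0)
        ((fun z => (explicitIsometry hk hs).symm (f z)) w)
        (deriv (fun z => (explicitIsometry hk hs).symm (f z)) w) := by
    intro f hf h1 h2 h3 z
    refine Eventually.of_forall fun w => ?_
    have hd : deriv (fun z => (explicitIsometry hk hs).symm (f z)) w =
        (explicitIsometry hk hs).symm (deriv f w) :=
      ((explicitIsometry hk hs).symm.hasFDerivAt.comp_hasDerivAt w (hf w).hasDerivAt).deriv
    simp only [hd, ← form5_explicitIsometry hk hs, ContinuousLinearEquiv.apply_symm_apply]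
    exact ⟨h1 w, h2 w, h3 w⟩
  have h0 := nullData_explicit hk
  have h1 := nullData_explicit_reverse hk
  refine isNullCurve_of_lifts kleinForm_comb (isLiftAt_secondCurve hk hs) fun p => ?_
  exact forall_chartLift (A := fun X z => ∀ᶠ w in 𝓝 z,
    (fun x y => kleinForm x x = 0 ∧ kleinForm x y = 0 ∧ kleinForm y y = 0) (X w) (deriv X w))
    (fun X z h => eventually_deriv_comp_add
      (A := fun x y => kleinForm x x = 0 ∧ kleinForm x y = 0 ∧ kleinForm y y = 0) h)
    (key differentiable_polyVec h0.form5_self h0.form5_deriv h0.form5_deriv_deriv)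
    (key differentiable_polyRev h1.form5_self h1.form5_deriv h1.form5_deriv_deriv 0) p

theorem mem_map_secondCurve (z : ℂ) : polyVec (nullPoly k) z ∈
    ((secondCurve hk hs (z : CP1)).map (explicitIsometry hk hs).toLinearEquiv.toLinearMap
      (explicitIsometry hk hs).toLinearEquiv.injective).submodule := by
  have := map_mem_map_submodule (mem_submodule_mk (secondLift_ne_zero hk hs z))
    (explicitIsometry hk hs).toLinearEquiv.toLinearMap (explicitIsometry hk hs).toLinearEquiv.injective
  have e : (explicitIsometry hk hs).toLinearEquiv.toLinearMap (secondLift hk hs z) =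
      polyVec (nullPoly k) z := (explicitIsometry hk hs).apply_symm_apply _
  rwa [e] at this

theorem mem_map_secondCurve_infty : polyRev (2 * k + 1) (nullPoly k) 0 ∈
    ((secondCurve hk hs OnePoint.infty).map (explicitIsometry hk hs).toLinearEquiv.toLinearMap
      (explicitIsometry hk hs).toLinearEquiv.injective).submodule := by
  have := map_mem_map_submodule (mem_submodule_mk (secondRev_ne_zero hk hs 0))
    (explicitIsometry hk hs).toLinearEquiv.toLinearMap (explicitIsometry hk hs).toLinearEquiv.injective
  have e : (explicitIsometry hk hs).toLinearEquiv.toLinearMap (secondRev hk hs 0) =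
      polyRev (2 * k + 1) (nullPoly k) 0 := (explicitIsometry hk hs).apply_symm_apply _
  rwa [e] at this

theorem hasDegree_map_secondCurve :
    HasDegree (fun p => (secondCurve hk hs p).map (explicitIsometry hk hs).toLinearEquiv.toLinearMap
      (explicitIsometry hk hs).toLinearEquiv.injective) (2 * k + 1) := by
  refine ⟨nullPoly k, natDegree_nullPoly_le hk, fun z => ⟨polyVec_nullPoly_ne_zero hk z,
    mem_map_secondCurve hk hs z⟩, ?_⟩
  rw [← polyRev_zero]
  exact ⟨polyRev_nullPoly_ne_zero hk 0, mem_map_secondCurve_infty hk hs⟩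

theorem branchOrder_map_secondCurve (p : CP1) :
    branchOrder (fun p => (secondCurve hk hs p).map
      (explicitIsometry hk hs).toLinearEquiv.toLinearMap
      (explicitIsometry hk hs).toLinearEquiv.injective) p = 0 := by
  have hl := (isLiftAt_secondCurve hk hs p).map (explicitIsometry hk hs).toContinuousLinearMap
    (explicitIsometry hk hs).toLinearEquiv.injective
  have e : (fun w => (explicitIsometry hk hs).toContinuousLinearMap
      (chartLift (secondLift hk hs) (secondRev hk hs) p w)) =
      chartLift (polyVec (nullPoly k)) (polyRev (2 * k + 1) (nullPoly k)) p := by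
    funext w
    cases p with
    | none => exact (explicitIsometry hk hs).apply_symm_apply _
    | some z => exact (explicitIsometry hk hs).apply_symm_apply _
  rw [e] at hl
  refine hl.branchOrder_eq.trans ((analyticAt_wedge hl.1).analyticOrderAt_eq_zero.2 ?_)
  refine forall_chartLift (A := fun X z => wedge (X z) (deriv X z) ≠ 0) (fun X z h => ?_)
    (nullData_explicit hk).wedge_ne_zero ((nullData_explicit_reverse hk).wedge_ne_zero 0) p
  rw [deriv_comp_const_add]
  simpa using h

end SecondCurve

/-! ### The explicit Willmore sphere -/

section ExplicitSphere

open Polynomial Filter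

theorem surfDenom_eq {k : ℕ} (hk : 4 ≤ k) (z : ℂ) :
    surfDenom k z = -12 * (k - 3) * (nullPoly k 4).eval z := by
  have h3 : (k : ℂ) - 3 ≠ 0 := natCast_sub_ne_zero hk (m := 3) (by norm_num)
  rw [eval_nullPoly, surfDenom]
  simp only [nullVec, Matrix.cons_val]
  field_simp
  ring

theorem surfF_eq {k : ℕ} (hk : 4 ≤ k) {z : ℂ} (h4 : (nullPoly k 4).eval z ≠ 0) (j : Fin 3) :
    surfF k z j = (nullPoly k j.succ.castSucc).eval z / (nullPoly k 4).eval z := by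
  have h3 : (k : ℂ) - 3 ≠ 0 := natCast_sub_ne_zero hk (m := 3) (by norm_num)
  have hD : -12 * ((k : ℂ) - 3) * (nullPoly k 4).eval z ≠ 0 :=
    mul_ne_zero (mul_ne_zero (by norm_num) h3) h4
  rw [eq_div_iff h4]
  have key : ∀ a : ℂ, a / (-12 * ((k : ℂ) - 3) * (nullPoly k 4).eval z) * (nullPoly k 4).eval z =
      a / (-12 * ((k : ℂ) - 3)) := by
    intro a
    field_simp
  fin_cases j
  · change _ / surfDenom k z * _ = (nullPoly k 1).eval z
    rw [surfDenom_eq hk, key, eval_nullPoly]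
    simp only [nullVec, Matrix.cons_val_one, Matrix.cons_val_zero]
    field_simp
    ring
  · change _ / surfDenom k z * _ = (nullPoly k 2).eval z
    rw [surfDenom_eq hk, key, eval_nullPoly]
    simp only [nullVec, Matrix.cons_val]
    field_simp
    ring
  · change _ / surfDenom k z * _ = (nullPoly k 3).eval z
    rw [surfDenom_eq hk, key, eval_nullPoly]
    simp only [nullVec, Matrix.cons_val]
    field_simp
    ring

theorem Psi_surfF {k : ℕ} (hk : 4 ≤ k) {z : ℂ} (h4 : (nullPoly k 4).eval z ≠ 0) :
    Psi (surfF k z) = ((nullPoly k 4).eval z)⁻¹ • polyVec (nullPoly k) z := by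
  have hq := (nullData_explicit hk).quadric z
  have h0 := surfF_eq hk h4 0
  have h1 := surfF_eq hk h4 1
  have h2 := surfF_eq hk h4 2
  change _ = (nullPoly k 1).eval z / _ at h0
  change _ = (nullPoly k 2).eval z / _ at h1
  change _ = (nullPoly k 3).eval z / _ at h2
  funext i
  fin_cases i
  -- The coordinate `½ (F₁² + F₂² + F₃²)` equals `p₀ / p₄` by the quadric.
  · simp only [Psi, h0, h1, h2, polyVec, Pi.smul_apply, smul_eq_mul, Fin.zero_eta,
      Matrix.cons_val_zero]
    field_simp
    linear_combination hq
  · simp [Psi, h0, polyVec, div_eq_inv_mul]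
  · simp [Psi, h1, polyVec, div_eq_inv_mul]
  · simp [Psi, h2, polyVec, div_eq_inv_mul]
  · simp [Psi, polyVec, h4]

/-- The number of ends of a rational null curve. -/
theorem NullData.encard_zeros {p : Fin 5 → ℂ[X]} {P Q : ℂ → ℂ} {κ : ℂ}
    (h : NullData (fun j z => (p j).eval z) P Q κ) (h0 : p 4 ≠ 0) :
    {z : ℂ | (p 4).eval z = 0}.encard = (p 4).natDegree := by
  classical
  -- A multiple root would be a common zero of `p 4` and its derivative; with simple roots over `ℂ`
  -- their number is the degree.
  have hn : (p 4).roots.Nodup := by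
    rw [Multiset.nodup_iff_count_le_one]
    intro z
    rw [count_roots]
    by_contra! h1
    have h2 := (one_lt_rootMultiplicity_iff_isRoot h0).1 h1
    refine h.deriv_ne_zero (z := z) h2.1 ?_
    rw [Polynomial.deriv]
    exact h2.2
  have hs : {z : ℂ | (p 4).eval z = 0} = ((p 4).roots.toFinset : Set ℂ) := by
    ext z
    simp [h0]
  rw [hs, Set.encard_coe_eq_coe_finsetCard, Multiset.toFinset_card_of_nodup hn,
    IsAlgClosed.card_roots_eq_natDegree]

/-- The explicit Willmore sphere. -/
def willmoreSphere (k : ℕ) : CP1 → E4 :=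
  glueCharts (nullSphere fun j z => (nullPoly k j).eval z)
    (nullSphere fun j => revEval (2 * k + 1) (nullPoly k j))

variable {k : ℕ} (hk : 4 ≤ k)
include hk

theorem chart₁_willmoreSphere : chart₁ (willmoreSphere k) =
    nullSphere fun j => revEval (2 * k + 1) (nullPoly k j) :=
  chart₁_glueCharts fun _ hw => nullSphere_congr (pow_ne_zero (2 * k + 1) hw)
    fun j => revEval_eq (natDegree_nullPoly_le hk j) hw

theorem willmoreSphere_eq_northPole_iff (z : ℂ) :
    willmoreSphere k (z : CP1) = northPole ↔ (nullPoly k 4).eval z = 0 :=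
  (nullData_explicit hk).nullSphere_eq_northPole_iff z

/-- The polynomial `p₄` has coefficient `1` in the full degree `2 k + 1`, so infinity is not an end.
-/
theorem willmoreSphere_infty_ne : willmoreSphere k OnePoint.infty ≠ northPole := by
  intro h
  have h1 := ((nullData_explicit_reverse hk).nullSphere_eq_northPole_iff 0).1 h
  rw [revEval_zero, coeff_nullPoly_four hk] at h1
  exact one_ne_zero h1

theorem encard_ends : {p | willmoreSphere k p = northPole}.encard = ((2 * k + 1 : ℕ) : ℕ∞) := by
  have hc := coeff_nullPoly_four hk
  have h0 : nullPoly k 4 ≠ 0 := by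
    intro h
    rw [h, coeff_zero] at hc
    exact zero_ne_one hc
  have hdeg : (nullPoly k 4).natDegree = 2 * k + 1 :=
    le_antisymm (natDegree_nullPoly_le hk 4) (le_natDegree_of_ne_zero (by rw [hc]; exact one_ne_zero))
  have hs : {p | willmoreSphere k p = northPole} =
      ((↑) : ℂ → CP1) '' {z : ℂ | (nullPoly k 4).eval z = 0} := by
    ext p
    induction p using OnePoint.rec with
    | infty =>
      refine iff_of_false (willmoreSphere_infty_ne hk) ?_
      rintro ⟨z, -, hz⟩
      exact OnePoint.coe_ne_infty z hz
    | coe z =>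
      rw [Set.mem_ofPred_eq, willmoreSphere_eq_northPole_iff hk, OnePoint.coe_injective.mem_set_image]
      rfl
  rw [hs, OnePoint.coe_injective.encard_image, (nullData_explicit hk).encard_zeros h0, hdeg]

theorem isMinimalSurface_willmoreSphere :
    IsMinimalSurfaceWithPlanarEnds (willmoreSphere k) (2 * k + 1) := by
  have h0 := nullData_explicit hk
  have h1 := nullData_explicit_reverse hk
  have e₁ := chart₁_willmoreSphere hk
  refine ⟨isSphericalImmersion_of_nullData h0 h1 rfl e₁, fun p =>
    (isConformalImmersionAt_of_nullData h0 h1 rfl e₁ p).conformalAt, ?_,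
    minimal_of_nullData h0 h1 rfl e₁⟩
  exact_mod_cast encard_ends hk

theorem stereo_willmoreSphere {z : ℂ} (hz : surfDenom k z ≠ 0) :
    stereo (willmoreSphere k (z : CP1)) = WithLp.toLp 2 (fun i => (surfF k z i).re) := by
  rw [surfDenom_eq hk] at hz
  have h4 := right_ne_zero_of_mul hz
  refine ((nullData_explicit hk).stereo_nullSphere h4).trans ?_
  ext i
  change ((nullPoly k i.succ.castSucc).eval z / (nullPoly k 4).eval z).re = _
  rw [← surfF_eq hk h4]

theorem isWillmoreSphere_willmoreSphere : IsWillmoreSphere (willmoreSphere k) :=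
  isWillmoreSphere_of_nullData (nullData_explicit hk) (nullData_explicit_reverse hk) rfl
    (chart₁_willmoreSphere hk)

theorem willmoreEnergy_willmoreSphere : willmoreEnergy (willmoreSphere k) = 8 * Real.pi * k := by
  have h0 := nullData_explicit hk
  have h1 := nullData_explicit_reverse hk
  rw [willmoreEnergy_of_nullData h0 h1 rfl (chart₁_willmoreSphere hk)]
  -- The spinor has degree `2 k`, so the Gauss map covers the sphere `2 k` times and the energy is
  -- `4 π * 2 k`.
  refine (integral_spinDensity h0.differentiable_left h0.differentiable_right h0.spinor_ne_zero
    (n := 2 * k) h1.differentiable_left h1.differentiable_right h1.spinor_ne_zero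
    (fun w hw => revEval_eq (natDegree_psiPoly_le hk 1) hw)
    (fun w hw => revEval_eq (natDegree_psiPoly_le hk 3) hw)).trans ?_
  push_cast
  ring

end ExplicitSphere

end WillmoreSphere

end

theorem mainTheorem2 (k : ℕ) (hk : 4 ≤ k) :
    -- the lift defines a unique rational curve
    (∃! ψ : CP1 → Projectivization ℂ (Fin 4 → ℂ), IsCurveOfLift (psiLift k) ψ) ∧
    ∀ ψ : CP1 → Projectivization ℂ (Fin 4 → ℂ), IsCurveOfLift (psiLift k) ψ →
      IsNondegenerate ψ ∧ HasDegree ψ (2 * k) ∧ IsContactCurve ψ ∧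
      -- branch points and branch orders
      (∀ z : ℂ, z ^ k = 1 → branchOrder ψ (z : CP1) = 1) ∧
      branchOrder ψ OnePoint.infty = ((k - 3 : ℕ) : ℕ∞) ∧
      (∀ z : ℂ, z ^ k ≠ 1 → branchOrder ψ (z : CP1) = 0) ∧
      ∑ᶠ p : CP1, branchOrder ψ p = ((2 * k - 3 : ℕ) : ℕ∞) ∧
      -- the second associated curve is an unbranched null curve of degree `2 k + 1`; in a suitable
      -- isometric identification of `W` with `ℂ⁵` it is the image of `surfF k` under `Psi`
      (∃ (ψ₂ : CP1 → Projectivization ℂ W) (T : W ≃ₗ[ℂ] (Fin 5 → ℂ)),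
        IsSecondAssociatedCurve ψ ψ₂ ∧ IsNullCurve kleinForm ψ₂ ∧
        (∀ η ξ : W, form5 (T η) (T ξ) = kleinForm η ξ) ∧
        HasDegree (fun p => (ψ₂ p).map T.toLinearMap T.injective) (2 * k + 1) ∧
        (∀ p : CP1, branchOrder (fun p => (ψ₂ p).map T.toLinearMap T.injective) p = 0) ∧
        (∀ z : ℂ, surfDenom k z ≠ 0 →
          Psi (surfF k z) ∈ ((ψ₂ (z : CP1)).map T.toLinearMap T.injective).submodule)) ∧
      -- the real part of `surfF k` is a minimal surface with `2 k + 1` embedded planar ends, and its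
      -- compactification in the 3-sphere is a Willmore sphere of energy `8 π k`
      (∃ φ : CP1 → E4,
        IsMinimalSurfaceWithPlanarEnds φ (2 * k + 1) ∧
        (∀ z : ℂ, φ (z : CP1) = northPole ↔ surfDenom k z = 0) ∧
        (∀ z : ℂ, surfDenom k z ≠ 0 →
          stereo (φ (z : CP1)) = WithLp.toLp 2 (fun i => (surfF k z i).re)) ∧
        IsWillmoreSphere φ ∧
        willmoreEnergy φ = 8 * Real.pi * k) := by
  have h3 : (k : ℂ) - 3 ≠ 0 := natCast_sub_ne_zero hk (m := 3) (by norm_num)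
  -- Either square root of `1 / 2` will do; it normalizes the identification of `W` with `ℂ⁵` to an
  -- isometry.
  obtain ⟨s, hs⟩ := IsAlgClosed.exists_pow_nat_eq (1 / 2 : ℂ) (n := 2) two_pos
  have hD : ∀ z, surfDenom k z ≠ 0 ↔ (nullPoly k 4).eval z ≠ 0 := fun z => by
    rw [surfDenom_eq hk, mul_ne_zero_iff, and_iff_right (mul_ne_zero (by norm_num) h3)]
  refine ⟨⟨psiCurve hk, isCurveOfLift_psiCurve hk, fun ψ hψ => eq_psiCurve hk hψ⟩,
    fun ψ hψ => ?_⟩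
  obtain rfl := eq_psiCurve hk hψ
  refine ⟨isNondegenerate_psiCurve hk, hasDegree_psiCurve hk, isContactCurve_psiCurve hk,
    fun z => branchOrder_psiCurve_of_eq hk, branchOrder_psiCurve_infty hk,
    fun z => branchOrder_psiCurve_of_ne hk, finsum_branchOrder_psiCurve hk,
    ⟨secondCurve hk hs, (explicitIsometry hk hs).toLinearEquiv,
      isSecondAssociatedCurve_secondCurve hk hs, isNullCurve_secondCurve hk hs,
      form5_explicitIsometry hk hs, hasDegree_map_secondCurve hk hs,
      branchOrder_map_secondCurve hk hs, fun z hz => ?_⟩,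
    willmoreSphere k, isMinimalSurface_willmoreSphere hk, fun z => ?_,
    fun z hz => stereo_willmoreSphere hk hz, isWillmoreSphere_willmoreSphere hk,
    willmoreEnergy_willmoreSphere hk⟩
  · rw [Psi_surfF hk ((hD z).1 hz)]
    exact Submodule.smul_mem _ _ (mem_map_secondCurve hk hs z)
  · rw [willmoreSphere_eq_northPole_iff hk]
    exact (not_iff_not.1 (hD z)).symm
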